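/- **Setting (chain).** Fix $D>0$, $v\in\mathbb R$, $L>0$ and an integer $k\ge 1$. A *UOFP-type triadic multibaker chain* has sites $A_n=[0,\Delta r]\times[0,h]$, $0\le n\le N$, with $N\Delta r=L$, and a time step $\tau>0$. Put $\beta=2\tau D/\Delta r^2$ and $Pe_g=v\Delta r/D$. On the sites $0<n<N$ the transition probabilities are $\eta(0)=\frac\beta2(1-\frac{Pe_g}2)$, $\eta(1)=1-\beta$, $\eta(2)=\frac\beta2(1+\frac{Pe_g}2)$, all positive; on the boundary sites $0,N$ other positive probabilities $\eta_0,\eta_N$ with sum $1$ are given; $\nu_n(\omega)=\eta_n(2-\omega)$. For $0<n<N$ the map is $$T(n,x,y)=\begin{cases}(n-1,\ x/\eta_n(0),\ \nu_{n-1}(0)y), & 0\le x<\eta_n(0)\Delta r,\\ (n,\ (x-\eta_n(0)\Delta r)/\eta_n(1),\ \nu_n(0)h+\nu_n(1)y), & \eta_n(0)\Delta r\le x<(\eta_n(0)+\eta_n(1))\Delta r,\\ (n+1,\ (x-(\eta_n(0)+\eta_n(1))\Delta r)/\eta_n(2),\ (\nu_{n+1}(0)+\nu_{n+1}(1))h+\nu_{n+1}(2)y),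 & \text{otherwise,}\end{cases}$$ and on the boundary sites $T$ is any measurable map of $A_0$ into $A_0\cup A_1$ and of $A_N$ into $A_{N-1}\cup A_N$. The Markov partition consists of the cells $(n,\omega_0\cdots\omega_{k-1})$, $\omega_i\in\{0,1,2\}$: rectangles of width $\Delta r$ and height $h\,\nu_n(\omega_0)\nu_{n+1-\omega_0}(\omega_1)\cdots$ (site indices truncated to $0,\dots,N$), stacked on each site from bottom to top in the numerical order of $\omega_0\cdots\omega_{k-1}$. For cells $i,j$ let $\Delta V_i$ be the area of $i$, $W_{ji}=|i\cap T^{-1}j|/\Delta V_i$, $\tilde W_{ji}=W_{ji}\Delta V_i$, $e_i=\Delta V_i/\sum_j\tilde W_{ij}$. From a probability vector $P^{(0)}$ on the cells, $P^{(l+1)}_j=\sum_iW_{ji}P^{(l)}_i$; the local densities are $\rho^{(l)}_i=P^{(l)}_i/\Delta V_i$, and $\rho_n^{(l)}$ is the total probability of the site $n$ divided by its area. **Local quantity.** Let $J\subset\mathbb R$ be open and let $f$ be $C^\infty$ on $J\times J$, symmetric or antisymmetric, with characteristic exponent $m\in\{0,1,2,\dots\}$ and characteristic function $\hat C$, not identically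 zero on $J$: $\lim_{a\to0}f(x+sa,x+ta)/(\frac{s-t}2a)^m=\hat C(x)$ for all $x\in J$ and real $s\ne t$. For $\epsilon,\delta\in\{1,-1\}$ put $$A^{(l)}_i=\sum_j\big[(1+\delta e_j)\tilde W_{ji}+\epsilon(1+\delta e_i)\tilde W_{ij}\big]f(\rho^{(l)}_j,\rho^{(l)}_i),\qquad \langle A\rangle^{(l)}_{A_n}=\frac1{\tau\,\Delta r\,h}\sum_{i\subset A_n}A^{(l)}_i .$$ **Limit.** Consider a sequence of such chains with $\Delta r\to0$ ($D,v,L,k$ fixed; $h$, $\tau$, boundary dynamics and $P^{(0)}$ may vary along the sequence). Assume the site densities are interpolated by functions $u$ (one for each chain), $\rho_n^{(l)}=u(n\Delta r,l\tau)$, such that near a point $(r,t)$ the function $u$ is eventually $C^3$ in position and $\partial_r^au$, $0\le a\le3$, evaluated at points tending to $(r,t)$, tends to $\partial_r^a\rho(r,t)$ for a macroscopic density $\rho$ with $\rho(r,t)\in J$. Let $(n,l)$ be bulk sites and times ($k+1<n$, $n+k+1<N$, $l>k$) with $n\Delta r\to r$, $l\tau\to t$. Write $\rho_n=\rho_n^{(l)}$,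 $\rho_r,\rho_{rr},\rho_{rrr}$ for $\partial_r^au(n\Delta r,l\tau)$, $a=1,2,3$, $V=v/D$, and $\hat C,\hat C_\rho,\hat C_{\rho\rho}$ for the value and the first two derivatives of $\hat C$ at $\rho_n$. Let $S_\nu(0)=1$, $S_\nu(a)=\beta Pe_g/2$ for odd $a$, $S_\nu(a)=\beta$ for even $a\ne0$. Put $X^{(1)}_{1,0}=X^{(2)}_{1,0}=X_{1,0}=V\rho_n$; $X^{(1)}_{0,1}=X^{(2)}_{0,1}=X_{0,1}=-V\rho_n+\rho_r$; $X^{(1)}_{2,0}=V^2\rho_n$; $X^{(2)}_{2,0}=V^2\rho_n-2V\rho_r$; $X^{(1)}_{1,1}=0$; $X^{(2)}_{1,1}=2V\rho_r-2\rho_{rr}$; $X^{(1)}_{0,2}=X^{(2)}_{0,2}=-V^2\rho_n+2V\rho_r-\rho_{rr}$; $X^{(1)}_{3,0}=V^3\rho_n$; $X^{(2)}_{3,0}=V^3\rho_n-2V^2\rho_r+2V\rho_{rr}$; $X^{(1)}_{2,1}=0$; $X^{(2)}_{2,1}=-2V\rho_{rr}+2\rho_{rrr}$; $X^{(1)}_{1,2}=0$;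 $X^{(2)}_{1,2}=2V^2\rho_r-4V\rho_{rr}+2\rho_{rrr}$; $X^{(1)}_{0,3}=X^{(2)}_{0,3}=-V^3\rho_n+2V^2\rho_r-2V\rho_{rr}+\frac23\rho_{rrr}$; $Y^{(1)}_{1,0}=V\rho_n$; $Y^{(2)}_{1,0}=V\rho_n-2\rho_r$; $Y^{(1)}_{0,1}=Y^{(2)}_{0,1}=V\rho_n-\rho_r$; $Y^{(1)}_{2,0}=V^2\rho_n$; $Y^{(2)}_{2,0}=V^2\rho_n-2V\rho_r+2\rho_{rr}$; $Y^{(1)}_{1,1}=0$; $Y^{(2)}_{1,1}=-2V\rho_r+2\rho_{rr}$; $Y^{(1)}_{0,2}=Y^{(2)}_{0,2}=V^2\rho_n-2V\rho_r+\rho_{rr}$. An empty sum is $0$; $[\,E\,]_{\sigma}$ means $E^{(1)}+\sigma E^{(2)}$, where $E^{(i)}$ is $E$ with the superscript $(i)$ on every $X_{p,q}$, $Y_{p,q}$ in it. **Theorem (leading-order form).** Along the sequence, $\langle A\rangle^{(l)}_{A_n}$ has the following leading terms. *Case I-1* ($m$ even, $\epsilon=\delta=1$). If $m=0$: $\langle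 A\rangle^{(l)}_{A_n}=\dfrac{4\hat C}{\tau}+o(1/\tau)$. If $m=2m'>0$: $\langle A\rangle^{(l)}_{A_n}=c\,\Delta r^{m-2}+o(\Delta r^{m-2})$ with $$c=\frac{D\hat C}{2^{m-3}}\Big(X_{0,1}^m+X_{1,0}^m+\beta\sum_{p=1}^{m'-1}\binom m{2p}X_{1,0}^{2p}X_{0,1}^{2(m'-p)}\Big).$$ *Case II-1* ($m=2m'+1$, $\epsilon=-1$ or $\delta=1$). $\langle A\rangle^{(l)}_{A_n}=c\,\Delta r^{m-1}+o(\Delta r^{m-1})$ with $$\begin{aligned}c={}&-(1-\epsilon)\frac{v\hat C}{2^m}\Big[(\delta+1)\sum_{p=0}^{m'}\binom m{2p}X_{1,0}^{2p}X_{0,1}^{2(m'-p)+1}S_\nu(2p)+(\delta-1)\sum_{p=0}^{m'}\binom m{2p+1}X_{1,0}^{2p+1}X_{0,1}^{2(m'-p)}S_\nu(2(m'-p))\Big]\\ &+(\delta+1)\frac{D}{2^m}\hat C_\rho\Big[\sum_{p=0}^{m'}\binom m{2p}X_{1,0}^{2p}X_{0,1}^{2(m'-p)+1}[Y_{0,1}]_{-\epsilon}S_\nu(2p)+\sum_{p=0}^{m'}\binom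 m{2p+1}X_{1,0}^{2p+1}X_{0,1}^{2(m'-p)}[Y_{1,0}]_{-\epsilon}S_\nu(2(m'-p))\Big]\\ &+(\delta+1)\frac{mD}{2^m}\hat C\Big\{\sum_{p=0}^{m'}\binom{2m'}{2p}X_{1,0}^{2p}X_{0,1}^{2(m'-p)}\big[X_{2,0}S_\nu(2(m'-p))+X_{0,2}S_\nu(2p)\big]_{-\epsilon}+\beta\sum_{p=0}^{m'-1}\binom{2m'}{2p+1}X_{1,0}^{2p+1}X_{0,1}^{2(m'-p)-1}[X_{1,1}]_{-\epsilon}\Big\}.\end{aligned}$$ *Case I-2* ($m=2m'$, $m'\ge0$, not $\epsilon=\delta=1$). $\langle A\rangle^{(l)}_{A_n}=c\,\Delta r^{m}+o(\Delta r^{m})$ with $$\begin{aligned}c={}&\beta\frac{(1+\epsilon)(\delta-1)}{2^{m+1}}\frac{v^2\hat C}{D}\sum_{p=0}^{m'-1}\binom m{2p+1}X_{1,0}^{2p+1}X_{0,1}^{2(m'-p)-1}\\ &-\frac v{2^{m+1}}\hat C_\rho\Big\{\sum_{p=0}^{m'}\binom m{2p}X_{1,0}^{2p}X_{0,1}^{2(m'-p)}\big[(\delta+1)Y_{0,1}S_\nu(2p)+(\delta-1)Y_{1,0}S_\nu(2(m'-p))\big]_\epsilon\\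 &\qquad+\beta\sum_{p=0}^{m'-1}\binom m{2p+1}X_{1,0}^{2p+1}X_{0,1}^{2(m'-p)-1}\big[(\delta-1)Y_{0,1}+(\delta+1)Y_{1,0}\big]_\epsilon\Big\}\\ &-\frac{m}{2^{m+1}}v\hat C\Big\{\sum_{p=0}^{m'-1}\binom{m-1}{2p}X_{1,0}^{2p}X_{0,1}^{2(m'-p)-1}\big[(\delta+1)X_{0,2}S_\nu(2p)+\beta(\delta-1)X_{1,1}+\beta(\delta+1)X_{2,0}\big]_\epsilon\\ &\qquad+\sum_{p=0}^{m'-1}\binom{m-1}{2p+1}X_{1,0}^{2p+1}X_{0,1}^{2(m'-p-1)}\big[\beta(\delta-1)X_{0,2}+\beta(\delta+1)X_{1,1}+(\delta-1)X_{2,0}S_\nu(2(m'-p-1))\big]_\epsilon\Big\}\\ &+(\delta+1)\frac D{2^{m+1}}\Big\{\sum_{p=0}^{m'}\binom m{2p}X_{1,0}^{2p}X_{0,1}^{2(m'-p)}\Big(\hat C_\rho\big[Y_{0,2}S_\nu(2p)+Y_{2,0}S_\nu(2(m'-p))\big]_\epsilon+\tfrac12\hat C_{\rho\rho}\big[Y_{0,1}^2S_\nu(2p)+Y_{1,0}^2S_\nu(2(m'-p))\big]_\epsilon\Big)\\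 &\qquad+\beta\sum_{p=0}^{m'-1}\binom m{2p+1}X_{1,0}^{2p+1}X_{0,1}^{2(m'-p)-1}\Big(\hat C_\rho[Y_{1,1}]_\epsilon+\hat C_{\rho\rho}[Y_{0,1}Y_{1,0}]_\epsilon\Big)\Big\}\\ &+(\delta+1)\frac{mD}{2^{m+1}}\Big\{\sum_{p=0}^{m'-1}\binom{m-1}{2p}X_{1,0}^{2p}X_{0,1}^{2(m'-p)-1}\Big(\hat C_\rho\big[X_{0,2}Y_{0,1}S_\nu(2p)+\beta X_{1,1}Y_{1,0}+\beta X_{2,0}Y_{0,1}\big]_\epsilon+\hat C\big[X_{0,3}S_\nu(2p)+\beta X_{2,1}\big]_\epsilon\Big)\\ &\qquad+\sum_{p=0}^{m'-1}\binom{m-1}{2p+1}X_{1,0}^{2p+1}X_{0,1}^{2(m'-p-1)}\Big(\hat C_\rho\big[\beta X_{0,2}Y_{1,0}+\beta X_{1,1}Y_{0,1}+X_{2,0}Y_{1,0}S_\nu(2(m'-p-1))\big]_\epsilon+\hat C\big[\beta X_{1,2}+X_{3,0}S_\nu(2(m'-p-1))\big]_\epsilon\Big)\Big\}\\ &+(\delta+1)\frac{m(m-1)}{2^{m+2}}D\hat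 C\Big\{\sum_{p=0}^{m'-1}\binom{m-2}{2p}X_{1,0}^{2p}X_{0,1}^{2(m'-p-1)}\big[X_{0,2}^2S_\nu(2p)+2\beta X_{0,2}X_{2,0}+\beta X_{1,1}^2+X_{2,0}^2S_\nu(2(m'-p-1))\big]_\epsilon\\ &\qquad+\beta\sum_{p=0}^{m'-2}\binom{m-2}{2p+1}X_{1,0}^{2p+1}X_{0,1}^{2(m'-p-1)-1}\big[2X_{0,2}X_{1,1}+2X_{1,1}X_{2,0}\big]_\epsilon\Big\}.\end{aligned}$$ *Case II-2* ($m=2m'+1$, $\epsilon=1$, $\delta=-1$). $\langle A\rangle^{(l)}_{A_n}=c\,\Delta r^{m+1}+o(\Delta r^{m+1})$ with $$\begin{aligned}c={}&-\frac{\beta}{2^{m+1}}\frac{v^2\hat C_\rho}{D}\Big[\sum_{p=0}^{m'}\binom m{2p}X_{1,0}^{2p}X_{0,1}^{2(m'-p)+1}[Y_{1,0}]_{-1}+\sum_{p=0}^{m'}\binom m{2p+1}X_{1,0}^{2p+1}X_{0,1}^{2(m'-p)}[Y_{0,1}]_{-1}\Big]\\ &-\frac{m\beta}{2^{m+1}}\frac{v^2\hat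 C}{D}\Big[\sum_{p=0}^{m'}\binom{m-1}{2p}X_{1,0}^{2p}X_{0,1}^{2(m'-p)}[X_{1,1}]_{-1}+\sum_{p=0}^{m'-1}\binom{m-1}{2p+1}X_{1,0}^{2p+1}X_{0,1}^{2(m'-p)-1}[X_{0,2}+X_{2,0}]_{-1}\Big]\\ &+\frac v{2^{m+1}}\Big\{\beta\sum_{p=0}^{m'}\binom m{2p}X_{1,0}^{2p}X_{0,1}^{2(m'-p)+1}\Big(\hat C_\rho[Y_{1,1}]_{-1}+\hat C_{\rho\rho}[Y_{0,1}Y_{1,0}]_{-1}\Big)\\ &\qquad+\sum_{p=0}^{m'}\binom m{2p+1}X_{1,0}^{2p+1}X_{0,1}^{2(m'-p)}\Big(\hat C_\rho\big[\beta Y_{0,2}+Y_{2,0}S_\nu(2(m'-p))\big]_{-1}+\tfrac12\hat C_{\rho\rho}\big[\beta Y_{0,1}^2+Y_{1,0}^2S_\nu(2(m'-p))\big]_{-1}\Big)\Big\}\\ &+\frac{mv}{2^{m+1}}\Big\{\sum_{p=0}^{m'}\binom{m-1}{2p}X_{1,0}^{2p}X_{0,1}^{2(m'-p)}\Big(\hat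 C_\rho\big[\beta X_{0,2}Y_{1,0}+\beta X_{1,1}Y_{0,1}+X_{2,0}Y_{1,0}S_\nu(2(m'-p))\big]_{-1}+\hat C\big[\beta X_{1,2}+X_{3,0}S_\nu(2(m'-p))\big]_{-1}\Big)\\ &\qquad+\beta\sum_{p=0}^{m'-1}\binom{m-1}{2p+1}X_{1,0}^{2p+1}X_{0,1}^{2(m'-p)-1}\Big(\hat C_\rho\big[X_{0,2}Y_{0,1}+X_{1,1}Y_{1,0}+X_{2,0}Y_{0,1}\big]_{-1}+\hat C\big[X_{2,1}+X_{0,3}\big]_{-1}\Big)\Big\}\\ &+\frac{m(m-1)}{2^{m+2}}v\hat C\Big[2\beta\sum_{p=0}^{m'-1}\binom{m-2}{2p}X_{1,0}^{2p}X_{0,1}^{2(m'-p)-1}\big[X_{0,2}X_{1,1}+X_{1,1}X_{2,0}\big]_{-1}\\ &\qquad+\sum_{p=0}^{m'-1}\binom{m-2}{2p+1}X_{1,0}^{2p+1}X_{0,1}^{2(m'-p-1)}\big[\beta X_{0,2}^2+2\beta X_{0,2}X_{2,0}+\beta X_{1,1}^2+X_{2,0}^2S_\nu(2(m'-p-1))\big]_{-1}\Big].\end{aligned}$$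 -/

import Mathlib

open Filter Topology MeasureTheory

noncomputable section

namespace Multibaker

/-- Phase space: `(n, x, y)` is the point `(x, y)` of the `n`-th site. -/
abbrev Phase := ℕ × ℝ × ℝ

/-- The Liouville measure: planar Lebesgue measure on every site. -/
def liouville : Measure Phase := (Measure.count : Measure ℕ).prod (volume : Measure (ℝ × ℝ))

/-- Labels `(n, ω₀ω₁⋯ω_{k-1})` of the partition elements of a chain with the `N + 1` sites
`0, …, N`. -/
abbrev Cell (N k : ℕ) := Fin (N + 1) × (Fin k → Fin 3)

/-- `β = 2 τ D / Δr²`. -/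
def betaOf (D dr tau : ℝ) : ℝ := 2 * tau * D / dr ^ 2

/-- The grid Péclet number `v Δr / D`. -/
def pecletOf (D v dr : ℝ) : ℝ := v * dr / D

/-- The transition probabilities `η(0), η(1), η(2)` of the non-boundary sites. -/
def bulkEta (D v dr tau : ℝ) : Fin 3 → ℝ :=
  ![betaOf D dr tau / 2 * (1 - pecletOf D v dr / 2),
    1 - betaOf D dr tau,
    betaOf D dr tau / 2 * (1 + pecletOf D v dr / 2)]

/-- The `n`-th site `Aₙ`, a rectangle of width `dr` and height `h`. -/
def siteSet (dr h : ℝ) (n : ℕ) : Set Phase := {n} ×ˢ Set.Icc 0 dr ×ˢ Set.Icc 0 h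

/-- A triadic multibaker chain of uniform one-dimensional Fokker-Planck type with sites
`0, …, N`, together with an initial probability vector on its level-`k` Markov partition.
The dynamics on the two boundary sites is an arbitrary measurable map that sends a boundary site
into itself and its neighbour. -/
structure UOFPChain (D v : ℝ) (k : ℕ) where
  N : ℕ
  two_le_N : 2 ≤ N
  /-- site width `Δr` -/
  dr : ℝ
  /-- site height -/
  h : ℝ
  /-- time step `τ` -/
  tau : ℝ
  dr_pos : 0 < dr
  h_pos : 0 < h
  tau_pos : 0 < tau
  bulkEta_pos : ∀ ω, 0 < bulkEta D v dr tau ω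
  /-- the transition probabilities of the boundary site `0` -/
  etaLeft : Fin 3 → ℝ
  /-- the transition probabilities of the boundary site `N` -/
  etaRight : Fin 3 → ℝ
  etaLeft_pos : ∀ ω, 0 < etaLeft ω
  etaRight_pos : ∀ ω, 0 < etaRight ω
  etaLeft_sum : ∑ ω, etaLeft ω = 1
  etaRight_sum : ∑ ω, etaRight ω = 1
  /-- the map on the two boundary sites -/
  bdry : Phase → Phase
  bdry_measurable : Measurable bdry
  bdry_left : Set.MapsTo bdry (siteSet dr h 0) (siteSet dr h 0 ∪ siteSet dr h 1)
  bdry_right : Set.MapsTo bdry (siteSet dr h N) (siteSet dr h (N - 1) ∪ siteSet dr h N)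
  /-- the initial probabilities `P⁽⁰⁾` of the partition elements -/
  init : Cell N k → ℝ
  init_nonneg : ∀ i, 0 ≤ init i
  init_sum : ∑ i, init i = 1

namespace UOFPChain

variable {D v : ℝ} {k : ℕ} (S : UOFPChain D v k)

def beta : ℝ := betaOf D S.dr S.tau

def peclet : ℝ := pecletOf D v S.dr

/-- `ηₙ(ω)`. -/
def eta (n : ℕ) : Fin 3 → ℝ :=
  if n = 0 then S.etaLeft else if n = S.N then S.etaRight else bulkEta D v S.dr S.tau

/-- `νₙ(ω) = ηₙ(2 - ω)`. -/
def nu (n : ℕ) (ω : Fin 3) : ℝ := S.eta n ω.rev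

/-- The multibaker chain map. -/
def map (p : Phase) : Phase :=
  if 0 < p.1 ∧ p.1 < S.N then
    if p.2.1 < S.eta p.1 0 * S.dr then
      (p.1 - 1, p.2.1 / S.eta p.1 0, S.nu (p.1 - 1) 0 * p.2.2)
    else if p.2.1 < (S.eta p.1 0 + S.eta p.1 1) * S.dr then
      (p.1, (p.2.1 - S.eta p.1 0 * S.dr) / S.eta p.1 1,
        S.nu p.1 0 * S.h + S.nu p.1 1 * p.2.2)
    else
      (p.1 + 1, (p.2.1 - (S.eta p.1 0 + S.eta p.1 1) * S.dr) / S.eta p.1 2,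
        (S.nu (p.1 + 1) 0 + S.nu (p.1 + 1) 1) * S.h + S.nu (p.1 + 1) 2 * p.2.2)
  else S.bdry p

/-- The site `n + 1 - ω` from which the horizontal strip `ω` of the site `n` is filled, truncated
to `0, …, N` (the truncation concerns the boundary sites only). -/
def source (n : ℕ) (ω : Fin 3) : ℕ := min S.N (n + 1 - (ω : ℕ))

/-- `νₙ(ω₀⋯ω_{k-1})`, the height of the cell `(n, ω₀⋯ω_{k-1})` relative to `h`. -/
def height : (k : ℕ) → ℕ → (Fin k → Fin 3) → ℝ
  | 0, _, _ => 1
  | k + 1, n, w => S.nu n (w 0) * height k (S.source n (w 0)) (Fin.tail w)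

/-- The lower edge, relative to `h`, of the cell `(n, ω₀⋯ω_{k-1})`: the cells of a site are stacked
from bottom to top in the numerical order of `ω₀⋯ω_{k-1}`. -/
def lower : (k : ℕ) → ℕ → (Fin k → Fin 3) → ℝ
  | 0, _, _ => 0
  | k + 1, n, w =>
      (∑ ω ∈ Finset.univ.filter (· < w 0), S.nu n ω)
        + S.nu n (w 0) * lower k (S.source n (w 0)) (Fin.tail w)

/-- The element `(n, ω₀⋯ω_{k-1})` of the Markov partition. -/
def cell (i : Cell S.N k) : Set Phase :=
  {(i.1 : ℕ)} ×ˢ Set.Icc 0 S.dr ×ˢ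
    Set.Icc (S.h * S.lower k i.1 i.2) (S.h * (S.lower k i.1 i.2 + S.height k i.1 i.2))

/-- The partition volume `ΔVᵢ`. -/
def vol (i : Cell S.N k) : ℝ := liouville.real (S.cell i)

/-- The transition probability `W_{ji}` from the cell `i` to the cell `j`. -/
def W (j i : Cell S.N k) : ℝ := liouville.real (S.cell i ∩ S.map ⁻¹' S.cell j) / S.vol i

/-- The transition volume `W_{ji} ΔVᵢ`. -/
def Wt (j i : Cell S.N k) : ℝ := S.W j i * S.vol i

/-- The expansion rate `eᵢ`. -/
def expansion (i : Cell S.N k) : ℝ := S.vol i / ∑ j, S.Wt i j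

/-- The probabilities `Pᵢ⁽ˡ⁾`, governed by the master equation of the Markov partition. -/
def prob : ℕ → Cell S.N k → ℝ
  | 0 => S.init
  | l + 1 => fun j => ∑ i, S.W j i * prob l i

/-- The local density `ρᵢ⁽ˡ⁾`. -/
def density (l : ℕ) (i : Cell S.N k) : ℝ := S.prob l i / S.vol i

/-- The density `ρₙ⁽ˡ⁾` of the whole site `n`. -/
def siteDensity (l : ℕ) (n : Fin (S.N + 1)) : ℝ :=
  (∑ w, S.prob l (n, w)) / ∑ w, S.vol (n, w)

/-- `A_{ij}⁽ˡ⁾`; it is zero if both transition volumes are zero. -/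
def pairQuantity (f : ℝ → ℝ → ℝ) (ε δ : ℝ) (l : ℕ) (i j : Cell S.N k) : ℝ :=
  ((1 + δ * S.expansion j) * S.Wt j i + ε * (1 + δ * S.expansion i) * S.Wt i j)
    * f (S.density l j) (S.density l i)

/-- The transitional type local quantity `Aᵢ⁽ˡ⁾`. -/
def localQuantity (f : ℝ → ℝ → ℝ) (ε δ : ℝ) (l : ℕ) (i : Cell S.N k) : ℝ :=
  ∑ j, S.pairQuantity f ε δ l i j

/-- Spatio-temporal average over a union `R` of cells. -/
def average (A : Cell S.N k → ℝ) (R : Finset (Cell S.N k)) : ℝ :=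
  1 / (S.tau * ∑ i ∈ R, S.vol i) * ∑ i ∈ R, A i

/-- The average `⟨A⟩⁽ˡ⁾` over the site `n`. -/
def siteAverage (f : ℝ → ℝ → ℝ) (ε δ : ℝ) (l : ℕ) (n : Fin (S.N + 1)) : ℝ :=
  S.average (S.localQuantity f ε δ l) (Finset.univ.filter (fun i => i.1 = n))

/-- Bulk sites and times: no cell that exchanges volume with the site `n` has met a boundary site
as an intermediate site during the last `k` steps. -/
def IsBulk (l n : ℕ) : Prop := k + 1 < n ∧ n + k + 1 < S.N ∧ k < l

end UOFPChain

/-- `f` is smooth on `J × J`, symmetric or antisymmetric, with characteristic exponent `m` and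
characteristic function `C`. (`J` is the range of admissible densities, e.g. `ℝ` or `(0, ∞)`.) -/
structure IsT1Function (J : Set ℝ) (f : ℝ → ℝ → ℝ) (m : ℕ) (C : ℝ → ℝ) : Prop where
  smooth : ContDiffOn ℝ (⊤ : ℕ∞) (fun p : ℝ × ℝ => f p.1 p.2) (J ×ˢ J)
  symm_or_antisymm : (∀ x ∈ J, ∀ y ∈ J, f y x = f x y) ∨ (∀ x ∈ J, ∀ y ∈ J, f y x = -f x y)
  char_lim : ∀ x ∈ J, ∀ s t : ℝ, t ≠ s →
    Tendsto (fun a : ℝ => f (x + s * a) (x + t * a) / ((s - t) / 2 * a) ^ m) (𝓝[≠] 0) (𝓝 (C x))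
  nonzero : ∃ x ∈ J, C x ≠ 0

/-- The site densities of the chains `S j` are interpolated by functions `u j` of position and time
(`ρₙ⁽ˡ⁾ = u j (n Δr) (l τ)`) which near `(r, t)` are three times continuously differentiable in
position and converge, with these derivatives, to the macroscopic density `ρ`. -/
structure HasContinuumLimit {D v : ℝ} {k : ℕ} (S : ℕ → UOFPChain D v k)
    (u : ℕ → ℝ → ℝ → ℝ) (ρ : ℝ → ℝ → ℝ) (r t : ℝ) : Prop where
  interp : ∀ (j : ℕ) (n : Fin ((S j).N + 1)) (l : ℕ),
    (S j).siteDensity l n = u j ((n : ℕ) * (S j).dr) (l * (S j).tau)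
  smooth : ∀ᶠ q : ℕ × ℝ × ℝ in atTop ×ˢ 𝓝 (r, t),
    ContDiffAt ℝ 3 (fun x => u q.1 x q.2.2) q.2.1
  conv : ∀ a ≤ 3, Tendsto
    (fun q : ℕ × ℝ × ℝ => iteratedDeriv a (fun x => u q.1 x q.2.2) q.2.1)
    (atTop ×ˢ 𝓝 (r, t)) (𝓝 (iteratedDeriv a (fun x => ρ x t) r))

/-- The quantities at one site and time in which the leading terms are written. -/
structure SiteData where
  v : ℝ
  D : ℝ
  /-- `β` -/
  b : ℝ
  /-- grid Péclet number -/
  Pe : ℝ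
  /-- `ε` -/
  ε : ℝ
  /-- `δ` -/
  δ : ℝ
  /-- density `ρ` and its first three derivatives with respect to position -/
  ρ : ℝ
  ρr : ℝ
  ρrr : ℝ
  ρrrr : ℝ
  /-- the characteristic function and its first two derivatives at `ρ` -/
  C : ℝ
  C' : ℝ
  C'' : ℝ

namespace SiteData

variable (z : SiteData)

/-- `S_ν(a)`. -/
def Sν (a : ℕ) : ℝ := if a = 0 then 1 else if a % 2 = 1 then z.b * z.Pe / 2 else z.b

/-- `v / D`. -/
def V : ℝ := z.v / z.D

/-- The expansion coefficients `X_{p,q}⁽¹⁾` (index `0`) and `X_{p,q}⁽²⁾` (index `1`) for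
`p + q ≤ 3`; no others are used. -/
def X : Fin 2 → ℕ → ℕ → ℝ
  | _, 1, 0 => z.V * z.ρ
  | _, 0, 1 => -z.V * z.ρ + z.ρr
  | 0, 2, 0 => z.V ^ 2 * z.ρ
  | 1, 2, 0 => z.V ^ 2 * z.ρ - 2 * z.V * z.ρr
  | 0, 1, 1 => 0
  | 1, 1, 1 => 2 * z.V * z.ρr - 2 * z.ρrr
  | _, 0, 2 => -z.V ^ 2 * z.ρ + 2 * z.V * z.ρr - z.ρrr
  | 0, 3, 0 => z.V ^ 3 * z.ρ
  | 1, 3, 0 => z.V ^ 3 * z.ρ - 2 * z.V ^ 2 * z.ρr + 2 * z.V * z.ρrr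
  | 0, 2, 1 => 0
  | 1, 2, 1 => -2 * z.V * z.ρrr + 2 * z.ρrrr
  | 0, 1, 2 => 0
  | 1, 1, 2 => 2 * z.V ^ 2 * z.ρr - 4 * z.V * z.ρrr + 2 * z.ρrrr
  | _, 0, 3 => -z.V ^ 3 * z.ρ + 2 * z.V ^ 2 * z.ρr - 2 * z.V * z.ρrr + 2 / 3 * z.ρrrr
  | _, _, _ => 0

/-- The expansion coefficients `Y_{p,q}⁽¹⁾` (index `0`) and `Y_{p,q}⁽²⁾` (index `1`) for
`p + q ≤ 2`; no others are used. -/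
def Y : Fin 2 → ℕ → ℕ → ℝ
  | _, 0, 0 => z.ρ
  | 0, 1, 0 => z.V * z.ρ
  | 1, 1, 0 => z.V * z.ρ - 2 * z.ρr
  | _, 0, 1 => z.V * z.ρ - z.ρr
  | 0, 2, 0 => z.V ^ 2 * z.ρ
  | 1, 2, 0 => z.V ^ 2 * z.ρ - 2 * z.V * z.ρr + 2 * z.ρrr
  | 0, 1, 1 => 0
  | 1, 1, 1 => -2 * z.V * z.ρr + 2 * z.ρrr
  | _, 0, 2 => z.V ^ 2 * z.ρ - 2 * z.V * z.ρr + z.ρrr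
  | _, _, _ => 0

/-- `X_{1,0}`, the same for both superscripts. -/
def X10 : ℝ := z.X 0 1 0

/-- `X_{0,1}`, the same for both superscripts. -/
def X01 : ℝ := z.X 0 0 1

/-- `(A)⁽¹⁾ + σ (A)⁽²⁾`. -/
def both (σ : ℝ) (A : Fin 2 → ℝ) : ℝ := A 0 + σ * A 1

/-- Coefficient of `Δr^(m-2)`, `m = 2m' > 0`, `ε = δ = 1`. -/
def leadI1 (m' : ℕ) : ℝ :=
  z.D * z.C / (2 : ℝ) ^ (2 * (m' : ℤ) - 3) *
    (z.X01 ^ (2 * m') + z.X10 ^ (2 * m')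
      + z.b * ∑ p ∈ Finset.Ico 1 m',
          ((2 * m').choose (2 * p) : ℝ) * z.X10 ^ (2 * p) * z.X01 ^ (2 * (m' - p)))

/-- Coefficient of `Δr^(m-1)`, `m = 2m' + 1`, `ε = -1` or `δ = 1`. -/
def leadII1 (m' : ℕ) : ℝ :=
  let m : ℕ := 2 * m' + 1;
  -(1 - z.ε) * (z.v * z.C / 2 ^ m) *
      ((z.δ + 1) * ∑ p ∈ Finset.range (m' + 1),
          (m.choose (2 * p) : ℝ) * z.X10 ^ (2 * p) * z.X01 ^ (2 * (m' - p) + 1) * z.Sν (2 * p)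
        + (z.δ - 1) * ∑ p ∈ Finset.range (m' + 1),
          (m.choose (2 * p + 1) : ℝ) * z.X10 ^ (2 * p + 1) * z.X01 ^ (2 * (m' - p))
            * z.Sν (2 * (m' - p)))
  + (z.δ + 1) * (z.D / 2 ^ m) * z.C' *
      ((∑ p ∈ Finset.range (m' + 1),
          (m.choose (2 * p) : ℝ) * z.X10 ^ (2 * p) * z.X01 ^ (2 * (m' - p) + 1)
            * both (-z.ε) (fun i => z.Y i 0 1) * z.Sν (2 * p))
        + ∑ p ∈ Finset.range (m' + 1),
          (m.choose (2 * p + 1) : ℝ) * z.X10 ^ (2 * p + 1) * z.X01 ^ (2 * (m' - p))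
            * both (-z.ε) (fun i => z.Y i 1 0) * z.Sν (2 * (m' - p)))
  + (z.δ + 1) * (m * z.D / 2 ^ m) * z.C *
      ((∑ p ∈ Finset.range (m' + 1),
          ((2 * m').choose (2 * p) : ℝ) * z.X10 ^ (2 * p) * z.X01 ^ (2 * (m' - p))
            * both (-z.ε) (fun i => z.X i 2 0 * z.Sν (2 * (m' - p)) + z.X i 0 2 * z.Sν (2 * p)))
        + z.b * ∑ p ∈ Finset.range m',
          ((2 * m').choose (2 * p + 1) : ℝ) * z.X10 ^ (2 * p + 1) * z.X01 ^ (2 * (m' - p) - 1)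
            * both (-z.ε) (fun i => z.X i 1 1))

/-- Coefficient of `Δr^m`, `m = 2m'`, `ε = -1` or `δ = -1`. -/
def leadI2 (m' : ℕ) : ℝ :=
  let m : ℕ := 2 * m';
  z.b * ((1 + z.ε) * (z.δ - 1) / 2 ^ (m + 1)) * (z.v ^ 2 * z.C / z.D) *
      (∑ p ∈ Finset.range m',
        (m.choose (2 * p + 1) : ℝ) * z.X10 ^ (2 * p + 1) * z.X01 ^ (2 * (m' - p) - 1))
  - z.v / 2 ^ (m + 1) * z.C' *
      ((∑ p ∈ Finset.range (m' + 1),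
          (m.choose (2 * p) : ℝ) * z.X10 ^ (2 * p) * z.X01 ^ (2 * (m' - p))
            * both z.ε (fun i => (z.δ + 1) * z.Y i 0 1 * z.Sν (2 * p)
                + (z.δ - 1) * z.Y i 1 0 * z.Sν (2 * (m' - p))))
        + z.b * ∑ p ∈ Finset.range m',
          (m.choose (2 * p + 1) : ℝ) * z.X10 ^ (2 * p + 1) * z.X01 ^ (2 * (m' - p) - 1)
            * both z.ε (fun i => (z.δ - 1) * z.Y i 0 1 + (z.δ + 1) * z.Y i 1 0))
  - m / 2 ^ (m + 1) * z.v * z.C *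
      ((∑ p ∈ Finset.range m',
          ((m - 1).choose (2 * p) : ℝ) * z.X10 ^ (2 * p) * z.X01 ^ (2 * (m' - p) - 1)
            * both z.ε (fun i => (z.δ + 1) * z.X i 0 2 * z.Sν (2 * p)
                + z.b * (z.δ - 1) * z.X i 1 1 + z.b * (z.δ + 1) * z.X i 2 0))
        + ∑ p ∈ Finset.range m',
          ((m - 1).choose (2 * p + 1) : ℝ) * z.X10 ^ (2 * p + 1) * z.X01 ^ (2 * (m' - p - 1))
            * both z.ε (fun i => z.b * (z.δ - 1) * z.X i 0 2 + z.b * (z.δ + 1) * z.X i 1 1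
                + (z.δ - 1) * z.X i 2 0 * z.Sν (2 * (m' - p - 1))))
  + (z.δ + 1) * (z.D / 2 ^ (m + 1)) *
      ((∑ p ∈ Finset.range (m' + 1),
          (m.choose (2 * p) : ℝ) * z.X10 ^ (2 * p) * z.X01 ^ (2 * (m' - p))
            * (z.C' * both z.ε (fun i => z.Y i 0 2 * z.Sν (2 * p)
                  + z.Y i 2 0 * z.Sν (2 * (m' - p)))
                + 1 / 2 * z.C'' * both z.ε (fun i => z.Y i 0 1 ^ 2 * z.Sν (2 * p)
                  + z.Y i 1 0 ^ 2 * z.Sν (2 * (m' - p)))))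
        + z.b * ∑ p ∈ Finset.range m',
          (m.choose (2 * p + 1) : ℝ) * z.X10 ^ (2 * p + 1) * z.X01 ^ (2 * (m' - p) - 1)
            * (z.C' * both z.ε (fun i => z.Y i 1 1)
                + z.C'' * both z.ε (fun i => z.Y i 0 1 * z.Y i 1 0)))
  + (z.δ + 1) * (m * z.D / 2 ^ (m + 1)) *
      ((∑ p ∈ Finset.range m',
          ((m - 1).choose (2 * p) : ℝ) * z.X10 ^ (2 * p) * z.X01 ^ (2 * (m' - p) - 1)
            * (z.C' * both z.ε (fun i => z.X i 0 2 * z.Y i 0 1 * z.Sν (2 * p)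
                  + z.b * z.X i 1 1 * z.Y i 1 0 + z.b * z.X i 2 0 * z.Y i 0 1)
                + z.C * both z.ε (fun i => z.X i 0 3 * z.Sν (2 * p) + z.b * z.X i 2 1)))
        + ∑ p ∈ Finset.range m',
          ((m - 1).choose (2 * p + 1) : ℝ) * z.X10 ^ (2 * p + 1) * z.X01 ^ (2 * (m' - p - 1))
            * (z.C' * both z.ε (fun i => z.b * z.X i 0 2 * z.Y i 1 0 + z.b * z.X i 1 1 * z.Y i 0 1
                  + z.X i 2 0 * z.Y i 1 0 * z.Sν (2 * (m' - p - 1)))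
                + z.C * both z.ε (fun i => z.b * z.X i 1 2
                  + z.X i 3 0 * z.Sν (2 * (m' - p - 1)))))
  + (z.δ + 1) * (m * ((m : ℝ) - 1) / 2 ^ (m + 2)) * z.D * z.C *
      ((∑ p ∈ Finset.range m',
          ((m - 2).choose (2 * p) : ℝ) * z.X10 ^ (2 * p) * z.X01 ^ (2 * (m' - p - 1))
            * both z.ε (fun i => z.X i 0 2 ^ 2 * z.Sν (2 * p) + 2 * z.b * z.X i 0 2 * z.X i 2 0
                + z.b * z.X i 1 1 ^ 2 + z.X i 2 0 ^ 2 * z.Sν (2 * (m' - p - 1))))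
        + z.b * ∑ p ∈ Finset.range (m' - 1),
          ((m - 2).choose (2 * p + 1) : ℝ) * z.X10 ^ (2 * p + 1) * z.X01 ^ (2 * (m' - p - 1) - 1)
            * both z.ε (fun i => 2 * z.X i 0 2 * z.X i 1 1 + 2 * z.X i 1 1 * z.X i 2 0))

/-- Coefficient of `Δr^(m+1)`, `m = 2m' + 1`, `ε = 1`, `δ = -1`. -/
def leadII2 (m' : ℕ) : ℝ :=
  let m : ℕ := 2 * m' + 1;
  -(z.b / 2 ^ (m + 1)) * (z.v ^ 2 * z.C' / z.D) *
      ((∑ p ∈ Finset.range (m' + 1),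
          (m.choose (2 * p) : ℝ) * z.X10 ^ (2 * p) * z.X01 ^ (2 * (m' - p) + 1)
            * both (-1) (fun i => z.Y i 1 0))
        + ∑ p ∈ Finset.range (m' + 1),
          (m.choose (2 * p + 1) : ℝ) * z.X10 ^ (2 * p + 1) * z.X01 ^ (2 * (m' - p))
            * both (-1) (fun i => z.Y i 0 1))
  - m * z.b / 2 ^ (m + 1) * (z.v ^ 2 * z.C / z.D) *
      ((∑ p ∈ Finset.range (m' + 1),
          ((m - 1).choose (2 * p) : ℝ) * z.X10 ^ (2 * p) * z.X01 ^ (2 * (m' - p))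
            * both (-1) (fun i => z.X i 1 1))
        + ∑ p ∈ Finset.range m',
          ((m - 1).choose (2 * p + 1) : ℝ) * z.X10 ^ (2 * p + 1) * z.X01 ^ (2 * (m' - p) - 1)
            * both (-1) (fun i => z.X i 0 2 + z.X i 2 0))
  + z.v / 2 ^ (m + 1) *
      ((z.b * ∑ p ∈ Finset.range (m' + 1),
          (m.choose (2 * p) : ℝ) * z.X10 ^ (2 * p) * z.X01 ^ (2 * (m' - p) + 1)
            * (z.C' * both (-1) (fun i => z.Y i 1 1)
                + z.C'' * both (-1) (fun i => z.Y i 0 1 * z.Y i 1 0)))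
        + ∑ p ∈ Finset.range (m' + 1),
          (m.choose (2 * p + 1) : ℝ) * z.X10 ^ (2 * p + 1) * z.X01 ^ (2 * (m' - p))
            * (z.C' * both (-1) (fun i => z.b * z.Y i 0 2 + z.Y i 2 0 * z.Sν (2 * (m' - p)))
                + 1 / 2 * z.C'' * both (-1) (fun i => z.b * z.Y i 0 1 ^ 2
                  + z.Y i 1 0 ^ 2 * z.Sν (2 * (m' - p)))))
  + m * z.v / 2 ^ (m + 1) *
      ((∑ p ∈ Finset.range (m' + 1),
          ((m - 1).choose (2 * p) : ℝ) * z.X10 ^ (2 * p) * z.X01 ^ (2 * (m' - p))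
            * (z.C' * both (-1) (fun i => z.b * z.X i 0 2 * z.Y i 1 0
                  + z.b * z.X i 1 1 * z.Y i 0 1 + z.X i 2 0 * z.Y i 1 0 * z.Sν (2 * (m' - p)))
                + z.C * both (-1) (fun i => z.b * z.X i 1 2 + z.X i 3 0 * z.Sν (2 * (m' - p)))))
        + z.b * ∑ p ∈ Finset.range m',
          ((m - 1).choose (2 * p + 1) : ℝ) * z.X10 ^ (2 * p + 1) * z.X01 ^ (2 * (m' - p) - 1)
            * (z.C' * both (-1) (fun i => z.X i 0 2 * z.Y i 0 1 + z.X i 1 1 * z.Y i 1 0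
                  + z.X i 2 0 * z.Y i 0 1)
                + z.C * both (-1) (fun i => z.X i 2 1 + z.X i 0 3)))
  + m * ((m : ℝ) - 1) / 2 ^ (m + 2) * z.v * z.C *
      ((2 * z.b * ∑ p ∈ Finset.range m',
          ((m - 2).choose (2 * p) : ℝ) * z.X10 ^ (2 * p) * z.X01 ^ (2 * (m' - p) - 1)
            * both (-1) (fun i => z.X i 0 2 * z.X i 1 1 + z.X i 1 1 * z.X i 2 0))
        + ∑ p ∈ Finset.range m',
          ((m - 2).choose (2 * p + 1) : ℝ) * z.X10 ^ (2 * p + 1) * z.X01 ^ (2 * (m' - p - 1))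
            * both (-1) (fun i => z.b * z.X i 0 2 ^ 2 + 2 * z.b * z.X i 0 2 * z.X i 2 0
                + z.b * z.X i 1 1 ^ 2 + z.X i 2 0 ^ 2 * z.Sν (2 * (m' - p - 1))))

end SiteData

/-- The data of the chain `S` at the site `n` and the time step `l`: `ρₙ⁽ˡ⁾` is the site density,
its derivatives are those of the interpolating function `u` at `r = n Δr`, `t = l τ`. -/
def UOFPChain.siteData {D v : ℝ} {k : ℕ} (S : UOFPChain D v k) (u : ℝ → ℝ → ℝ) (C : ℝ → ℝ)
    (ε δ : ℝ) (l : ℕ) (n : Fin (S.N + 1)) : SiteData where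
  v := v
  D := D
  b := S.beta
  Pe := S.peclet
  ε := ε
  δ := δ
  ρ := S.siteDensity l n
  ρr := iteratedDeriv 1 (fun x => u x (l * S.tau)) ((n : ℕ) * S.dr)
  ρrr := iteratedDeriv 2 (fun x => u x (l * S.tau)) ((n : ℕ) * S.dr)
  ρrrr := iteratedDeriv 3 (fun x => u x (l * S.tau)) ((n : ℕ) * S.dr)
  C := C (S.siteDensity l n)
  C' := iteratedDeriv 1 C (S.siteDensity l n)
  C'' := iteratedDeriv 2 C (S.siteDensity l n)

end Multibaker

end

noncomputable section

namespace Multibaker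

/-! ### Smooth factorization along a hyperplane -/

/-! Away from the boundary the chain is exactly solvable. One step of the map puts a symbol in front
of the word of a cell and drops the last one, so transition volumes, expansion rates and densities
are explicit (`sum_Wt_fwd`, `sum_Wt_bwd`, `expansion_eq`, `density_eq`): a cell density is the
product of the ratios η(ω)/ν(ω) over the word times the density, k steps earlier, of the site to
which the word leads back. The two cells of a transition share k - 1 symbols. Isolating these
(`siteAverage_eq`) turns the site average into a weighted average of nine-term sums `branchSum` over
displacements σ, κ ∈ {-1, 0, 1}; the shared symbols only shift the centre by O(Δr) and contribute a
factor tending to 1.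

Near the diagonal f(c + d, c - d) = d^m (C(c) + d² H(c, d)) with H continuous, by Hadamard's lemma
and because f has the parity of m (`exists_expansion`). Inserting the expanded densities gives
(Δr/2)^m (T0 + Δr T1 + Δr² T2 + …) for an outflow pair, and (-1)^m times a similar expression for
the inflow pair (`pairTerm_expand`). Under (σ, κ) ↦ (-σ, -κ) the coefficient of order i has parity
(-1)^(m+i), while the weight of the branch σ has an even part carrying 1 + δ and an odd part
carrying (1 - δ)Δr. This parity, together with the vanishing or not of 1 + ε(-1)^m, decides which
order survives and gives the cases. The factor β/τ = 2D/Δr² shifts the exponent by -2. Only the pair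
(0, 0) lacks a factor β, and it matters for m = 0, ε = δ = 1 alone. Whenever T2 is needed, inflow is
subtracted from outflow and the unknown H cancels.

The sums with S_ν are these sums over branches in binomial form (`leadI1_eq`, `leadII1_eq_plus`,
`leadI2_eq_plus`, `leadII2_eq` and their companions). Since β need not converge along the sequence,
the little-o statements are tested on ultrafilters, along which β converges and the normalised
average and the coefficient have a common limit (`isLittleO_of_ultrafilter`,
`isLittleO_siteAverage`). -/

theorem continuous_integral_unit {H F : Type} [NormedAddCommGroup H] [NormedSpace ℝ H]
    [ProperSpace H] [NormedAddCommGroup F] [NormedSpace ℝ F] {G : H × ℝ → F}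
    (hG : Continuous G) : Continuous fun p : H => ∫ θ in (0 : ℝ)..1, G (p, θ) :=
  intervalIntegral.continuous_parametric_intervalIntegral_of_continuous' (show Continuous
    (Function.uncurry fun (p : H) (θ : ℝ) => G (p, θ)) from hG) 0 1

theorem hasFDerivAt_integral_unit {H F : Type} [NormedAddCommGroup H] [NormedSpace ℝ H]
    [ProperSpace H] [NormedAddCommGroup F] [NormedSpace ℝ F] {G : H × ℝ → F}
    (hG : ContDiff ℝ 1 G) (p : H) :
    HasFDerivAt (fun p : H => ∫ θ in (0 : ℝ)..1, G (p, θ))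
      (∫ θ in (0 : ℝ)..1, (fderiv ℝ G (p, θ)).comp (ContinuousLinearMap.inl ℝ H ℝ)) p := by
  have hc : Continuous fun q : H × ℝ => (fderiv ℝ G q).comp (ContinuousLinearMap.inl ℝ H ℝ) :=
    (hG.continuous_fderiv one_ne_zero).clm_comp continuous_const
  -- Properness makes closed balls compact, which supplies a constant dominating the derivative near
  -- `p`.
  obtain ⟨B, hB⟩ := ((isCompact_closedBall p 1).prod (isCompact_Icc (a := (0 : ℝ)) (b := 1))
    ).exists_bound_of_continuousOn hc.continuousOn
  have hcont : ∀ q : H, Continuous fun θ : ℝ => G (q, θ) := fun q =>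
    hG.continuous.comp (by fun_prop)
  refine intervalIntegral.hasFDerivAt_integral_of_dominated_of_fderiv_le (𝕜 := ℝ)
    (F := fun q θ => G (q, θ))
    (F' := fun q θ => (fderiv ℝ G (q, θ)).comp (ContinuousLinearMap.inl ℝ H ℝ))
    (bound := fun _ => B)
    (Metric.ball_mem_nhds p one_pos) (Eventually.of_forall fun q => (hcont q).aestronglyMeasurable)
    ((hcont p).intervalIntegrable _ _) ?_ ?_ intervalIntegrable_const ?_
  · exact (hc.comp (by fun_prop : Continuous fun θ : ℝ => (p, θ))).aestronglyMeasurable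
  · refine Eventually.of_forall fun θ hθ q hq => hB (q, θ) ⟨Metric.ball_subset_closedBall hq, ?_⟩
    rw [Set.uIoc_of_le zero_le_one] at hθ
    exact ⟨hθ.1.le, hθ.2⟩
  · refine Eventually.of_forall fun θ _ q _ => ?_
    have h1 : HasFDerivAt G (fderiv ℝ G (q, θ)) (q, θ) :=
      (hG.differentiable one_ne_zero).differentiableAt.hasFDerivAt
    exact h1.comp q (hasFDerivAt_prodMk_left q θ)

/-- The derivative of a parametric integral is again one, with values in `H →L[ℝ] F`; hence the
target space is quantified inside the induction. -/
theorem contDiff_integral_unit_nat {H : Type} [NormedAddCommGroup H] [NormedSpace ℝ H]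
    [ProperSpace H] (n : ℕ) : ∀ {F : Type} [NormedAddCommGroup F] [NormedSpace ℝ F]
    {G : H × ℝ → F}, ContDiff ℝ n G → ContDiff ℝ n fun p : H => ∫ θ in (0 : ℝ)..1, G (p, θ) := by
  induction n with
  | zero =>
    intro F _ _ G hG
    exact contDiff_zero.2 (continuous_integral_unit hG.continuous)
  | succ n ih =>
    intro F _ _ G hG
    have h1 : ContDiff ℝ 1 G := hG.of_le (by norm_cast; omega)
    have hder := hasFDerivAt_integral_unit h1
    rw [show ((n + 1 : ℕ) : WithTop ℕ∞) = (n : WithTop ℕ∞) + 1 by norm_cast] at hG ⊢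
    rw [contDiff_succ_iff_fderiv]
    refine ⟨fun p => (hder p).differentiableAt, by simp, ?_⟩
    have : fderiv ℝ (fun p : H => ∫ θ in (0 : ℝ)..1, G (p, θ)) = fun p =>
        ∫ θ in (0 : ℝ)..1, (fderiv ℝ G (p, θ)).comp (ContinuousLinearMap.inl ℝ H ℝ) :=
      funext fun p => (hder p).fderiv
    rw [this]
    exact ih ((contDiff_succ_iff_fderiv.1 hG).2.2.clm_comp contDiff_const)

theorem contDiff_integral_unit {H F : Type} [NormedAddCommGroup H] [NormedSpace ℝ H]
    [ProperSpace H] [NormedAddCommGroup F] [NormedSpace ℝ F] {G : H × ℝ → F}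
    (hG : ContDiff ℝ (⊤ : ℕ∞) G) :
    ContDiff ℝ (⊤ : ℕ∞) fun p : H => ∫ θ in (0 : ℝ)..1, G (p, θ) :=
  contDiff_infty.2 fun n => contDiff_integral_unit_nat n (contDiff_infty.1 hG n)

/-- Hadamard's lemma in the second variable. -/
theorem exists_contDiff_eq_add_mul {Φ : ℝ × ℝ → ℝ} (hΦ : ContDiff ℝ (⊤ : ℕ∞) Φ) :
    ∃ Ψ : ℝ × ℝ → ℝ, ContDiff ℝ (⊤ : ℕ∞) Ψ ∧ ∀ c d, Φ (c, d) = Φ (c, 0) + d * Ψ (c, d) := by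
  have hΦ' : ContDiff ℝ (⊤ : ℕ∞) (fderiv ℝ Φ) :=
    hΦ.fderiv_right (m := (⊤ : ℕ∞)) (by norm_cast)
  refine ⟨fun p => ∫ θ in (0 : ℝ)..1, fderiv ℝ Φ (p.1, θ * p.2) (0, 1), ?_, fun c d => ?_⟩
  · exact contDiff_integral_unit (G := fun q : (ℝ × ℝ) × ℝ =>
      fderiv ℝ Φ (q.1.1, q.2 * q.1.2) (0, 1))
      ((hΦ'.comp (by fun_prop)).clm_apply contDiff_const)
  · have hd : ∀ θ ∈ Set.uIcc (0 : ℝ) 1, HasDerivAt (fun θ : ℝ => Φ (c, θ * d))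
        (d * fderiv ℝ Φ (c, θ * d) (0, 1)) θ := by
      intro θ _
      have h1 : HasFDerivAt Φ (fderiv ℝ Φ (c, θ * d)) (c, θ * d) :=
        (hΦ.differentiable (by simp)).differentiableAt.hasFDerivAt
      have h2 : HasDerivAt (fun θ : ℝ => (c, θ * d)) ((0 : ℝ), 1 * d) θ :=
        (hasDerivAt_const θ c).prodMk ((hasDerivAt_id θ).mul_const d)
      have h3 := h1.comp_hasDerivAt θ h2
      rwa [show ((0 : ℝ), 1 * d) = d • ((0 : ℝ), (1 : ℝ)) by simp, map_smul, smul_eq_mul] at h3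
    have hcont : Continuous fun θ : ℝ => d * fderiv ℝ Φ (c, θ * d) (0, 1) :=
      continuous_const.mul ((hΦ'.continuous.comp (by fun_prop)).clm_apply continuous_const)
    have := intervalIntegral.integral_eq_sub_of_hasDerivAt hd (hcont.intervalIntegrable _ _)
    rw [intervalIntegral.integral_const_mul] at this
    simp only [one_mul, zero_mul] at this
    linarith

end Multibaker

namespace Multibaker

/-! ### The structure of functions with a characteristic exponent -/

namespace IsT1Function

variable {J : Set ℝ} {f : ℝ → ℝ → ℝ} {m : ℕ} {C : ℝ → ℝ}

theorem tendsto_diag (hf : IsT1Function J f m C) {x : ℝ} (hx : x ∈ J) :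
    Tendsto (fun a : ℝ => f (x + a) (x - a) / a ^ m) (𝓝[≠] 0) (𝓝 (C x)) := by
  have h := hf.char_lim x hx 1 (-1) (by norm_num)
  refine h.congr fun a => ?_
  norm_num [sub_eq_add_neg]

/-- The parity of `f` is the parity of its characteristic exponent. -/
theorem swap (hf : IsT1Function J f m C) (hJ : IsOpen J) {p q : ℝ} (hp : p ∈ J) (hq : q ∈ J) :
    f q p = (-1) ^ m * f p q := by
  obtain ⟨x, hx, hCx⟩ := hf.nonzero
  have hneg : Tendsto (fun a : ℝ => -a) (𝓝[≠] 0) (𝓝[≠] 0) := by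
    refine tendsto_nhdsWithin_iff.2 ⟨?_, ?_⟩
    · have : Tendsto (fun a : ℝ => -a) (𝓝 0) (𝓝 (-0)) := continuous_neg.tendsto 0
      rw [neg_zero] at this
      exact this.mono_left nhdsWithin_le_nhds
    · filter_upwards [self_mem_nhdsWithin] with a ha
      simpa using ha
  have h1 := hf.tendsto_diag hx
  have h2 := h1.comp hneg
  have hmem : ∀ᶠ a : ℝ in 𝓝[≠] 0, x + a ∈ J ∧ x - a ∈ J := by
    refine Eventually.filter_mono nhdsWithin_le_nhds ?_
    have ha : Tendsto (fun a : ℝ => x + a) (𝓝 0) (𝓝 x) := by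
      simpa using (continuous_const.add continuous_id).tendsto (0 : ℝ) (f := fun a => x + a)
    have hb : Tendsto (fun a : ℝ => x - a) (𝓝 0) (𝓝 x) := by
      simpa using (continuous_const.sub continuous_id).tendsto (0 : ℝ) (f := fun a => x - a)
    exact (ha.eventually (hJ.mem_nhds hx)).and (hb.eventually (hJ.mem_nhds hx))
  -- Replacing a by -a turns the limit C(x) into σ(-1)^m C(x). At a point with C(x) ≠ 0 this forces
  -- σ(-1)^m = 1.
  have key : ∀ σ : ℝ, (∀ x ∈ J, ∀ y ∈ J, f y x = σ * f x y) → σ = 1 ∨ σ = -1 →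
      σ = (-1) ^ m := by
    intro σ hσ hσ1
    have h3 : Tendsto (fun a : ℝ => σ * (-1) ^ m * (f (x + a) (x - a) / a ^ m)) (𝓝[≠] 0)
        (𝓝 (C x)) := by
      refine h2.congr' ?_
      filter_upwards [hmem, self_mem_nhdsWithin] with a ha ha0
      have ha0 : a ≠ 0 := ha0
      simp only [Function.comp, sub_neg_eq_add, ← sub_eq_add_neg]
      rw [hσ _ ha.1 _ ha.2, neg_pow]
      rcases neg_one_pow_eq_or ℝ m with h | h <;> rw [h] <;> field_simp
    have h4 := tendsto_nhds_unique (h1.const_mul (σ * (-1) ^ m)) h3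
    have h5 : σ * (-1) ^ m = 1 := mul_right_cancel₀ hCx (by rw [h4, one_mul])
    rcases neg_one_pow_eq_or ℝ m with h | h <;> rw [h] at h5 ⊢ <;> linarith
  rcases hf.symm_or_antisymm with h | h
  · rw [← key 1 (fun x hx y hy => by rw [h x hx y hy, one_mul]) (Or.inl rfl), h p hp q hq, one_mul]
  · rw [← key (-1) (fun x hx y hy => by rw [h x hx y hy]; ring) (Or.inr rfl), h p hp q hq]
    ring

end IsT1Function

/-- Nothing is known about f off `J ×ˢ J`, but near such a point one of the two cutoff factors is
identically zero. -/
theorem contDiff_cutoff_mul {J : Set ℝ} {f : ℝ → ℝ → ℝ} {χ : ℝ → ℝ} (hJ : IsOpen J)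
    (hf : ContDiffOn ℝ (⊤ : ℕ∞) (fun p : ℝ × ℝ => f p.1 p.2) (J ×ˢ J))
    (hχ : ContDiff ℝ (⊤ : ℕ∞) χ) (hsupp : tsupport χ ⊆ J) :
    ContDiff ℝ (⊤ : ℕ∞) fun p : ℝ × ℝ => χ p.1 * χ p.2 * f p.1 p.2 := by
  rw [contDiff_iff_contDiffAt]
  rintro ⟨x, y⟩
  by_cases hx : x ∈ tsupport χ
  · by_cases hy : y ∈ tsupport χ
    · have h1 := hf.contDiffAt ((hJ.prod hJ).mem_nhds (⟨hsupp hx, hsupp hy⟩ : (x, y) ∈ J ×ˢ J))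
      exact ((hχ.comp contDiff_fst).contDiffAt.mul (hχ.comp contDiff_snd).contDiffAt).mul h1
    · have h0 : ∀ᶠ p : ℝ × ℝ in 𝓝 (x, y), χ p.2 = 0 :=
        continuousAt_snd.eventually (notMem_tsupport_iff_eventuallyEq.1 hy)
      refine contDiffAt_const (c := (0 : ℝ)) |>.congr_of_eventuallyEq ?_
      filter_upwards [h0] with p hp
      simp [hp]
  · have h0 : ∀ᶠ p : ℝ × ℝ in 𝓝 (x, y), χ p.1 = 0 :=
      continuousAt_fst.eventually (notMem_tsupport_iff_eventuallyEq.1 hx)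
    refine contDiffAt_const (c := (0 : ℝ)) |>.congr_of_eventuallyEq ?_
    filter_upwards [h0] with p hp
    simp [hp]

/-- A smooth function of `(c, d)` that is `O(d ^ m)` on every vertical line, factored. -/
theorem exists_contDiff_pow_mul {Φ : ℝ × ℝ → ℝ} (hΦ : ContDiff ℝ (⊤ : ℕ∞) Φ) {m : ℕ} {C : ℝ → ℝ}
    (hlim : ∀ c, Tendsto (fun d : ℝ => Φ (c, d) / d ^ m) (𝓝[≠] 0) (𝓝 (C c))) :
    ∃ F : ℝ × ℝ → ℝ, ContDiff ℝ (⊤ : ℕ∞) F ∧ (∀ c d, Φ (c, d) = d ^ m * F (c, d)) ∧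
      ∀ c, F (c, 0) = C c := by
  -- After i factors d have been split off, the limit determines the value at d = 0. It is zero for
  -- i < m, so that a further factor can be extracted, and C(c) for i = m.
  have lim0 : ∀ {i : ℕ} {F : ℝ × ℝ → ℝ}, ContDiff ℝ (⊤ : ℕ∞) F →
      (∀ c d, Φ (c, d) = d ^ i * F (c, d)) → i ≤ m → ∀ c, F (c, 0) = C c * 0 ^ (m - i) := by
    intro i F hF hΦF hi c
    have h1 : Tendsto (fun d : ℝ => F (c, d)) (𝓝[≠] 0) (𝓝 (F (c, 0))) :=
      (hF.continuous.comp (by fun_prop : Continuous fun d : ℝ => (c, d))).continuousAt.mono_left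
        nhdsWithin_le_nhds
    have h2 : Tendsto (fun d : ℝ => Φ (c, d) / d ^ m * d ^ (m - i)) (𝓝[≠] 0)
        (𝓝 (C c * 0 ^ (m - i))) :=
      (hlim c).mul (((continuous_pow (m - i)).tendsto 0).mono_left nhdsWithin_le_nhds)
    refine tendsto_nhds_unique h1 (h2.congr' ?_)
    filter_upwards [self_mem_nhdsWithin] with d hd
    have hd : d ≠ 0 := hd
    rw [hΦF, show d ^ m = d ^ i * d ^ (m - i) by rw [← pow_add]; congr 1; omega]
    field_simp
  have step : ∀ i ≤ m, ∃ F : ℝ × ℝ → ℝ, ContDiff ℝ (⊤ : ℕ∞) F ∧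
      ∀ c d, Φ (c, d) = d ^ i * F (c, d) := by
    intro i
    induction i with
    | zero => exact fun _ => ⟨Φ, hΦ, by simp⟩
    | succ i ih =>
      intro hi
      obtain ⟨F, hF, hΦF⟩ := ih (by omega)
      obtain ⟨G, hG, hFG⟩ := exists_contDiff_eq_add_mul hF
      refine ⟨G, hG, fun c d => ?_⟩
      rw [hΦF, hFG, lim0 hF hΦF (by omega) c, zero_pow (by omega)]
      ring
  obtain ⟨F, hF, hΦF⟩ := step m le_rfl
  exact ⟨F, hF, hΦF, fun c => by simpa using lim0 hF hΦF le_rfl c⟩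

/-- A smooth function that is even in the second variable. -/
theorem exists_contDiff_eq_add_sq_mul {F : ℝ × ℝ → ℝ} (hF : ContDiff ℝ (⊤ : ℕ∞) F)
    (heven : ∀ c d, F (c, -d) = F (c, d)) :
    ∃ H : ℝ × ℝ → ℝ, ContDiff ℝ (⊤ : ℕ∞) H ∧ ∀ c d, F (c, d) = F (c, 0) + d ^ 2 * H (c, d) := by
  obtain ⟨G, hG, hFG⟩ := exists_contDiff_eq_add_mul hF
  obtain ⟨H, hH, hGH⟩ := exists_contDiff_eq_add_mul hG
  refine ⟨H, hH, fun c d => ?_⟩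
  -- The difference quotient of an even function is odd off d = 0, hence by continuity it vanishes
  -- there and is divisible by d once more.
  have hG0 : G (c, 0) = 0 := by
    have h1 : Tendsto (fun d : ℝ => G (c, d)) (𝓝[≠] 0) (𝓝 (G (c, 0))) :=
      (hG.continuous.comp (by fun_prop : Continuous fun d : ℝ => (c, d))).continuousAt.mono_left
        nhdsWithin_le_nhds
    have h2 : Tendsto (fun d : ℝ => -G (c, -d)) (𝓝[≠] 0) (𝓝 (-G (c, -0))) :=
      ((hG.continuous.comp (by fun_prop : Continuous fun d : ℝ => (c, -d))).continuousAt.neg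
        ).mono_left nhdsWithin_le_nhds
    have h3 : G (c, 0) = -G (c, -0) := by
      refine tendsto_nhds_unique h1 (h2.congr' ?_)
      filter_upwards [self_mem_nhdsWithin] with d hd
      have hd : d ≠ 0 := hd
      have e1 := hFG c d
      have e2 := hFG c (-d)
      rw [heven] at e2
      have : d * (G (c, d) + G (c, -d)) = 0 := by linarith
      rcases mul_eq_zero.1 this with h | h
      · exact absurd h hd
      · linarith
    rw [neg_zero] at h3
    linarith
  rw [hFG, hGH, hG0]
  ring

/-- Taylor's formula of second order at a variable point, with a continuous remainder. -/
theorem exists_taylor_two {C : ℝ → ℝ} (hC : ContDiff ℝ (⊤ : ℕ∞) C) :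
    ∃ K : ℝ × ℝ → ℝ, Continuous K ∧ (∀ y, K (y, 0) = iteratedDeriv 2 C y / 2) ∧
      ∀ y c, C (y + c) = C y + c * iteratedDeriv 1 C y + c ^ 2 * K (y, c) := by
  -- Hadamard's lemma is applied twice to (y, c) ↦ C(y + c); the two coefficients are identified
  -- afterwards by differentiating in c at 0.
  obtain ⟨Ψ, hΨ, h1⟩ := exists_contDiff_eq_add_mul (Φ := fun p => C (p.1 + p.2))
    (hC.comp (by fun_prop))
  obtain ⟨K, hK, h2⟩ := exists_contDiff_eq_add_mul hΨ
  have key : ∀ y c, C (y + c) = C y + c * Ψ (y, 0) + c ^ 2 * K (y, c) := by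
    intro y c
    have e1 := h1 y c
    have e2 := h2 y c
    simp only [add_zero] at e1
    rw [e1, e2]; ring
  have hk : ∀ y, ContDiff ℝ (⊤ : ℕ∞) fun c => K (y, c) := fun y => hK.comp (by fun_prop)
  have hd1 : ∀ y, deriv (fun c => C (y + c)) = fun c =>
      Ψ (y, 0) + (2 * c * K (y, c) + c ^ 2 * deriv (fun c => K (y, c)) c) := by
    intro y
    funext c
    have hKd : HasDerivAt (fun c => K (y, c)) (deriv (fun c => K (y, c)) c) c :=
      ((hk y).differentiable (by simp)).differentiableAt.hasDerivAt
    have : HasDerivAt (fun c => C y + c * Ψ (y, 0) + c ^ 2 * K (y, c))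
        (0 + 1 * Ψ (y, 0) + ((2 : ℕ) * c ^ (2 - 1) * 1 * K (y, c)
          + c ^ 2 * deriv (fun c => K (y, c)) c)) c :=
      (((hasDerivAt_const c (C y)).add ((hasDerivAt_id c).mul_const _))).add
        (((hasDerivAt_id c).pow 2).mul hKd)
    rw [funext (key y), this.deriv]
    norm_num
  have hshift : ∀ y, deriv (fun c => C (y + c)) = fun c => deriv C (y + c) := fun y => by
    funext c
    exact deriv_comp_const_add C y c
  have hΨ0 : ∀ y, Ψ (y, 0) = iteratedDeriv 1 C y := by
    intro y
    have e := congrFun ((hshift y).symm.trans (hd1 y)) 0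
    rw [iteratedDeriv_one]
    simpa using e.symm
  refine ⟨K, hK.continuous, fun y => ?_, fun y c => by rw [key, hΨ0]⟩
  have e := congrArg (fun g => deriv g 0) ((hshift y).symm.trans (hd1 y))
  have hKd : HasDerivAt (fun c => K (y, c)) (deriv (fun c => K (y, c)) 0) 0 :=
    ((hk y).differentiable (by simp)).differentiableAt.hasDerivAt
  have hKd' : HasDerivAt (deriv fun c => K (y, c)) (deriv (deriv fun c => K (y, c)) 0) 0 := by
    have : ContDiff ℝ 1 (deriv fun c => K (y, c)) :=
      ((contDiff_infty_iff_deriv.1 (hk y)).2).of_le (by simp)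
    exact (this.differentiable one_ne_zero).differentiableAt.hasDerivAt
  have hd2 : HasDerivAt (fun c => Ψ (y, 0) + (2 * c * K (y, c)
      + c ^ 2 * deriv (fun c => K (y, c)) c)) (0 + (2 * 1 * K (y, 0) + 2 * 0 * _ +
        ((2 : ℕ) * 0 ^ (2 - 1) * 1 * deriv (fun c => K (y, c)) 0 + 0 ^ 2 * _))) (0 : ℝ) :=
    (hasDerivAt_const (0 : ℝ) (Ψ (y, 0))).add
      ((((hasDerivAt_id (0 : ℝ)).const_mul 2).mul hKd).add
        (((hasDerivAt_id (0 : ℝ)).pow 2).mul hKd'))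
  rw [hd2.deriv, deriv_comp_const_add] at e
  rw [iteratedDeriv_succ, iteratedDeriv_one]
  norm_num at e
  linarith

/-- Near the diagonal, `f` is a power of the difference times a smooth function which is even in
the difference. -/
theorem IsT1Function.exists_expansion {J : Set ℝ} {f : ℝ → ℝ → ℝ} {m : ℕ} {C : ℝ → ℝ}
    (hf : IsT1Function J f m C) (hJ : IsOpen J) {x : ℝ} (hx : x ∈ J) :
    ContDiffAt ℝ (⊤ : ℕ∞) C x ∧ ∃ K H : ℝ × ℝ → ℝ, Continuous K ∧ Continuous H ∧
      (∀ᶠ y in 𝓝 x, K (y, 0) = iteratedDeriv 2 C y / 2) ∧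
      ∀ᶠ q : ℝ × ℝ × ℝ in 𝓝 (x, 0, 0),
        f (q.1 + q.2.1 + q.2.2) (q.1 + q.2.1 - q.2.2) = q.2.2 ^ m *
          (C q.1 + q.2.1 * iteratedDeriv 1 C q.1 + q.2.1 ^ 2 * K (q.1, q.2.1)
            + q.2.2 ^ 2 * H (q.1 + q.2.1, q.2.2)) := by
  obtain ⟨R, hR, hRJ⟩ := Metric.isOpen_iff.1 hJ x hx
  let χ : ContDiffBump x := ⟨R / 4, R / 2, by linarith, by linarith⟩
  have hχ : ContDiff ℝ (⊤ : ℕ∞) (χ : ℝ → ℝ) := χ.contDiff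
  have hsupp : tsupport (χ : ℝ → ℝ) ⊆ J := by
    rw [χ.tsupport_eq]
    exact (Metric.closedBall_subset_ball (by change R / 2 < R; linarith)).trans hRJ
  have hone : ∀ᶠ y in 𝓝 x, χ y = 1 := χ.eventuallyEq_one
  -- The coordinates are the mean and the half difference of the arguments. The cutoff makes the
  -- function smooth on the whole plane, so that the global factorization lemmas apply.
  set Φ : ℝ × ℝ → ℝ := fun p => χ (p.1 + p.2) * χ (p.1 - p.2) * f (p.1 + p.2) (p.1 - p.2) with hΦdef
  have hΦ : ContDiff ℝ (⊤ : ℕ∞) Φ := (contDiff_cutoff_mul hJ hf.smooth hχ hsupp).comp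
    (by fun_prop : ContDiff ℝ (⊤ : ℕ∞) fun p : ℝ × ℝ => (p.1 + p.2, p.1 - p.2))
  -- Both cutoff factors tend to χ(c) as d → 0, hence the square.
  set C₁ : ℝ → ℝ := fun y => χ y ^ 2 * C y with hC₁def
  have hlim : ∀ c, Tendsto (fun d : ℝ => Φ (c, d) / d ^ m) (𝓝[≠] 0) (𝓝 (C₁ c)) := by
    intro c
    have hp : Tendsto (fun d : ℝ => c + d) (𝓝[≠] 0) (𝓝 c) := by
      have := ((continuous_const.add continuous_id).tendsto (0 : ℝ) (f := fun d => c + d))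
      rw [add_zero] at this
      exact this.mono_left nhdsWithin_le_nhds
    have hm : Tendsto (fun d : ℝ => c - d) (𝓝[≠] 0) (𝓝 c) := by
      have := ((continuous_const.sub continuous_id).tendsto (0 : ℝ) (f := fun d => c - d))
      rw [sub_zero] at this
      exact this.mono_left nhdsWithin_le_nhds
    by_cases hc : c ∈ tsupport (χ : ℝ → ℝ)
    · have h1 := (((χ.continuous.tendsto c).comp hp).mul ((χ.continuous.tendsto c).comp hm)).mul
        (hf.tendsto_diag (hsupp hc))
      have e : C₁ c = χ c * χ c * C c := by simp only [hC₁def]; ring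
      rw [e]
      refine h1.congr fun d => ?_
      simp only [hΦdef, Function.comp]
      ring
    · have h0 : (χ : ℝ → ℝ) =ᶠ[𝓝 c] 0 := notMem_tsupport_iff_eventuallyEq.1 hc
      have e : C₁ c = 0 := by simp [hC₁def, h0.eq_of_nhds]
      rw [e]
      refine tendsto_const_nhds.congr' ?_
      filter_upwards [hp.eventually h0] with d hd
      simp only [Pi.zero_apply] at hd
      simp [hΦdef, hd]
  obtain ⟨F, hF, hΦF, hF0⟩ := exists_contDiff_pow_mul hΦ hlim
  have hΦswap : ∀ c d, Φ (c, -d) = (-1) ^ m * Φ (c, d) := by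
    intro c d
    simp only [hΦdef, sub_neg_eq_add, ← sub_eq_add_neg]
    by_cases h1 : c + d ∈ J
    · by_cases h2 : c - d ∈ J
      · rw [hf.swap hJ h1 h2]; ring
      · rw [image_eq_zero_of_notMem_tsupport fun h => h2 (hsupp h)]; ring
    · rw [image_eq_zero_of_notMem_tsupport fun h => h1 (hsupp h)]; ring
  -- The sign (-1)^m from exchanging the arguments of f is exactly that of d^m, so the quotient is
  -- even and has no term linear in d.
  have heven : ∀ c d, F (c, -d) = F (c, d) := by
    intro c d
    rcases eq_or_ne d 0 with rfl | hd
    · simp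
    · have h := hΦswap c d
      rw [hΦF, hΦF, neg_pow, mul_assoc] at h
      have hne : ((-1 : ℝ) ^ m) ≠ 0 := pow_ne_zero _ (by norm_num)
      exact mul_left_cancel₀ (pow_ne_zero m hd) (mul_left_cancel₀ hne h)
  obtain ⟨H, hH, hFH⟩ := exists_contDiff_eq_add_sq_mul hF heven
  have hC₁ : ContDiff ℝ (⊤ : ℕ∞) C₁ := by
    have : C₁ = fun c => F (c, 0) := funext fun c => (hF0 c).symm
    rw [this]
    exact hF.comp (by fun_prop)
  obtain ⟨K, hK, hK0, hCK⟩ := exists_taylor_two hC₁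
  -- Agreement on a neighbourhood of every nearby point, so that derivatives may be exchanged there
  -- as well as values.
  have heq : ∀ᶠ y in 𝓝 x, C =ᶠ[𝓝 y] C₁ := by
    refine eventually_eventually_nhds.2 ?_
    filter_upwards [hone] with y hy
    simp [hC₁def, hy]
  refine ⟨hC₁.contDiffAt.congr_of_eventuallyEq heq.self_of_nhds, K, H, hK, hH.continuous, ?_, ?_⟩
  · filter_upwards [heq] with y hy
    rw [hK0, hy.iteratedDeriv_eq]
  · have t1 : Tendsto (fun q : ℝ × ℝ × ℝ => q.1 + q.2.1 + q.2.2) (𝓝 (x, 0, 0)) (𝓝 x) := by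
      have : Continuous fun q : ℝ × ℝ × ℝ => q.1 + q.2.1 + q.2.2 := by fun_prop
      simpa using this.tendsto (x, 0, 0)
    have t2 : Tendsto (fun q : ℝ × ℝ × ℝ => q.1 + q.2.1 - q.2.2) (𝓝 (x, 0, 0)) (𝓝 x) := by
      have : Continuous fun q : ℝ × ℝ × ℝ => q.1 + q.2.1 - q.2.2 := by fun_prop
      simpa using this.tendsto (x, 0, 0)
    filter_upwards [t1.eventually hone, t2.eventually hone, continuousAt_fst.eventually heq]
      with q h1 h2 h3
    have e1 := hΦF (q.1 + q.2.1) q.2.2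
    rw [hFH, hF0, hCK] at e1
    simp only [hΦdef, h1, h2, one_mul] at e1
    rw [e1, h3.iteratedDeriv_eq, h3.eq_of_nhds]

end Multibaker

namespace Multibaker

/-! ### Geometry of the Markov partition -/

theorem sum_filter_lt (g : Fin 3 → ℝ) (a : Fin 3) :
    ∑ ω ∈ Finset.univ.filter (· < a), g ω = ![0, g 0, g 0 + g 1] a := by
  rw [Finset.sum_filter]
  fin_cases a <;> simp [Fin.sum_univ_three]

theorem sum_bulkEta (D v dr tau : ℝ) : ∑ ω, bulkEta D v dr tau ω = 1 := by
  simp [Fin.sum_univ_three, bulkEta]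
  ring

namespace UOFPChain

variable {D v : ℝ} {k : ℕ} (S : UOFPChain D v k)

theorem eta_pos (n : ℕ) (ω : Fin 3) : 0 < S.eta n ω := by
  unfold eta
  split_ifs
  exacts [S.etaLeft_pos ω, S.etaRight_pos ω, S.bulkEta_pos ω]

theorem sum_eta (n : ℕ) : ∑ ω, S.eta n ω = 1 := by
  unfold eta
  split_ifs
  exacts [S.etaLeft_sum, S.etaRight_sum, sum_bulkEta _ _ _ _]

theorem nu_pos (n : ℕ) (ω : Fin 3) : 0 < S.nu n ω := S.eta_pos n _

theorem sum_nu (n : ℕ) : S.nu n 0 + S.nu n 1 + S.nu n 2 = 1 := by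
  have h := S.sum_eta n
  rw [Fin.sum_univ_three] at h
  change S.eta n 2 + S.eta n 1 + S.eta n 0 = 1
  linarith

/-- The lower edge, relative to `h`, of the strip `ω` of the site `n`. -/
def strip (n : ℕ) (ω : Fin 3) : ℝ := ![0, S.nu n 0, S.nu n 0 + S.nu n 1] ω

theorem strip_nonneg (n : ℕ) (ω : Fin 3) : 0 ≤ S.strip n ω := by
  have h0 := S.nu_pos n 0
  have h1 := S.nu_pos n 1
  fin_cases ω <;> simp [strip] <;> linarith

theorem strip_add_nu_le_one (n : ℕ) (ω : Fin 3) : S.strip n ω + S.nu n ω ≤ 1 := by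
  have h := S.sum_nu n
  have h0 := S.nu_pos n 0
  have h1 := S.nu_pos n 1
  have h2 := S.nu_pos n 2
  fin_cases ω <;> simp [strip] <;> linarith

theorem strip_add_nu_le (n : ℕ) {a b : Fin 3} (hab : a < b) :
    S.strip n a + S.nu n a ≤ S.strip n b := by
  have h0 := S.nu_pos n 0
  have h1 := S.nu_pos n 1
  have h2 := S.nu_pos n 2
  fin_cases a <;> fin_cases b <;> first | (exact absurd hab (by decide)) | (simp [strip]; try linarith)

theorem height_succ (p n : ℕ) (w : Fin (p + 1) → Fin 3) :
    S.height (p + 1) n w = S.nu n (w 0) * S.height p (S.source n (w 0)) (Fin.tail w) := rfl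

theorem lower_succ (p n : ℕ) (w : Fin (p + 1) → Fin 3) :
    S.lower (p + 1) n w
      = S.strip n (w 0) + S.nu n (w 0) * S.lower p (S.source n (w 0)) (Fin.tail w) := by
  rw [strip, ← sum_filter_lt]
  rfl

theorem height_pos : ∀ (p n : ℕ) (w : Fin p → Fin 3), 0 < S.height p n w
  | 0, _, _ => one_pos
  | p + 1, n, w => by
    rw [height_succ]
    exact mul_pos (S.nu_pos _ _) (height_pos p _ _)

theorem lower_nonneg : ∀ (p n : ℕ) (w : Fin p → Fin 3), 0 ≤ S.lower p n w
  | 0, _, _ => le_rfl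
  | p + 1, n, w => by
    rw [lower_succ]
    exact add_nonneg (S.strip_nonneg _ _) (mul_nonneg (S.nu_pos _ _).le (lower_nonneg p _ _))

theorem lower_add_height_le_one : ∀ (p n : ℕ) (w : Fin p → Fin 3),
    S.lower p n w + S.height p n w ≤ 1
  | 0, _, _ => by simp [lower, height]
  | p + 1, n, w => by
    have ih := lower_add_height_le_one p (S.source n (w 0)) (Fin.tail w)
    have h1 := S.strip_add_nu_le_one n (w 0)
    have h2 := mul_le_mul_of_nonneg_left ih (S.nu_pos n (w 0)).le
    rw [lower_succ, height_succ]
    linarith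

/-- Every cell lies in the strip of its first symbol. -/
theorem strip_le_lower (p n : ℕ) (w : Fin (p + 1) → Fin 3) :
    S.strip n (w 0) ≤ S.lower (p + 1) n w := by
  rw [lower_succ]
  exact le_add_of_nonneg_right (mul_nonneg (S.nu_pos _ _).le (S.lower_nonneg _ _ _))

theorem lower_add_height_le_strip (p n : ℕ) (w : Fin (p + 1) → Fin 3) :
    S.lower (p + 1) n w + S.height (p + 1) n w ≤ S.strip n (w 0) + S.nu n (w 0) := by
  have h2 := mul_le_mul_of_nonneg_left
    (S.lower_add_height_le_one p (S.source n (w 0)) (Fin.tail w)) (S.nu_pos n (w 0)).le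
  rw [lower_succ, height_succ]
  linarith

/-- Different cells of a site do not overlap. -/
theorem lower_separated : ∀ (p n : ℕ) (w w' : Fin p → Fin 3), w ≠ w' →
    S.lower p n w + S.height p n w ≤ S.lower p n w' ∨
      S.lower p n w' + S.height p n w' ≤ S.lower p n w
  | 0, _, w, w', h => absurd (Subsingleton.elim w w') h
  | p + 1, n, w, w', h => by
    rcases lt_trichotomy (w 0) (w' 0) with h0 | h0 | h0
    · exact Or.inl ((S.lower_add_height_le_strip p n w).trans
        ((S.strip_add_nu_le n h0).trans (S.strip_le_lower p n w')))
    · have htail : Fin.tail w ≠ Fin.tail w' := by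
        intro ht
        apply h
        rw [← Fin.cons_self_tail w, ← Fin.cons_self_tail w', h0, ht]
      have hν := (S.nu_pos n (w' 0)).le
      simp only [lower_succ, height_succ, h0]
      rcases lower_separated p (S.source n (w' 0)) _ _ htail with h1 | h1
      · left
        have := mul_le_mul_of_nonneg_left h1 hν
        linarith
      · right
        have := mul_le_mul_of_nonneg_left h1 hν
        linarith
    · exact Or.inr ((S.lower_add_height_le_strip p n w').trans
        ((S.strip_add_nu_le n h0).trans (S.strip_le_lower p n w)))

/-- A cell is contained in the cell of the word without its last symbol. -/
theorem lower_init : ∀ (p n : ℕ) (w : Fin (p + 1) → Fin 3),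
    S.lower p n (Fin.init w) ≤ S.lower (p + 1) n w ∧
      S.lower (p + 1) n w + S.height (p + 1) n w
        ≤ S.lower p n (Fin.init w) + S.height p n (Fin.init w)
  | 0, n, w => by
    have h1 := S.lower_nonneg 1 n w
    have h2 := S.lower_add_height_le_one 1 n w
    simpa [lower, height] using And.intro h1 h2
  | p + 1, n, w => by
    obtain ⟨h1, h2⟩ := lower_init p (S.source n (w 0)) (Fin.tail w)
    have hν := (S.nu_pos n (w 0)).le
    have e1 := S.lower_succ p n (Fin.init w)
    have e2 := S.height_succ p n (Fin.init w)
    have e0 : Fin.init w 0 = w 0 := rfl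
    rw [e0, Fin.tail_init_eq_init_tail] at e1 e2
    rw [e1, e2, S.lower_succ (p + 1), S.height_succ (p + 1)]
    have h1' := mul_le_mul_of_nonneg_left h1 hν
    have h2' := mul_le_mul_of_nonneg_left h2 hν
    constructor <;> linarith

theorem liouville_real_prod (n : ℕ) (A B : Set ℝ) :
    liouville.real ({n} ×ˢ A ×ˢ B) = volume.real A * volume.real B := by
  rw [liouville, measureReal_prod_prod, Measure.volume_eq_prod, measureReal_prod_prod]
  simp [measureReal_def]

theorem vol_eq (i : Cell S.N k) : S.vol i = S.dr * (S.h * S.height k i.1 i.2) := by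
  have h1 := S.dr_pos
  have h2 := mul_pos S.h_pos (S.height_pos k i.1 i.2)
  rw [vol, cell, liouville_real_prod, Real.volume_real_Icc_of_le h1.le,
    Real.volume_real_Icc_of_le (by nlinarith)]
  ring

theorem vol_pos (i : Cell S.N k) : 0 < S.vol i := by
  rw [vol_eq]
  exact mul_pos S.dr_pos (mul_pos S.h_pos (S.height_pos _ _ _))

theorem Wt_eq (j i : Cell S.N k) : S.Wt j i = liouville.real (S.cell i ∩ S.map ⁻¹' S.cell j) := by
  rw [Wt, W, div_mul_cancel₀ _ (S.vol_pos i).ne']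

/-- The part of the horizontal extent of the site `n` which is mapped to the site
`n - 1 + s`. -/
def column (n : ℕ) (s : Fin 3) : Set ℝ :=
  ![Set.Ico 0 (S.eta n 0 * S.dr),
    Set.Ico (S.eta n 0 * S.dr) ((S.eta n 0 + S.eta n 1) * S.dr),
    Set.Icc ((S.eta n 0 + S.eta n 1) * S.dr) S.dr] s

theorem volume_column (n : ℕ) (s : Fin 3) : volume.real (S.column n s) = S.eta n s * S.dr := by
  have hd := S.dr_pos
  have h0 := mul_pos (S.eta_pos n 0) hd
  have h1 := mul_pos (S.eta_pos n 1) hd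
  have h2 := mul_pos (S.eta_pos n 2) hd
  have h := S.sum_eta n
  rw [Fin.sum_univ_three] at h
  have h' : S.eta n 0 * S.dr + S.eta n 1 * S.dr + S.eta n 2 * S.dr = S.dr := by
    rw [← add_mul, ← add_mul, h, one_mul]
  fin_cases s
  · simp [column, h0.le]
  · simp only [column]
    change volume.real (Set.Ico (S.eta n 0 * S.dr) ((S.eta n 0 + S.eta n 1) * S.dr)) = S.eta n 1 * S.dr
    rw [Real.volume_real_Ico_of_le (by linarith)]
    ring
  · change volume.real (Set.Icc ((S.eta n 0 + S.eta n 1) * S.dr) S.dr) = S.eta n 2 * S.dr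
    rw [Real.volume_real_Icc_of_le (by linarith)]
    linarith

/-- Each branch stretches its column onto the full width, so the horizontal condition is automatic
and only the vertical affine contraction onto the strip `s` of the target site remains. The relation
of the sites is written additively to avoid truncated subtraction. -/
theorem map_mem_iff {n n' : ℕ} (hn : 0 < n ∧ n < S.N) {x y : ℝ} (hx : x ∈ Set.Icc 0 S.dr)
    {s : Fin 3} (hs : n' + 1 = n + s) (Y : Set ℝ) :
    S.map (n, x, y) ∈ ({n'} ×ˢ Set.Icc 0 S.dr ×ˢ Y : Set Phase) ↔
      x ∈ S.column n s ∧ S.strip n' s * S.h + S.nu n' s * y ∈ Y := by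
  have hd := S.dr_pos
  have e0 := S.eta_pos n 0
  have e1 := S.eta_pos n 1
  have e2 := S.eta_pos n 2
  have h := S.sum_eta n
  rw [Fin.sum_univ_three] at h
  have h0 := mul_pos e0 hd
  have h1 := mul_pos e1 hd
  have h2 := mul_pos e2 hd
  have h' : S.eta n 0 * S.dr + S.eta n 1 * S.dr + S.eta n 2 * S.dr = S.dr := by
    rw [← add_mul, ← add_mul, h, one_mul]
  obtain ⟨hx0, hx1⟩ := hx
  rw [map, if_pos hn]
  by_cases c0 : x < S.eta n 0 * S.dr
  · rw [if_pos c0]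
    fin_cases s
    · obtain rfl : n' = n - 1 := by simp at hs; omega
      simp only [Set.mem_prod, Set.mem_singleton_iff, true_and, Set.mem_Icc, div_le_iff₀ e0,
        column, strip]
      simp [hx0, c0, div_nonneg hx0 e0.le, mul_comm S.dr, c0.le]
    · have : n - 1 ≠ n' := by simp at hs; omega
      simp [column, this, c0]
    · have : n - 1 ≠ n' := by simp at hs; omega
      have : x < (S.eta n 0 + S.eta n 1) * S.dr := by linarith
      simp [column, *]
  · rw [if_neg c0]
    by_cases c1 : x < (S.eta n 0 + S.eta n 1) * S.dr
    · rw [if_pos c1]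
      fin_cases s
      · have : n ≠ n' := by simp at hs; omega
        simp [column, this, c0]
      · obtain rfl : n' = n := by simp at hs; omega
        have a1 : 0 ≤ x - S.eta n' 0 * S.dr := by linarith
        have a2 : x - S.eta n' 0 * S.dr ≤ S.dr * S.eta n' 1 := by linarith
        have a3 : S.eta n' 0 * S.dr ≤ x := by linarith
        simp only [Set.mem_prod, Set.mem_singleton_iff, true_and, Set.mem_Icc, div_le_iff₀ e1]
        simp [column, strip, a2, a3, c1, div_nonneg a1 e1.le]
      · have : n ≠ n' := by simp at hs; omega
        simp [column, *]
    · rw [if_neg c1]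
      have a3 : (S.eta n 0 + S.eta n 1) * S.dr ≤ x := by linarith
      fin_cases s
      · have : n + 1 ≠ n' := by simp at hs; omega
        simp [column, this, c0]
      · have : n + 1 ≠ n' := by simp at hs; omega
        simp only [Set.mem_prod, Set.mem_singleton_iff, this, false_and, false_iff, not_and]
        intro hx
        exact absurd hx.2 c1
      · obtain rfl : n' = n + 1 := by simp at hs; omega
        have a1 : 0 ≤ x - (S.eta n 0 + S.eta n 1) * S.dr := by linarith
        have a2 : x - (S.eta n 0 + S.eta n 1) * S.dr ≤ S.dr * S.eta n 2 := by linarith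
        simp only [Set.mem_prod, Set.mem_singleton_iff, true_and, Set.mem_Icc, div_le_iff₀ e2]
        simp [column, strip, a2, a3, hx1, div_nonneg a1 e2.le]

end UOFPChain
end Multibaker

namespace Multibaker
namespace UOFPChain

/-! ### Transition volumes -/

variable {D v : ℝ} {k : ℕ}

theorem source_of_eq (S : UOFPChain D v k) {n n' : ℕ} (hn : 0 < n ∧ n < S.N) {s : Fin 3}
    (hs : n' + 1 = n + s) : S.source n' s = n := by
  have := s.2
  unfold source
  omega

/-- The vertical extent of the part of the cell `(n, w)` which is mapped into the cell `(n', w')`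
by the `s`-th branch of the map. -/
theorem volume_branch (S : UOFPChain D v (k + 1)) {n n' : ℕ} (hn : 0 < n ∧ n < S.N) {s : Fin 3}
    (hs : n' + 1 = n + s) (w w' : Fin (k + 1) → Fin 3) :
    volume.real {y | y ∈ Set.Icc (S.h * S.lower (k + 1) n w)
        (S.h * (S.lower (k + 1) n w + S.height (k + 1) n w)) ∧
        S.strip n' s * S.h + S.nu n' s * y ∈ Set.Icc (S.h * S.lower (k + 1) n' w')
        (S.h * (S.lower (k + 1) n' w' + S.height (k + 1) n' w'))}
      = if w' = Fin.cons s (Fin.init w) then S.h * S.height (k + 1) n w else 0 := by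
  have hh := S.h_pos
  have hν := S.nu_pos n' s
  have hsrc := S.source_of_eq hn hs
  -- Cells are closed and may share an edge, so non-matching words can still meet in one point; such
  -- sets are null rather than empty.
  have null : ∀ {A : Set ℝ} (a : ℝ), A ⊆ {a} → volume.real A = 0 := fun a hA =>
    (measureReal_mono_null hA (by simp [measureReal_def]) (by simp))
  have hlo : 0 ≤ S.lower (k + 1) n w := S.lower_nonneg _ _ _
  have hhi := S.lower_add_height_le_one (k + 1) n w
  have hpos := S.height_pos (k + 1) n w
  by_cases h0 : w' 0 = s
  · have e1 := S.lower_succ k n' w'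
    have e2 := S.height_succ k n' w'
    rw [h0, hsrc] at e1 e2
    -- Undoing the contraction onto the strip `s` removes the first symbol of the target word; what
    -- remains is comparison with a cell of a word one symbol shorter.
    have hiff : ∀ y, S.strip n' s * S.h + S.nu n' s * y ∈ Set.Icc (S.h * S.lower (k + 1) n' w')
        (S.h * (S.lower (k + 1) n' w' + S.height (k + 1) n' w')) ↔
        y ∈ Set.Icc (S.h * S.lower k n (Fin.tail w'))
          (S.h * (S.lower k n (Fin.tail w') + S.height k n (Fin.tail w'))) := by
      intro y
      rw [e1, e2, Set.mem_Icc, Set.mem_Icc,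
        ← mul_le_mul_iff_right₀ hν (b := S.h * S.lower k n (Fin.tail w')),
        ← mul_le_mul_iff_right₀ hν (b := y)]
      constructor <;> rintro ⟨h1, h2⟩ <;> constructor <;> linarith
    simp only [hiff]
    obtain ⟨i1, i2⟩ := S.lower_init k n w
    by_cases ht : Fin.tail w' = Fin.init w
    · have hw : w' = Fin.cons s (Fin.init w) := by
        rw [← ht, ← h0, Fin.cons_self_tail]
      rw [if_pos hw, ht]
      have : {y | y ∈ Set.Icc (S.h * S.lower (k + 1) n w)
          (S.h * (S.lower (k + 1) n w + S.height (k + 1) n w)) ∧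
          y ∈ Set.Icc (S.h * S.lower k n (Fin.init w))
          (S.h * (S.lower k n (Fin.init w) + S.height k n (Fin.init w)))}
          = Set.Icc (S.h * S.lower (k + 1) n w)
          (S.h * (S.lower (k + 1) n w + S.height (k + 1) n w)) := by
        ext y
        simp only [Set.mem_ofPred_eq, and_iff_left_iff_imp]
        rintro ⟨h1, h2⟩
        exact ⟨(mul_le_mul_of_nonneg_left i1 hh.le).trans h1,
          h2.trans (mul_le_mul_of_nonneg_left i2 hh.le)⟩
      rw [this, Real.volume_real_Icc_of_le (by nlinarith)]
      ring
    · have hw : w' ≠ Fin.cons s (Fin.init w) := by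
        rintro rfl
        exact ht (Fin.tail_cons _ _)
      rw [if_neg hw]
      rcases S.lower_separated k n _ _ ht with hsep | hsep
      · refine null (S.h * S.lower (k + 1) n w) ?_
        rintro y ⟨⟨h1, h2⟩, h3, h4⟩
        exact le_antisymm (h4.trans (mul_le_mul_of_nonneg_left (hsep.trans i1) hh.le)) h1
      · refine null (S.h * (S.lower (k + 1) n w + S.height (k + 1) n w)) ?_
        rintro y ⟨⟨h1, h2⟩, h3, h4⟩
        exact le_antisymm h2 ((mul_le_mul_of_nonneg_left (i2.trans hsep) hh.le).trans h3)
  · have hw : w' ≠ Fin.cons s (Fin.init w) := by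
      rintro rfl
      exact h0 (Fin.cons_zero _ _)
    rw [if_neg hw]
    have b1 := S.strip_le_lower k n' w'
    have b2 := S.lower_add_height_le_strip k n' w'
    rcases lt_or_gt_of_ne h0 with hlt | hlt
    · refine null 0 ?_
      rintro y ⟨⟨h1, h2⟩, h3, h4⟩
      have hy0 : 0 ≤ y := (mul_nonneg hh.le hlo).trans h1
      have := mul_le_mul_of_nonneg_left (b2.trans (S.strip_add_nu_le n' hlt)) hh.le
      have h5 : S.nu n' s * y ≤ 0 := by linarith
      exact le_antisymm (nonpos_of_mul_nonpos_right h5 hν) hy0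
    · refine null S.h ?_
      rintro y ⟨⟨h1, h2⟩, h3, h4⟩
      have hy1 : y ≤ S.h := h2.trans (mul_le_of_le_one_right hh.le hhi)
      have := mul_le_mul_of_nonneg_left ((S.strip_add_nu_le n' hlt).trans b1) hh.le
      have h5 : S.nu n' s * S.h ≤ S.nu n' s * y := by linarith
      exact le_antisymm hy1 (le_of_mul_le_mul_left h5 hν)

/-- Transition volumes out of a cell of a non-boundary site. -/
theorem Wt_of_bulk (S : UOFPChain D v (k + 1)) (i j : Cell S.N (k + 1))
    (hi : 0 < (i.1 : ℕ) ∧ (i.1 : ℕ) < S.N) :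
    S.Wt j i = ∑ s : Fin 3, if (j.1 : ℕ) + 1 = i.1 + s ∧ j.2 = Fin.cons s (Fin.init i.2)
      then S.eta i.1 s * S.vol i else 0 := by
  rw [Wt_eq]
  by_cases hex : ∃ s : Fin 3, (j.1 : ℕ) + 1 = i.1 + s
  · obtain ⟨s, hs⟩ := hex
    have huniq : ∀ s' : Fin 3, (j.1 : ℕ) + 1 = i.1 + s' ↔ s' = s := fun s' =>
      ⟨fun h => Fin.ext (by omega), fun h => h ▸ hs⟩
    simp only [huniq, ite_and, Finset.sum_ite_eq', Finset.mem_univ, if_true]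
    have hset : S.cell i ∩ S.map ⁻¹' S.cell j = {(i.1 : ℕ)} ×ˢ S.column i.1 s ×ˢ
        {y | y ∈ Set.Icc (S.h * S.lower (k + 1) i.1 i.2)
          (S.h * (S.lower (k + 1) i.1 i.2 + S.height (k + 1) i.1 i.2)) ∧
          S.strip j.1 s * S.h + S.nu j.1 s * y ∈ Set.Icc (S.h * S.lower (k + 1) j.1 j.2)
          (S.h * (S.lower (k + 1) j.1 j.2 + S.height (k + 1) j.1 j.2))} := by
      have hcol : S.column i.1 s ⊆ Set.Icc 0 S.dr := by
        have hd := S.dr_pos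
        have h0 := mul_pos (S.eta_pos i.1 0) hd
        have h1 := mul_pos (S.eta_pos i.1 1) hd
        have h2 := mul_pos (S.eta_pos i.1 2) hd
        have h := S.sum_eta i.1
        rw [Fin.sum_univ_three] at h
        have h' : S.eta i.1 0 * S.dr + S.eta i.1 1 * S.dr + S.eta i.1 2 * S.dr = S.dr := by
          rw [← add_mul, ← add_mul, h, one_mul]
        unfold column
        intro x hx
        fin_cases s <;> obtain ⟨hx1, hx2⟩ := hx <;> constructor <;> linarith
      ext ⟨n, x, y⟩
      constructor
      · rintro ⟨⟨hn, hx, hy⟩, hmap⟩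
        obtain rfl : n = i.1 := hn
        have := (S.map_mem_iff hi hx hs _).1 hmap
        exact ⟨rfl, this.1, hy, this.2⟩
      · rintro ⟨hn, hx, hy, hy'⟩
        obtain rfl : n = i.1 := hn
        exact ⟨⟨rfl, hcol hx, hy⟩, (S.map_mem_iff hi (hcol hx) hs _).2 ⟨hx, hy'⟩⟩
    rw [hset, liouville_real_prod, volume_column, volume_branch S hi hs, vol_eq]
    split_ifs <;> ring
  · have hempty : S.cell i ∩ S.map ⁻¹' S.cell j = ∅ := by
      rw [Set.eq_empty_iff_forall_notMem]
      rintro ⟨n, x, y⟩ ⟨⟨hn, hx, hy⟩, hmap⟩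
      obtain rfl : n = i.1 := hn
      have hsite : (S.map (i.1, x, y)).1 = j.1 := hmap.1
      apply hex
      rw [map, if_pos hi] at hsite
      split_ifs at hsite
      · exact ⟨0, by simp at hsite ⊢; omega⟩
      · exact ⟨1, by simp at hsite ⊢; omega⟩
      · exact ⟨2, by simp at hsite ⊢; omega⟩
    rw [hempty, measureReal_empty]
    refine (Finset.sum_eq_zero fun s _ => if_neg fun h => hex ⟨s, h.1⟩).symm

theorem cell_subset_siteSet (S : UOFPChain D v k) (i : Cell S.N k) :
    S.cell i ⊆ siteSet S.dr S.h i.1 := by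
  rintro ⟨n, x, y⟩ ⟨hn, hx, hy1, hy2⟩
  refine ⟨hn, hx, (mul_nonneg S.h_pos.le (S.lower_nonneg _ _ _)).trans hy1,
    hy2.trans (mul_le_of_le_one_right S.h_pos.le (S.lower_add_height_le_one _ _ _))⟩

/-- A boundary site sends nothing to the sites `2, …, N - 2`. -/
theorem Wt_of_boundary (S : UOFPChain D v k) (i j : Cell S.N k)
    (hi : ¬(0 < (i.1 : ℕ) ∧ (i.1 : ℕ) < S.N)) (hj : 2 ≤ (j.1 : ℕ) ∧ (j.1 : ℕ) + 2 ≤ S.N) :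
    S.Wt j i = 0 := by
  rw [Wt_eq]
  have hempty : S.cell i ∩ S.map ⁻¹' S.cell j = ∅ := by
    rw [Set.eq_empty_iff_forall_notMem]
    rintro ⟨n, x, y⟩ ⟨hc, hmap⟩
    have hsite := S.cell_subset_siteSet i hc
    obtain rfl : n = i.1 := hc.1
    have hj' : (S.map (i.1, x, y)).1 = j.1 := hmap.1
    rw [map, if_neg hi] at hj'
    have hi2 := i.1.2
    have hcase : (i.1 : ℕ) = 0 ∨ (i.1 : ℕ) = S.N := by omega
    rcases hcase with h | h
    · rw [h] at hsite hj'
      rcases S.bdry_left hsite with h' | h' <;> have := h'.1 <;>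
        simp only [Set.mem_singleton_iff] at this <;> omega
    · rw [h] at hsite hj'
      rcases S.bdry_right hsite with h' | h' <;> have := h'.1 <;>
        simp only [Set.mem_singleton_iff] at this <;> omega
  rw [hempty, measureReal_empty]

/-- The cell to which the `s`-th part of the cell `i` is mapped. -/
def fwd (S : UOFPChain D v (k + 1)) (i : Cell S.N (k + 1)) (s : Fin 3) : Cell S.N (k + 1) :=
  (Fin.ofNat (S.N + 1) (i.1 + s - 1), Fin.cons s (Fin.init i.2))

/-- The cells which are mapped to the cell `i`. -/
def bwd (S : UOFPChain D v (k + 1)) (i : Cell S.N (k + 1)) (t : Fin 3) : Cell S.N (k + 1) :=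
  (Fin.ofNat (S.N + 1) (i.1 + 1 - i.2 0), Fin.snoc (α := fun _ => Fin 3) (Fin.tail i.2) t)

/-- At interior sites neither the reduction modulo `S.N + 1` in `Fin.ofNat` nor the natural
subtraction has any effect. -/
theorem fwd_site (S : UOFPChain D v (k + 1)) (i : Cell S.N (k + 1)) (s : Fin 3)
    (hi : 0 < (i.1 : ℕ) ∧ (i.1 : ℕ) < S.N) : ((S.fwd i s).1 : ℕ) + 1 = i.1 + s := by
  have := s.2
  simp only [fwd, Fin.ofNat]
  rw [Nat.mod_eq_of_lt] <;> omega

theorem bwd_site (S : UOFPChain D v (k + 1)) (i : Cell S.N (k + 1)) (t : Fin 3)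
    (hi : 0 < (i.1 : ℕ) ∧ (i.1 : ℕ) < S.N) : ((S.bwd i t).1 : ℕ) + i.2 0 = i.1 + 1 := by
  have := (i.2 0).2
  simp only [bwd, Fin.ofNat]
  rw [Nat.mod_eq_of_lt] <;> omega

theorem sum_Wt_fwd (S : UOFPChain D v (k + 1)) (i : Cell S.N (k + 1))
    (hi : 0 < (i.1 : ℕ) ∧ (i.1 : ℕ) < S.N) (Φ : Cell S.N (k + 1) → ℝ) :
    ∑ j, S.Wt j i * Φ j = ∑ s, S.eta i.1 s * S.vol i * Φ (S.fwd i s) := by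
  have hiff : ∀ (j : Cell S.N (k + 1)) (s : Fin 3),
      ((j.1 : ℕ) + 1 = i.1 + s ∧ j.2 = Fin.cons s (Fin.init i.2)) ↔ j = S.fwd i s := by
    intro j s
    constructor
    · rintro ⟨h1, h2⟩
      have h3 := S.fwd_site i s hi
      exact Prod.ext (Fin.ext (by omega)) h2
    · rintro rfl
      exact ⟨S.fwd_site i s hi, rfl⟩
  simp only [S.Wt_of_bulk i _ hi, hiff, Finset.sum_mul, ite_mul, zero_mul]
  rw [Finset.sum_comm]
  simp

/-- The symbol dropped by the map is free, so a cell has three preimage cells, one for each choice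
of last symbol. Two sites of distance from the ends are required because the unspecified boundary
dynamics may fill the sites 0, 1, N - 1 and N. -/
theorem sum_Wt_bwd (S : UOFPChain D v (k + 1)) (i : Cell S.N (k + 1))
    (hi : 2 ≤ (i.1 : ℕ) ∧ (i.1 : ℕ) + 2 ≤ S.N) (Φ : Cell S.N (k + 1) → ℝ) :
    ∑ j, S.Wt i j * Φ j =
      ∑ t, S.eta (S.bwd i t).1 (i.2 0) * S.vol (S.bwd i t) * Φ (S.bwd i t) := by
  have hi' : 0 < (i.1 : ℕ) ∧ (i.1 : ℕ) < S.N := by omega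
  have key : ∀ j, S.Wt i j
      = ∑ t, if j = S.bwd i t then S.eta (S.bwd i t).1 (i.2 0) * S.vol (S.bwd i t) else 0 := by
    intro j
    by_cases hj : 0 < (j.1 : ℕ) ∧ (j.1 : ℕ) < S.N
    · rw [S.Wt_of_bulk j i hj]
      by_cases hex : ∃ t, j = S.bwd i t
      · obtain ⟨t, rfl⟩ := hex
        have hinj : ∀ t', S.bwd i t = S.bwd i t' ↔ t' = t := by
          intro t'
          refine ⟨fun h => ?_, fun h => by rw [h]⟩
          have := congrFun (congrArg Prod.snd h) (Fin.last k)
          simpa [bwd] using this.symm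
        have hc : ∀ s : Fin 3, ((i.1 : ℕ) + 1 = (S.bwd i t).1 + s ∧
            i.2 = Fin.cons s (Fin.init (S.bwd i t).2)) ↔ s = i.2 0 := by
          intro s
          constructor
          · rintro ⟨-, h2⟩
            rw [h2, Fin.cons_zero]
          · rintro rfl
            refine ⟨(S.bwd_site i t hi').symm, ?_⟩
            simp [bwd, Fin.init_snoc, Fin.cons_self_tail]
        simp only [hc, hinj, Finset.sum_ite_eq', Finset.mem_univ, if_true]
      · rw [Finset.sum_eq_zero, Finset.sum_eq_zero]
        · exact fun t _ => if_neg fun h => hex ⟨t, h⟩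
        · rintro s -
          refine if_neg ?_
          rintro ⟨h1, h2⟩
          apply hex
          refine ⟨j.2 (Fin.last k), Prod.ext (Fin.ext ?_) ?_⟩
          · have h3 := S.bwd_site i (j.2 (Fin.last k)) hi'
            have h4 : i.2 0 = s := by rw [h2, Fin.cons_zero]
            rw [h4] at h3
            omega
          · have h4 : Fin.tail i.2 = Fin.init j.2 := by rw [h2, Fin.tail_cons]
            simp only [bwd, h4, Fin.snoc_init_self]
    · rw [S.Wt_of_boundary j i hj hi, Finset.sum_eq_zero]
      rintro t -
      refine if_neg ?_
      rintro rfl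
      have h3 := S.bwd_site i t hi'
      have := (i.2 0).2
      omega
  simp only [key, Finset.sum_mul, ite_mul, zero_mul]
  rw [Finset.sum_comm]
  simp

end UOFPChain
end Multibaker

namespace Multibaker
namespace UOFPChain

/-! ### Bulk sites -/

variable {D v : ℝ} {k : ℕ}

theorem sum_words_cons (F : (Fin (k + 1) → Fin 3) → ℝ) :
    ∑ w, F w = ∑ s : Fin 3, ∑ a : Fin k → Fin 3, F (Fin.cons s a) := by
  rw [← Fintype.sum_prod_type', ← (Fin.consEquiv fun _ => Fin 3).sum_comp]
  rfl

theorem sum_words_snoc (F : (Fin (k + 1) → Fin 3) → ℝ) :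
    ∑ w, F w = ∑ t : Fin 3, ∑ a : Fin k → Fin 3, F (Fin.snoc (α := fun _ => Fin 3) a t) := by
  rw [← Fintype.sum_prod_type', ← (Fin.snocEquiv fun _ => Fin 3).sum_comp]
  rfl

/-- The transition probabilities `η(ω)` of the non-boundary sites. -/
def ηb (S : UOFPChain D v k) : Fin 3 → ℝ := bulkEta D v S.dr S.tau

/-- `ν(ω) = η(2 - ω)` of the non-boundary sites. -/
def νb (S : UOFPChain D v k) (ω : Fin 3) : ℝ := S.ηb ω.rev

/-- The ratio `η(ω) / ν(ω)` of a density after and before a passage through the strip `ω`. -/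
def gain (S : UOFPChain D v k) (ω : Fin 3) : ℝ := S.ηb ω / S.νb ω

theorem ηb_pos (S : UOFPChain D v k) (ω : Fin 3) : 0 < S.ηb ω := S.bulkEta_pos ω

theorem νb_pos (S : UOFPChain D v k) (ω : Fin 3) : 0 < S.νb ω := S.bulkEta_pos ω.rev

theorem sum_νb (S : UOFPChain D v k) : ∑ ω, S.νb ω = 1 := by
  have h := sum_bulkEta D v S.dr S.tau
  rw [Fin.sum_univ_three] at h ⊢
  change S.ηb 2 + S.ηb 1 + S.ηb 0 = 1
  simp only [ηb]
  linarith

theorem eta_eq_ηb (S : UOFPChain D v k) {n : ℕ} (hn : 0 < n ∧ n < S.N) : S.eta n = S.ηb := by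
  rw [eta, if_neg (by omega), if_neg (by omega), ηb]

theorem nu_eq_νb (S : UOFPChain D v k) {n : ℕ} (hn : 0 < n ∧ n < S.N) : S.nu n = S.νb := by
  funext ω
  rw [nu, νb, S.eta_eq_ηb hn]

/-- The site `n` has distance at least `c` from both boundary sites. -/
def Deep (S : UOFPChain D v k) (c n : ℕ) : Prop := c ≤ n ∧ n + c ≤ S.N

/-- Each symbol moves the source by at most one site, so depth `p` keeps every site at which ν is
evaluated in the interior, where ν is the same everywhere. -/
theorem height_eq_prod (S : UOFPChain D v k) : ∀ (p n : ℕ) (w : Fin p → Fin 3), S.Deep p n →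
    S.height p n w = ∏ i, S.νb (w i)
  | 0, _, _, _ => by simp [height]
  | p + 1, n, w, hn => by
    obtain ⟨h1, h2⟩ := hn
    have h3 := (w 0).2
    rw [height_succ, S.nu_eq_νb (by omega), Fin.prod_univ_succ,
      height_eq_prod S p (S.source n (w 0)) (Fin.tail w) ⟨by unfold source; omega, by unfold source; omega⟩]
    rfl

theorem sum_height (S : UOFPChain D v k) : ∀ (p n : ℕ), ∑ w : Fin p → Fin 3, S.height p n w = 1
  | 0, _ => by simp [height]
  | p + 1, n => by
    rw [sum_words_cons]
    have : ∀ s, ∑ a : Fin p → Fin 3, S.height (p + 1) n (Fin.cons s a) = S.nu n s := by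
      intro s
      simp only [height_succ, Fin.cons_zero, Fin.tail_cons]
      rw [← Finset.mul_sum, sum_height S p, mul_one]
    simp only [this]
    rw [Fin.sum_univ_three, S.sum_nu]

theorem vol_eq_prod (S : UOFPChain D v k) (i : Cell S.N k) (hi : S.Deep k i.1) :
    S.vol i = S.dr * S.h * ∏ r, S.νb (i.2 r) := by
  rw [vol_eq, S.height_eq_prod _ _ _ hi, mul_assoc]

theorem sum_vol (S : UOFPChain D v k) (n : Fin (S.N + 1)) :
    ∑ w, S.vol (n, w) = S.dr * S.h := by
  simp only [vol_eq, ← Finset.mul_sum, S.sum_height]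
  ring

theorem prod_snoc (g : Fin 3 → ℝ) (a : Fin k → Fin 3) (t : Fin 3) :
    ∏ r, g (Fin.snoc (α := fun _ => Fin 3) a t r) = (∏ r, g (a r)) * g t := by
  rw [Fin.prod_univ_castSucc]
  simp

theorem prod_cons (g : Fin 3 → ℝ) (a : Fin k → Fin 3) (t : Fin 3) :
    ∏ r, g (Fin.cons (α := fun _ => Fin 3) t a r) = g t * ∏ r, g (a r) := by
  rw [Fin.prod_univ_succ]
  simp

theorem sum_snoc_val (a : Fin k → Fin 3) (t : Fin 3) :
    ∑ r, (Fin.snoc (α := fun _ => Fin 3) a t r : ℕ) = (∑ r, (a r : ℕ)) + t := by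
  rw [Fin.sum_univ_castSucc]
  simp

theorem sum_cons_val (a : Fin k → Fin 3) (t : Fin 3) :
    ∑ r, (Fin.cons (α := fun _ => Fin 3) t a r : ℕ) = t + ∑ r, (a r : ℕ) := by
  rw [Fin.sum_univ_succ]
  simp

/-- The inflow is summed over the free last symbol of the preimages, whose ν-weights add up to 1; of
the ratio of volumes only the first symbol survives. The preimages lie one site away, which costs
one unit of depth beyond the word length. -/
theorem expansion_eq (S : UOFPChain D v (k + 1)) (j : Cell S.N (k + 1))
    (hj : S.Deep (k + 2) j.1) : S.expansion j = S.νb (j.2 0) / S.ηb (j.2 0) := by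
  obtain ⟨h1, h2⟩ := hj
  have h3 := (j.2 0).2
  have hb := S.sum_Wt_bwd j ⟨by omega, by omega⟩ (fun _ => 1)
  have hν : 0 < ∏ r, S.νb (Fin.tail j.2 r) := Finset.prod_pos fun r _ => S.νb_pos _
  have hs : ∑ i, S.Wt j i = S.ηb (j.2 0) * (S.dr * S.h * ∏ r, S.νb (Fin.tail j.2 r)) := by
    simp only [mul_one] at hb
    rw [hb]
    have : ∀ t, S.eta (S.bwd j t).1 (j.2 0) * S.vol (S.bwd j t)
        = S.ηb (j.2 0) * (S.dr * S.h * ∏ r, S.νb (Fin.tail j.2 r)) * S.νb t := by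
      intro t
      have hsite := S.bwd_site j t (by omega)
      rw [S.eta_eq_ηb (by omega), S.vol_eq_prod _ ⟨by omega, by omega⟩]
      simp only [bwd, prod_snoc]
      ring
    simp only [this, ← Finset.mul_sum, S.sum_νb, mul_one]
  rw [expansion, hs, S.vol_eq_prod j ⟨by omega, by omega⟩, Fin.prod_univ_succ]
  have hη := S.ηb_pos (j.2 0)
  have hd := S.dr_pos
  have hh := S.h_pos
  change S.dr * S.h * (S.νb (j.2 0) * ∏ r, S.νb (Fin.tail j.2 r)) / _ = _
  field_simp

/-- A transition probability is a transition volume divided by the volume of the source, so the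
preimage volumes cancel and each preimage passes on the fraction η of its probability. -/
theorem prob_succ (S : UOFPChain D v (k + 1)) (l : ℕ) (j : Cell S.N (k + 1))
    (hj : S.Deep 2 j.1) :
    S.prob (l + 1) j = S.ηb (j.2 0) * ∑ t, S.prob l (S.bwd j t) := by
  obtain ⟨h1, h2⟩ := hj
  have h3 := (j.2 0).2
  have hb := S.sum_Wt_bwd j ⟨by omega, by omega⟩ (fun i => S.prob l i / S.vol i)
  have e : S.prob (l + 1) j = ∑ i, S.Wt j i * (S.prob l i / S.vol i) := by
    change ∑ i, S.W j i * S.prob l i = _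
    refine Finset.sum_congr rfl fun i _ => ?_
    have := (S.vol_pos i).ne'
    rw [Wt]
    field_simp
  rw [e, hb, Finset.mul_sum]
  refine Finset.sum_congr rfl fun t _ => ?_
  have hsite := S.bwd_site j t (by omega)
  have := (S.vol_pos (S.bwd j t)).ne'
  rw [S.eta_eq_ηb (by omega)]
  field_simp

/-- The probability of the cells of the site `n` whose word begins with `a`. -/
def marginal (S : UOFPChain D v (k + 1)) (p : ℕ) (hp : p ≤ k + 1) (l n : ℕ) (a : Fin p → Fin 3) : ℝ :=
  ∑ w : Fin (k + 1) → Fin 3,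
    if ∀ r : Fin p, w (Fin.castLE hp r) = a r then S.prob l (Fin.ofNat (S.N + 1) n, w) else 0

/-- One time step uses up exactly the first prescribed symbol, since the last symbol of the preimage
word is summed over anyway. -/
theorem marginal_succ (S : UOFPChain D v (k + 1)) (p : ℕ) (hp : p + 1 ≤ k + 1) (l n : ℕ)
    (a : Fin (p + 1) → Fin 3) (hn : S.Deep 2 n) :
    S.marginal (p + 1) hp (l + 1) n a
      = S.ηb (a 0) * S.marginal p (by omega) l (n + 1 - a 0) (Fin.tail a) := by
  obtain ⟨h1, h2⟩ := hn
  have hmod : (Fin.ofNat (S.N + 1) n : ℕ) = n := by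
    simp only [Fin.ofNat]
    exact Nat.mod_eq_of_lt (by omega)
  have hcond : ∀ (s : Fin 3) (c : Fin k → Fin 3),
      (∀ r : Fin (p + 1), (Fin.cons s c : Fin (k + 1) → Fin 3) (Fin.castLE hp r) = a r) ↔
        s = a 0 ∧ ∀ r : Fin p, c (Fin.castLE (by omega) r) = Fin.tail a r := by
    intro s c
    rw [Fin.forall_fin_succ]
    exact Iff.rfl
  have hcond' : ∀ (t : Fin 3) (c : Fin k → Fin 3),
      (∀ r : Fin p, (Fin.snoc c t : Fin (k + 1) → Fin 3) (Fin.castLE (by omega) r) = Fin.tail a r) ↔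
        ∀ r : Fin p, c (Fin.castLE (by omega) r) = Fin.tail a r := by
    intro t c
    refine forall_congr' fun r => ?_
    have : (Fin.castLE (by omega : p ≤ k + 1) r) = Fin.castSucc (Fin.castLE (by omega : p ≤ k) r) := rfl
    rw [this, Fin.snoc_castSucc]
  unfold marginal
  -- The new word is split at its first symbol and the old one at its last, so that both sums run
  -- over the same middle words.
  rw [sum_words_cons, sum_words_snoc]
  simp only [hcond, hcond']
  rw [Finset.sum_eq_single (a 0), Finset.sum_comm, Finset.mul_sum]
  · refine Finset.sum_congr rfl fun c _ => ?_
    simp only [true_and]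
    split_ifs
    · rw [prob_succ _ _ _ ⟨by rw [hmod]; exact h1, by rw [hmod]; exact h2⟩]
      simp only [bwd, hmod, Fin.cons_zero, Fin.tail_cons]
    · simp
  · intro s _ hs
    simp [hs]
  · simp

/-- The total probability of the site `n`. -/
def siteProb (S : UOFPChain D v k) (l n : ℕ) : ℝ := ∑ w, S.prob l (Fin.ofNat (S.N + 1) n, w)

/-- Iterating the one-step relation until the prefix is exhausted leaves an unrestricted sum over
the words of one site. -/
theorem marginal_eq (S : UOFPChain D v (k + 1)) (l : ℕ) : ∀ (p : ℕ) (hp : p ≤ k + 1) (n : ℕ)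
    (a : Fin p → Fin 3), S.Deep (p + 1) n →
    S.marginal p hp (l + p) n a
      = (∏ r, S.ηb (a r)) * S.siteProb l (n + p - ∑ r, (a r : ℕ))
  | 0, hp, n, a, _ => by simp [marginal, siteProb]
  | p + 1, hp, n, a, hn => by
    obtain ⟨h1, h2⟩ := hn
    have h3 := (a 0).2
    rw [← add_assoc, S.marginal_succ p hp (l + p) n a ⟨by omega, by omega⟩,
      marginal_eq S l p (by omega) _ _ ⟨by omega, by omega⟩, Fin.prod_univ_succ, Fin.sum_univ_succ]
    have : n + 1 - (a 0 : ℕ) + p - ∑ r, (Fin.tail a r : ℕ)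
        = n + (p + 1) - ((a 0 : ℕ) + ∑ r : Fin p, (a r.succ : ℕ)) := by
      simp only [Fin.tail]
      omega
    rw [this, mul_assoc]
    rfl

/-- After as many steps as the word has symbols, the distribution among the cells of a site is
forgotten, and the word records the whole passage. The word enters through a product and a sum over
its symbols only. -/
theorem density_eq (S : UOFPChain D v (k + 1)) (l : ℕ) (j : Cell S.N (k + 1))
    (hj : S.Deep (k + 2) j.1) :
    S.density (l + (k + 1)) j = (∏ r, S.gain (j.2 r)) *
      S.siteDensity l (Fin.ofNat (S.N + 1) (j.1 + (k + 1) - ∑ r, (j.2 r : ℕ))) := by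
  obtain ⟨h1, h2⟩ := hj
  have hm := S.marginal_eq l (k + 1) le_rfl j.1 j.2 ⟨h1, h2⟩
  have hmod : Fin.ofNat (S.N + 1) (j.1 : ℕ) = j.1 := by
    apply Fin.ext
    simp only [Fin.ofNat]
    exact Nat.mod_eq_of_lt (by omega)
  have e : S.marginal (k + 1) le_rfl (l + (k + 1)) j.1 j.2 = S.prob (l + (k + 1)) j := by
    unfold marginal
    rw [hmod]
    have : ∀ w : Fin (k + 1) → Fin 3,
        (∀ r : Fin (k + 1), w (Fin.castLE le_rfl r) = j.2 r) ↔ w = j.2 := fun w =>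
      funext_iff.symm
    simp only [this, Finset.sum_ite_eq', Finset.mem_univ, if_true]
  rw [density, ← e, hm, S.vol_eq_prod j ⟨by omega, by omega⟩, siteDensity, S.sum_vol]
  have hν : 0 < ∏ r, S.νb (j.2 r) := Finset.prod_pos fun r _ => S.νb_pos _
  have hd := S.dr_pos
  have hh := S.h_pos
  simp only [gain, Finset.prod_div_distrib, siteProb]
  field_simp

end UOFPChain
end Multibaker

/-! ### The site average as a weighted sum over pairs of branches -/

namespace Multibaker

/-- The displacement `ω - 1` of the `ω`-th branch. -/
def disp (ω : Fin 3) : ℝ := (ω : ℕ) - 1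

namespace UOFPChain

variable {D v : ℝ} {k : ℕ}

/-- The sum over all pairs of consecutive passages of the local quantity, for a density profile
`Q` around the common site. -/
def branchSum (S : UOFPChain D v k) (f : ℝ → ℝ → ℝ) (ε δ : ℝ) (Q : ℝ → ℝ) : ℝ :=
  ∑ s, ∑ t, (S.ηb s + δ * S.νb s) * S.νb t *
    (f (S.gain s * Q 0) (S.gain t * Q (-disp t * S.dr))
      + ε * f (S.gain t * Q (-(disp s + disp t) * S.dr)) (S.gain s * Q (-disp s * S.dr)))

/-- In both directions the expansion rate in the factor 1 + δe belongs to the cell that receives the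
volume, whose first symbol is the branch used; multiplied by η it gives η + δν. The target cells lie
one site away, hence one more unit of depth than for `expansion_eq`. -/
theorem localQuantity_eq (S : UOFPChain D v (k + 1)) (f : ℝ → ℝ → ℝ) (ε δ : ℝ) (l : ℕ)
    (i : Cell S.N (k + 1)) (hi : S.Deep (k + 3) i.1) :
    S.localQuantity f ε δ l i =
      (∑ s, (S.ηb s + δ * S.νb s) * S.vol i * f (S.density l (S.fwd i s)) (S.density l i))
        + ε * ∑ t, (S.ηb (i.2 0) + δ * S.νb (i.2 0)) * S.vol (S.bwd i t)
          * f (S.density l (S.bwd i t)) (S.density l i) := by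
  obtain ⟨h1, h2⟩ := hi
  have e : S.localQuantity f ε δ l i =
      (∑ j, S.Wt j i * ((1 + δ * S.expansion j) * f (S.density l j) (S.density l i)))
        + ε * (1 + δ * S.expansion i) * ∑ j, S.Wt i j * f (S.density l j) (S.density l i) := by
    rw [localQuantity, Finset.mul_sum, ← Finset.sum_add_distrib]
    refine Finset.sum_congr rfl fun j _ => ?_
    rw [pairQuantity]
    ring
  rw [e, S.sum_Wt_fwd i (by omega), S.sum_Wt_bwd i (by omega),
    S.expansion_eq i ⟨by omega, by omega⟩, mul_assoc ε,
    Finset.mul_sum Finset.univ _ (1 + δ * (S.νb (i.2 0) / S.ηb (i.2 0)))]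
  congr 1
  · refine Finset.sum_congr rfl fun s _ => ?_
    have hs := S.fwd_site i s (by omega)
    have := s.2
    have hη := (S.ηb_pos s).ne'
    rw [S.expansion_eq _ ⟨by omega, by omega⟩, S.eta_eq_ηb (by omega)]
    simp only [fwd, Fin.cons_zero]
    field_simp
  · congr 1
    refine Finset.sum_congr rfl fun t _ => ?_
    have hs := S.bwd_site i t (by omega)
    have := (i.2 0).2
    have hη := (S.ηb_pos (i.2 0)).ne'
    rw [S.eta_eq_ηb (by omega)]
    field_simp

/-- With `a` the common symbols, outflow goes from the word `a t` to `s a`, and inflow into `s a`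
comes from `a t`. All four densities then carry the factor ∏ gain(a) and sample one profile, centred
at the site n - ∑ disp(a), at the time k + 1 steps back. -/
theorem siteAverage_eq (S : UOFPChain D v (k + 1)) (f : ℝ → ℝ → ℝ) (ε δ : ℝ) (l : ℕ)
    (n : Fin (S.N + 1)) (hn : S.IsBulk (l + (k + 1)) n) (u : ℝ → ℝ → ℝ)
    (hu : ∀ (n : Fin (S.N + 1)) (l : ℕ), S.siteDensity l n = u ((n : ℕ) * S.dr) (l * S.tau)) :
    S.siteAverage f ε δ (l + (k + 1)) n = 1 / S.tau * ∑ a : Fin k → Fin 3, (∏ r, S.νb (a r)) *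
      S.branchSum f ε δ fun x => (∏ r, S.gain (a r)) *
        u (((n : ℕ) - ∑ r, disp (a r)) * S.dr + x) (l * S.tau) := by
  obtain ⟨h1, h2, -⟩ := hn
  -- With this bound and the distance of a bulk site from the ends, no natural subtraction below
  -- truncates and no site index wraps around.
  have hsum : ∀ a : Fin k → Fin 3, ∑ r, (a r : ℕ) ≤ 2 * k := by
    intro a
    have := Finset.sum_le_card_nsmul Finset.univ (fun r => (a r : ℕ)) 2 fun r _ => by omega
    simpa [mul_comm] using this
  have hval : ∀ {m : ℕ}, m ≤ S.N → S.siteDensity l (Fin.ofNat (S.N + 1) m)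
      = u (m * S.dr) (l * S.tau) := by
    intro m hm
    rw [hu]
    simp only [Fin.ofNat]
    rw [Nat.mod_eq_of_lt (by omega)]
  have hcast : ∀ a : Fin k → Fin 3, ((n + k - ∑ r, (a r : ℕ) : ℕ) : ℝ)
      = (n : ℕ) - ∑ r, disp (a r) := by
    intro a
    have := hsum a
    rw [Nat.cast_sub (by omega)]
    simp [disp, Finset.sum_sub_distrib]
    ring
  have hR : ∀ F : Cell S.N (k + 1) → ℝ,
      ∑ i ∈ Finset.univ.filter (fun i : Cell S.N (k + 1) => i.1 = n), F i = ∑ w, F (n, w) := by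
    intro F
    rw [Finset.sum_filter, Fintype.sum_prod_type, Finset.sum_comm]
    simp
  have hdeep : ∀ w : Fin (k + 1) → Fin 3, S.Deep (k + 3) ((n, w) : Cell S.N (k + 1)).1 :=
    fun w => ⟨by simp only; omega, by simp only; omega⟩
  -- the densities in terms of the profile
  have dfwd : ∀ (a : Fin k → Fin 3) (s t : Fin 3),
      S.density (l + (k + 1)) (S.fwd (n, Fin.snoc (α := fun _ => Fin 3) a t) s)
        = S.gain s * ((∏ r, S.gain (a r)) *
          u (((n : ℕ) - ∑ r, disp (a r)) * S.dr + 0) (l * S.tau)) := by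
    intro a s t
    have hs := S.fwd_site (n, Fin.snoc (α := fun _ => Fin 3) a t) s
      ⟨by simp only; omega, by simp only; omega⟩
    have hs3 := s.2
    have ha := hsum a
    simp only at hs
    rw [S.density_eq _ _ ⟨by omega, by omega⟩]
    have hw : (S.fwd (n, Fin.snoc (α := fun _ => Fin 3) a t) s).2 = Fin.cons s a := by
      simp [fwd]
    have e : ((S.fwd (n, Fin.snoc (α := fun _ => Fin 3) a t) s).1 : ℕ) + (k + 1)
        - ((s : ℕ) + ∑ r, (a r : ℕ)) = n + k - ∑ r, (a r : ℕ) := by omega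
    rw [hw, prod_cons, sum_cons_val, e, hval (by omega), hcast, add_zero]
    ring
  have dself : ∀ (a : Fin k → Fin 3) (t : Fin 3),
      S.density (l + (k + 1)) (n, Fin.snoc (α := fun _ => Fin 3) a t)
        = S.gain t * ((∏ r, S.gain (a r)) *
          u (((n : ℕ) - ∑ r, disp (a r)) * S.dr + -disp t * S.dr) (l * S.tau)) := by
    intro a t
    have ht3 := t.2
    have ha := hsum a
    rw [S.density_eq _ _ ⟨by simp only; omega, by simp only; omega⟩]
    have e : (n : ℕ) + (k + 1) - ((∑ r, (a r : ℕ)) + t)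
        = n + k - (∑ r, (a r : ℕ)) + 1 - t := by omega
    have e2 : ((n + k - (∑ r, (a r : ℕ)) + 1 - t : ℕ) : ℝ)
        = ((n : ℕ) - ∑ r, disp (a r)) - disp t := by
      rw [Nat.cast_sub (by omega), Nat.cast_add, hcast, disp]
      push_cast
      ring
    simp only [prod_snoc, sum_snoc_val]
    rw [e, hval (by omega), e2, show ∀ x y z : ℝ, (x - y) * z = x * z + -y * z by intros; ring]
    ring
  have dself' : ∀ (a : Fin k → Fin 3) (t : Fin 3),
      S.density (l + (k + 1)) (n, Fin.cons t a)
        = S.gain t * ((∏ r, S.gain (a r)) *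
          u (((n : ℕ) - ∑ r, disp (a r)) * S.dr + -disp t * S.dr) (l * S.tau)) := by
    intro a t
    -- Moving `t` from the end of the word to its front changes neither the product of gains nor the
    -- total displacement.
    rw [← dself a t, S.density_eq _ _ ⟨by simp only; omega, by simp only; omega⟩,
      S.density_eq _ _ ⟨by simp only; omega, by simp only; omega⟩]
    simp only [prod_snoc, sum_snoc_val, prod_cons, sum_cons_val]
    rw [add_comm (t : ℕ), mul_comm (S.gain t)]
  have dbwd : ∀ (a : Fin k → Fin 3) (s t : Fin 3),
      S.density (l + (k + 1)) (S.bwd (n, Fin.cons s a) t)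
        = S.gain t * ((∏ r, S.gain (a r)) *
          u (((n : ℕ) - ∑ r, disp (a r)) * S.dr + -(disp s + disp t) * S.dr) (l * S.tau)) := by
    intro a s t
    have hs := S.bwd_site (n, Fin.cons s a) t ⟨by simp only; omega, by simp only; omega⟩
    have hs3 := s.2
    have ht3 := t.2
    have ha := hsum a
    simp only [Fin.cons_zero] at hs
    rw [S.density_eq _ _ ⟨by omega, by omega⟩]
    have hw : (S.bwd (n, Fin.cons s a) t).2 = Fin.snoc (α := fun _ => Fin 3) a t := by
      simp [bwd]
    have e : ((S.bwd (n, Fin.cons s a) t).1 : ℕ) + (k + 1) - ((∑ r, (a r : ℕ)) + t)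
        = n + k - (∑ r, (a r : ℕ)) + 2 - (s + t) := by omega
    have e2 : ((n + k - (∑ r, (a r : ℕ)) + 2 - (s + t) : ℕ) : ℝ)
        = ((n : ℕ) - ∑ r, disp (a r)) - (disp s + disp t) := by
      rw [Nat.cast_sub (by omega), Nat.cast_add, hcast, disp, disp]
      push_cast
      ring
    rw [hw, prod_snoc, sum_snoc_val, e, hval (by omega), e2,
      show ∀ x y z : ℝ, (x - y) * z = x * z + -y * z by intros; ring]
    ring
  rw [siteAverage, average, hR, hR, S.sum_vol]
  simp only [S.localQuantity_eq f ε δ _ _ (hdeep _), Finset.sum_add_distrib]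
  -- Outflow words are split at the last symbol, inflow words at the first: in each case this is the
  -- symbol not shared with the partner cell.
  rw [sum_words_snoc, ← Finset.mul_sum, sum_words_cons]
  have vself : ∀ (a : Fin k → Fin 3) (t : Fin 3),
      S.vol (n, Fin.snoc (α := fun _ => Fin 3) a t)
        = S.dr * S.h * ((∏ r, S.νb (a r)) * S.νb t) := by
    intro a t
    rw [S.vol_eq_prod _ ⟨by simp only; omega, by simp only; omega⟩, prod_snoc]
  have vbwd : ∀ (a : Fin k → Fin 3) (s t : Fin 3), S.vol (S.bwd (n, Fin.cons s a) t)
        = S.dr * S.h * ((∏ r, S.νb (a r)) * S.νb t) := by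
    intro a s t
    have hs := S.bwd_site (n, Fin.cons s a) t ⟨by simp only; omega, by simp only; omega⟩
    have hs3 := s.2
    simp only [Fin.cons_zero] at hs
    have hw : (S.bwd (n, Fin.cons s a) t).2 = Fin.snoc (α := fun _ => Fin 3) a t := by
      simp [bwd]
    rw [S.vol_eq_prod _ ⟨by omega, by omega⟩, hw, prod_snoc]
  simp only [dfwd, dself, dself', dbwd, vself, vbwd, Fin.cons_zero, branchSum]
  have hd := S.dr_pos
  have hh := S.h_pos
  have ht := S.tau_pos
  have r1 : ∀ A B : ℝ, 1 / (S.tau * (S.dr * S.h)) * (S.dr * S.h * A + ε * (S.dr * S.h * B))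
      = 1 / S.tau * (A + ε * B) := by
    intro A B
    field_simp
  -- reorder the sums
  have c1 : ∀ F : Fin 3 → (Fin k → Fin 3) → Fin 3 → ℝ, ∑ t, ∑ a, ∑ s, F t a s
      = ∑ a, ∑ s, ∑ t, F t a s := by
    intro F
    rw [Finset.sum_comm]
    exact Finset.sum_congr rfl fun a _ => Finset.sum_comm
  rw [c1, Finset.sum_comm (s := (Finset.univ : Finset (Fin 3)))
    (t := (Finset.univ : Finset (Fin k → Fin 3)))]
  have f1 : ∀ A : (Fin k → Fin 3) → Fin 3 → Fin 3 → ℝ,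
      ∑ a, ∑ s, ∑ t, (S.ηb s + δ * S.νb s) * (S.dr * S.h * ((∏ r, S.νb (a r)) * S.νb t)) * A a s t
      = S.dr * S.h * ∑ a, (∏ r, S.νb (a r)) * ∑ s, ∑ t, (S.ηb s + δ * S.νb s) * S.νb t * A a s t := by
    intro A
    simp only [Finset.mul_sum]
    refine Finset.sum_congr rfl fun a _ => Finset.sum_congr rfl fun s _ =>
      Finset.sum_congr rfl fun t _ => ?_
    ring
  rw [f1, f1, r1]
  congr 1
  rw [Finset.mul_sum, ← Finset.sum_add_distrib]
  refine Finset.sum_congr rfl fun a _ => ?_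
  simp only [mul_add, Finset.sum_add_distrib]
  congr 1
  simp only [Finset.mul_sum]
  refine Finset.sum_congr rfl fun s _ => Finset.sum_congr rfl fun t _ => ?_
  ring

end UOFPChain
end Multibaker

namespace Multibaker

/-! ### Expansion of the local quantity on one pair of branches -/

namespace SiteData

variable (z : SiteData)

/-- The part of order one of twice the half difference of two densities. -/
def formA (σ κ : ℝ) : ℝ := σ * z.X10 + κ * z.X01

/-- The part of order two, up to the factor `1 / 2`. -/
def formB (e : Fin 2) (σ κ : ℝ) : ℝ :=
  σ ^ 2 * z.X e 2 0 + σ * κ * z.X e 1 1 + κ ^ 2 * z.X e 0 2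

/-- The part of order three, up to the factor `1 / 4`. -/
def formE (e : Fin 2) (σ κ : ℝ) : ℝ :=
  σ ^ 3 * z.X e 3 0 + σ ^ 2 * κ * z.X e 2 1 + σ * κ ^ 2 * z.X e 1 2 + κ ^ 3 * z.X e 0 3

/-- The part of order one of the sum of two densities. -/
def formY1 (e : Fin 2) (σ κ : ℝ) : ℝ := σ * z.Y e 1 0 + κ * z.Y e 0 1

/-- The part of order two of the sum of two densities, up to the factor `1 / 2`. -/
def formY2 (e : Fin 2) (σ κ : ℝ) : ℝ :=
  σ ^ 2 * z.Y e 2 0 + σ * κ * z.Y e 1 1 + κ ^ 2 * z.Y e 0 2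

/-- `T0`, `T1`, `T2` are the coefficients of the orders 0, 1, 2 of f divided by (Δr/2)^m. In `T2`
the number `H` stands for the coefficient of d² in f/d^m on the diagonal; its term does not depend
on `e`. The truncated exponents m - 1 and m - 2 are harmless, their prefactors m and m(m - 1) being
zero. -/
def T0 (m : ℕ) (σ κ : ℝ) : ℝ := z.formA σ κ ^ m * z.C

def T1 (m : ℕ) (e : Fin 2) (σ κ : ℝ) : ℝ :=
  m * z.formA σ κ ^ (m - 1) * (z.formB e σ κ / 2) * z.C
    + z.formA σ κ ^ m * (z.C' * (z.formY1 e σ κ / 2))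

def T2 (m : ℕ) (H : ℝ) (e : Fin 2) (σ κ : ℝ) : ℝ :=
  (m * z.formA σ κ ^ (m - 1) * (z.formE e σ κ / 4)
      + (z.formB e σ κ / 2) ^ 2 * (m * ((m : ℝ) - 1) / 2 * z.formA σ κ ^ (m - 2))) * z.C
    + m * z.formA σ κ ^ (m - 1) * (z.formB e σ κ / 2) * (z.C' * (z.formY1 e σ κ / 2))
    + z.formA σ κ ^ m * (z.C' * (z.formY2 e σ κ / 4)
        + (z.formY1 e σ κ / 2) ^ 2 * (z.C'' / 2) + z.formA σ κ ^ 2 / 4 * H)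

/-- Convergence of site data, with fixed `v` and `D`. -/
structure TendsTo {ι : Type} (z : ι → SiteData) (F : Filter ι) (w : SiteData) : Prop where
  v : ∀ j, (z j).v = w.v
  D : ∀ j, (z j).D = w.D
  b : Tendsto (fun j => (z j).b) F (𝓝 w.b)
  ρ : Tendsto (fun j => (z j).ρ) F (𝓝 w.ρ)
  ρr : Tendsto (fun j => (z j).ρr) F (𝓝 w.ρr)
  ρrr : Tendsto (fun j => (z j).ρrr) F (𝓝 w.ρrr)
  ρrrr : Tendsto (fun j => (z j).ρrrr) F (𝓝 w.ρrrr)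
  C : Tendsto (fun j => (z j).C) F (𝓝 w.C)
  C' : Tendsto (fun j => (z j).C') F (𝓝 w.C')
  C'' : Tendsto (fun j => (z j).C'') F (𝓝 w.C'')

/-- Site data with fixed `v`, `D` from a tuple of the remaining quantities. -/
def ofTuple (v D : ℝ) (q : ℝ × ℝ × ℝ × ℝ × ℝ × ℝ × ℝ) : SiteData where
  v := v
  D := D
  b := 0
  Pe := 0
  ε := 0
  δ := 0
  ρ := q.1
  ρr := q.2.1
  ρrr := q.2.2.1
  ρrrr := q.2.2.2.1
  C := q.2.2.2.2.1
  C' := q.2.2.2.2.2.1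
  C'' := q.2.2.2.2.2.2

/-- The quantities of `ofTuple`. -/
def toTuple (z : SiteData) : ℝ × ℝ × ℝ × ℝ × ℝ × ℝ × ℝ :=
  (z.ρ, z.ρr, z.ρrr, z.ρrrr, z.C, z.C', z.C'')

variable {ι : Type} {z : ι → SiteData} {F : Filter ι} {w : SiteData}

theorem TendsTo.toTuple (hz : TendsTo z F w) :
    Tendsto (fun j => (z j).toTuple) F (𝓝 w.toTuple) :=
  hz.ρ.prodMk_nhds (hz.ρr.prodMk_nhds (hz.ρrr.prodMk_nhds (hz.ρrrr.prodMk_nhds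
    (hz.C.prodMk_nhds (hz.C'.prodMk_nhds hz.C'')))))

/-- The condition `hG` says that `G` reads only `v`, `D` and the seven quantities of the tuple;
convergence then follows from continuity in seven real variables. -/
theorem TendsTo.comp (hz : TendsTo z F w) {G : SiteData → ℝ}
    (hG : ∀ z : SiteData, G z = G (ofTuple z.v z.D z.toTuple))
    (hc : Continuous fun q => G (ofTuple w.v w.D q)) :
    Tendsto (fun j => G (z j)) F (𝓝 (G w)) := by
  rw [hG w]
  refine ((hc.tendsto _).comp hz.toTuple).congr fun j => ?_
  rw [hG (z j), hz.v, hz.D]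
  rfl

theorem TendsTo.formA (hz : TendsTo z F w) (σ κ : ℝ) :
    Tendsto (fun j => (z j).formA σ κ) F (𝓝 (w.formA σ κ)) :=
  hz.comp (G := fun z => z.formA σ κ) (fun _ => rfl) (by
    simp only [SiteData.formA, X10, X01, X, V, ofTuple]
    fun_prop)

theorem TendsTo.formB (hz : TendsTo z F w) (e : Fin 2) (σ κ : ℝ) :
    Tendsto (fun j => (z j).formB e σ κ) F (𝓝 (w.formB e σ κ)) := by
  refine hz.comp (G := fun z => z.formB e σ κ) (fun _ => ?_) ?_ <;> fin_cases e
  · rfl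
  · rfl
  all_goals
    simp only [SiteData.formB, X, V, ofTuple]
    fun_prop

theorem TendsTo.formE (hz : TendsTo z F w) (e : Fin 2) (σ κ : ℝ) :
    Tendsto (fun j => (z j).formE e σ κ) F (𝓝 (w.formE e σ κ)) := by
  refine hz.comp (G := fun z => z.formE e σ κ) (fun _ => ?_) ?_ <;> fin_cases e
  · rfl
  · rfl
  all_goals
    simp only [SiteData.formE, X, V, ofTuple]
    fun_prop

theorem TendsTo.formY1 (hz : TendsTo z F w) (e : Fin 2) (σ κ : ℝ) :
    Tendsto (fun j => (z j).formY1 e σ κ) F (𝓝 (w.formY1 e σ κ)) := by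
  refine hz.comp (G := fun z => z.formY1 e σ κ) (fun _ => ?_) ?_ <;> fin_cases e
  · rfl
  · rfl
  all_goals
    simp only [SiteData.formY1, Y, V, ofTuple]
    fun_prop

theorem TendsTo.formY2 (hz : TendsTo z F w) (e : Fin 2) (σ κ : ℝ) :
    Tendsto (fun j => (z j).formY2 e σ κ) F (𝓝 (w.formY2 e σ κ)) := by
  refine hz.comp (G := fun z => z.formY2 e σ κ) (fun _ => ?_) ?_ <;> fin_cases e
  · rfl
  · rfl
  all_goals
    simp only [SiteData.formY2, Y, V, ofTuple]
    fun_prop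

theorem TendsTo.T0 (hz : TendsTo z F w) (m : ℕ) (σ κ : ℝ) :
    Tendsto (fun j => (z j).T0 m σ κ) F (𝓝 (w.T0 m σ κ)) :=
  ((hz.formA σ κ).pow m).mul hz.C

theorem TendsTo.T1 (hz : TendsTo z F w) (m : ℕ) (e : Fin 2) (σ κ : ℝ) :
    Tendsto (fun j => (z j).T1 m e σ κ) F (𝓝 (w.T1 m e σ κ)) :=
  (((((hz.formA σ κ).pow (m - 1)).const_mul (m : ℝ)).mul ((hz.formB e σ κ).div_const 2)).mul
    hz.C).add (((hz.formA σ κ).pow m).mul (hz.C'.mul ((hz.formY1 e σ κ).div_const 2)))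

theorem TendsTo.T2 (hz : TendsTo z F w) (m : ℕ) (H : ℝ) (e : Fin 2) (σ κ : ℝ) :
    Tendsto (fun j => (z j).T2 m H e σ κ) F (𝓝 (w.T2 m H e σ κ)) := by
  have hA := hz.formA σ κ
  have hB := hz.formB e σ κ
  have hY := hz.formY1 e σ κ
  have h1 := (hA.pow (m - 1)).const_mul (m : ℝ)
  exact ((((h1.mul ((hz.formE e σ κ).div_const 4)).add (((hB.div_const 2).pow 2).mul
    ((hA.pow (m - 2)).const_mul (m * ((m : ℝ) - 1) / 2)))).mul hz.C).add
    ((h1.mul (hB.div_const 2)).mul (hz.C'.mul (hY.div_const 2)))).add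
    ((hA.pow m).mul (((hz.C'.mul ((hz.formY2 e σ κ).div_const 4)).add
      (((hY.div_const 2).pow 2).mul (hz.C''.div_const 2))).add
        (((hA.pow 2).div_const 4).mul_const H)))

end SiteData

/-- Taylor's formula for x ↦ x^m covers m = 0 and m = 1 uniformly. Continuity of the remainder in
both variables is what allows A and d to vary along the sequence. -/
theorem exists_pow_taylor (m : ℕ) : ∃ q : ℝ × ℝ → ℝ, Continuous q ∧
    (∀ A, q (A, 0) = m * ((m : ℝ) - 1) / 2 * A ^ (m - 2)) ∧
    ∀ A d : ℝ, (A + d) ^ m = A ^ m + m * A ^ (m - 1) * d + d ^ 2 * q (A, d) := by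
  obtain ⟨K, hK, hK0, hK1⟩ := exists_taylor_two (C := fun x : ℝ => x ^ m) (by fun_prop)
  refine ⟨K, hK, fun A => ?_, fun A d => ?_⟩
  · have hd : ∀ n : ℕ, deriv (fun x : ℝ => x ^ n) = fun x : ℝ => (n : ℝ) * x ^ (n - 1) := fun n =>
      funext fun x => by simp
    rw [hK0, iteratedDeriv_succ, iteratedDeriv_one, hd, deriv_const_mul_field, hd, Nat.sub_sub]
    rcases m with _ | m
    · simp
    · push_cast
      simp only [add_sub_cancel_right]
      ring
  · rw [hK1, iteratedDeriv_one, deriv_pow_field]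
    ring

/-- Profiles with a uniform Taylor expansion of third order at `0` on the scale `h`. -/
def HasProfile {ι : Type} (F : Filter ι) (h : ι → ℝ) (Q : ι → ℝ → ℝ) (z : ι → SiteData)
    (r : ℝ) : Prop :=
  ∀ c : ℝ, ∃ T : ι → ℝ, Tendsto T F (𝓝 r) ∧ ∀ᶠ j in F, Q j (c * h j) =
    (z j).ρ + c * h j * (z j).ρr + (c * h j) ^ 2 / 2 * (z j).ρrr + (c * h j) ^ 3 / 6 * T j

/-- `η(ω) / ν(ω)` as a function of the displacement and the grid Péclet number. -/
def gainFun (Pe σ : ℝ) : ℝ := (1 + σ * Pe / 2) / (1 - σ * Pe / 2)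

/-- With y = σVh/2 this is (1 + y)/(1 - y) = 1 + 2y + 2y² + 2y³/(1 - y). -/
theorem gainFun_expand {ι : Type} {F : Filter ι} {h : ι → ℝ} (hh : Tendsto h F (𝓝 0)) (V σ : ℝ) :
    ∃ T : ι → ℝ, Tendsto T F (𝓝 (σ ^ 3 * V ^ 3 / 4)) ∧ ∀ᶠ j in F, gainFun (V * h j) σ =
      1 + σ * V * h j + σ ^ 2 * V ^ 2 / 2 * h j ^ 2 + h j ^ 3 * T j := by
  have h1 : Tendsto (fun j => 1 - σ * (V * h j) / 2) F (𝓝 1) := by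
    have : Continuous fun x : ℝ => 1 - σ * (V * x) / 2 := by fun_prop
    simpa [Function.comp_def] using (this.tendsto 0).comp hh
  refine ⟨fun j => σ ^ 3 * V ^ 3 / 4 / (1 - σ * (V * h j) / 2), ?_, ?_⟩
  · have : Tendsto (fun j => σ ^ 3 * V ^ 3 / 4 / (1 - σ * (V * h j) / 2)) F
        (𝓝 (σ ^ 3 * V ^ 3 / 4 / 1)) := tendsto_const_nhds.div h1 one_ne_zero
    rwa [div_one] at this
  · filter_upwards [h1.eventually_ne one_ne_zero] with j hj
    have hi := mul_inv_cancel₀ hj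
    rw [gainFun, div_eq_iff hj, div_eq_mul_inv _ (1 - σ * (V * h j) / 2)]
    linear_combination (-(h j ^ 3 * (σ ^ 3 * V ^ 3 / 4))) * hi

/-- Density times gain, expanded to third order. -/
theorem gain_profile_expand {ι : Type} {F : Filter ι} {h : ι → ℝ} {Q : ι → ℝ → ℝ}
    {z : ι → SiteData} {w : SiteData} (hh : Tendsto h F (𝓝 0)) (hz : SiteData.TendsTo z F w)
    (hQ : HasProfile F h Q z w.ρrrr) (V σ c : ℝ) :
    ∃ T : ι → ℝ, Tendsto T F (𝓝 (σ ^ 3 * V ^ 3 / 4 * w.ρ + σ ^ 2 * V ^ 2 / 2 * (c * w.ρr)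
        + σ * V * (c ^ 2 / 2 * w.ρrr) + c ^ 3 / 6 * w.ρrrr)) ∧
      ∀ᶠ j in F, gainFun (V * h j) σ * Q j (c * h j) = (z j).ρ + h j * (σ * V * (z j).ρ + c * (z j).ρr)
        + h j ^ 2 * (σ ^ 2 * V ^ 2 / 2 * (z j).ρ + σ * V * (c * (z j).ρr) + c ^ 2 / 2 * (z j).ρrr)
        + h j ^ 3 * T j := by
  obtain ⟨G, hG, hG'⟩ := gainFun_expand hh V σ
  obtain ⟨T, hT, hT'⟩ := hQ c
  refine ⟨fun j => G j * ((z j).ρ + c * h j * (z j).ρr + (c * h j) ^ 2 / 2 * (z j).ρrr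
      + (c * h j) ^ 3 / 6 * T j) + σ ^ 2 * V ^ 2 / 2 * (c * (z j).ρr + h j * (c ^ 2 / 2 * (z j).ρrr)
      + h j ^ 2 * (c ^ 3 / 6 * T j)) + σ * V * (c ^ 2 / 2 * (z j).ρrr + h j * (c ^ 3 / 6 * T j))
      + c ^ 3 / 6 * T j, ?_, ?_⟩
  · have hc : Continuous fun q : ℝ × ℝ × ℝ × ℝ × ℝ × ℝ =>
        q.1 * (q.2.2.1 + c * q.2.1 * q.2.2.2.1 + (c * q.2.1) ^ 2 / 2 * q.2.2.2.2.1
        + (c * q.2.1) ^ 3 / 6 * q.2.2.2.2.2)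
        + σ ^ 2 * V ^ 2 / 2 * (c * q.2.2.2.1 + q.2.1 * (c ^ 2 / 2 * q.2.2.2.2.1)
          + q.2.1 ^ 2 * (c ^ 3 / 6 * q.2.2.2.2.2))
        + σ * V * (c ^ 2 / 2 * q.2.2.2.2.1 + q.2.1 * (c ^ 3 / 6 * q.2.2.2.2.2))
        + c ^ 3 / 6 * q.2.2.2.2.2 := by fun_prop
    have ht := (hc.tendsto _).comp (hG.prodMk_nhds (hh.prodMk_nhds (hz.ρ.prodMk_nhds
      (hz.ρr.prodMk_nhds (hz.ρrr.prodMk_nhds hT)))))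
    simpa [Function.comp_def] using ht
  · filter_upwards [hG', hT'] with j h1 h2
    rw [h1, h2]
    ring

/-- The half difference and the mean of the densities on a pair of branches. -/
theorem pair_expand {ι : Type} {F : Filter ι} {h : ι → ℝ} {Q : ι → ℝ → ℝ}
    {z : ι → SiteData} {w : SiteData} (hh : Tendsto h F (𝓝 0)) (hz : SiteData.TendsTo z F w)
    (hQ : HasProfile F h Q z w.ρrrr) (e : Fin 2) (σ κ : ℝ) :
    ∃ E y : ι → ℝ, Tendsto E F (𝓝 (w.formE e σ κ / 4)) ∧ Tendsto y F (𝓝 (w.formY2 e σ κ / 4)) ∧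
      ∀ᶠ j in F,
        gainFun (w.V * h j) σ * Q j (-((e : ℕ) * σ) * h j) = (z j).ρ
            + h j * ((z j).formY1 e σ κ / 2 + h j * y j)
            + h j / 2 * ((z j).formA σ κ + h j * ((z j).formB e σ κ / 2 + h j * E j)) ∧
        gainFun (w.V * h j) κ * Q j (-((e : ℕ) * σ + κ) * h j) = (z j).ρ
            + h j * ((z j).formY1 e σ κ / 2 + h j * y j)
            - h j / 2 * ((z j).formA σ κ + h j * ((z j).formB e σ κ / 2 + h j * E j)) := by
  obtain ⟨P, hP, hP'⟩ := gain_profile_expand hh hz hQ w.V σ (-((e : ℕ) * σ))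
  obtain ⟨R, hR, hR'⟩ := gain_profile_expand hh hz hQ w.V κ (-((e : ℕ) * σ + κ))
  have hV : ∀ j, (z j).V = w.V := fun j => by rw [SiteData.V, SiteData.V, hz.v, hz.D]
  refine ⟨fun j => P j - R j, fun j => (z j).formY2 e σ κ / 4 + h j * ((P j + R j) / 2),
    ?_, ?_, ?_⟩
  · convert! hP.sub hR using 2
    fin_cases e <;> simp [SiteData.formE, SiteData.X] <;> ring
  · have := (hz.formY2 e σ κ).div_const 4 |>.add (hh.mul ((hP.add hR).div_const 2))
    simpa using this
  · filter_upwards [hP', hR'] with j h1 h2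
    rw [h1, h2]
    constructor <;> fin_cases e <;>
      simp [SiteData.formA, SiteData.formB, SiteData.formY1, SiteData.formY2, SiteData.X10,
        SiteData.X01, SiteData.X, SiteData.Y, hV] <;> ring

/-- The index `e` is 0 for the outflow pair and 1 for the inflow pair with exchanged arguments. The
half difference is h/2 times a convergent quantity, which produces the factor (h/2)^m; the mean
deviates from ρ by O(h), so two orders of C and of the power suffice. -/
theorem branch_expand {ι : Type} {F : Filter ι} {h : ι → ℝ} {Q : ι → ℝ → ℝ}
    {z : ι → SiteData} {w : SiteData} (hh : Tendsto h F (𝓝 0)) (hz : SiteData.TendsTo z F w)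
    (hQ : HasProfile F h Q z w.ρrrr) {f : ℝ → ℝ → ℝ} {m : ℕ} {C : ℝ → ℝ} {K H : ℝ × ℝ → ℝ}
    (hK : Continuous K) (hH : Continuous H) (hK0 : K (w.ρ, 0) = w.C'' / 2)
    (hC : ∀ j, (z j).C = C (z j).ρ) (hC' : ∀ j, (z j).C' = iteratedDeriv 1 C (z j).ρ)
    (hf : ∀ᶠ q : ℝ × ℝ × ℝ in 𝓝 (w.ρ, 0, 0),
        f (q.1 + q.2.1 + q.2.2) (q.1 + q.2.1 - q.2.2) = q.2.2 ^ m *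
          (C q.1 + q.2.1 * iteratedDeriv 1 C q.1 + q.2.1 ^ 2 * K (q.1, q.2.1)
            + q.2.2 ^ 2 * H (q.1 + q.2.1, q.2.2))) (e : Fin 2) (σ κ : ℝ) :
    ∃ R : ι → ℝ, Tendsto R F (𝓝 (w.T2 m (H (w.ρ, 0)) e σ κ)) ∧ ∀ᶠ j in F,
      f (gainFun (w.V * h j) σ * Q j (-((e : ℕ) * σ) * h j))
          (gainFun (w.V * h j) κ * Q j (-((e : ℕ) * σ + κ) * h j))
        = (h j / 2) ^ m * ((z j).T0 m σ κ + h j * (z j).T1 m e σ κ + h j ^ 2 * R j) := by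
  obtain ⟨E, y, hE, hy, hpair⟩ := pair_expand hh hz hQ e σ κ
  obtain ⟨q, hq, hq0, hq1⟩ := exists_pow_taylor m
  have hA := hz.formA σ κ
  have hB := (hz.formB e σ κ).div_const 2
  have hY := (hz.formY1 e σ κ).div_const 2
  -- the second-order parts of the increments
  have hBE : Tendsto (fun j => (z j).formB e σ κ / 2 + h j * E j) F (𝓝 (w.formB e σ κ / 2)) := by
    simpa using hB.add (hh.mul hE)
  have hAB : Tendsto (fun j => (z j).formA σ κ + h j * ((z j).formB e σ κ / 2 + h j * E j)) F
      (𝓝 (w.formA σ κ)) := by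
    simpa using hA.add (hh.mul hBE)
  have hYy : Tendsto (fun j => (z j).formY1 e σ κ / 2 + h j * y j) F
      (𝓝 (w.formY1 e σ κ / 2)) := by
    simpa using hY.add (hh.mul hy)
  have hc : Tendsto (fun j => h j * ((z j).formY1 e σ κ / 2 + h j * y j)) F (𝓝 0) := by
    simpa using hh.mul hYy
  have hd : Tendsto (fun j => h j / 2 * ((z j).formA σ κ + h j * ((z j).formB e σ κ / 2
      + h j * E j))) F (𝓝 0) := by
    simpa using (hh.div_const 2).mul hAB
  have hKl : Tendsto (fun j => K ((z j).ρ, h j * ((z j).formY1 e σ κ / 2 + h j * y j))) F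
      (𝓝 (w.C'' / 2)) := by
    rw [← hK0]
    exact (hK.tendsto _).comp (hz.ρ.prodMk_nhds hc)
  have hHl : Tendsto (fun j => H ((z j).ρ + h j * ((z j).formY1 e σ κ / 2 + h j * y j),
      h j / 2 * ((z j).formA σ κ + h j * ((z j).formB e σ κ / 2 + h j * E j)))) F
      (𝓝 (H (w.ρ, 0))) := by
    have h1 : Tendsto (fun j => (z j).ρ + h j * ((z j).formY1 e σ κ / 2 + h j * y j)) F
        (𝓝 w.ρ) := by
      simpa using hz.ρ.add hc
    exact (hH.tendsto _).comp (h1.prodMk_nhds hd)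
  have hql : Tendsto (fun j => q ((z j).formA σ κ, h j * ((z j).formB e σ κ / 2 + h j * E j))) F
      (𝓝 (m * ((m : ℝ) - 1) / 2 * w.formA σ κ ^ (m - 2))) := by
    rw [← hq0]
    refine (hq.tendsto _).comp (hA.prodMk_nhds ?_)
    simpa using hh.mul hBE
  have hm1 := (hA.pow (m - 1)).const_mul (m : ℝ)
  -- The second-order remainder of the power A^m; `hG` below treats that of the factor C + cC' + ….
  -- The full remainder collects all products of these of order at least two.
  have hW : Tendsto (fun j => m * (z j).formA σ κ ^ (m - 1) * E j
      + ((z j).formB e σ κ / 2 + h j * E j) ^ 2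
        * q ((z j).formA σ κ, h j * ((z j).formB e σ κ / 2 + h j * E j))) F
      (𝓝 (m * w.formA σ κ ^ (m - 1) * (w.formE e σ κ / 4) + (w.formB e σ κ / 2) ^ 2
        * (m * ((m : ℝ) - 1) / 2 * w.formA σ κ ^ (m - 2)))) :=
    (hm1.mul hE).add ((hBE.pow 2).mul hql)
  have hG : Tendsto (fun j => (z j).C' * y j
      + ((z j).formY1 e σ κ / 2 + h j * y j) ^ 2
        * K ((z j).ρ, h j * ((z j).formY1 e σ κ / 2 + h j * y j))
      + ((z j).formA σ κ + h j * ((z j).formB e σ κ / 2 + h j * E j)) ^ 2 / 4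
        * H ((z j).ρ + h j * ((z j).formY1 e σ κ / 2 + h j * y j),
          h j / 2 * ((z j).formA σ κ + h j * ((z j).formB e σ κ / 2 + h j * E j)))) F
      (𝓝 (w.C' * (w.formY2 e σ κ / 4) + (w.formY1 e σ κ / 2) ^ 2 * (w.C'' / 2)
        + w.formA σ κ ^ 2 / 4 * H (w.ρ, 0))) :=
    ((hz.C'.mul hy).add ((hYy.pow 2).mul hKl)).add (((hAB.pow 2).div_const 4).mul hHl)
  set W := fun j => m * (z j).formA σ κ ^ (m - 1) * E j
      + ((z j).formB e σ κ / 2 + h j * E j) ^ 2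
        * q ((z j).formA σ κ, h j * ((z j).formB e σ κ / 2 + h j * E j)) with hWdef
  set G := fun j => (z j).C' * y j
      + ((z j).formY1 e σ κ / 2 + h j * y j) ^ 2
        * K ((z j).ρ, h j * ((z j).formY1 e σ κ / 2 + h j * y j))
      + ((z j).formA σ κ + h j * ((z j).formB e σ κ / 2 + h j * E j)) ^ 2 / 4
        * H ((z j).ρ + h j * ((z j).formY1 e σ κ / 2 + h j * y j),
          h j / 2 * ((z j).formA σ κ + h j * ((z j).formB e σ κ / 2 + h j * E j))) with hGdef
  refine ⟨fun j => W j * (z j).C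
      + m * (z j).formA σ κ ^ (m - 1) * ((z j).formB e σ κ / 2)
        * ((z j).C' * ((z j).formY1 e σ κ / 2))
      + (z j).formA σ κ ^ m * G j
      + h j * (W j * ((z j).C' * ((z j).formY1 e σ κ / 2))
        + m * (z j).formA σ κ ^ (m - 1) * ((z j).formB e σ κ / 2) * G j + h j * (W j * G j)), ?_, ?_⟩
  · have hCY := hz.C'.mul hY
    have := (((hW.mul hz.C).add ((hm1.mul hB).mul hCY)).add ((hA.pow m).mul hG)).add
      (hh.mul (((hW.mul hCY).add ((hm1.mul hB).mul hG)).add (hh.mul (hW.mul hG))))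
    simpa [SiteData.T2] using this
  · have hev := (hz.ρ.prodMk_nhds (hc.prodMk_nhds hd)).eventually hf
    filter_upwards [hpair, hev] with j h1 h2
    rw [h1.1, h1.2, h2, mul_pow, hq1, SiteData.T0, SiteData.T1, hC, hC']
    simp only [hWdef, hGdef, hC']
    ring

end Multibaker

namespace Multibaker

/-! ### The sum over pairs of branches -/

/-- The contribution of the pair of branches with displacements `σ`, `κ`. -/
def pairTerm (f : ℝ → ℝ → ℝ) (ε Pe dr : ℝ) (Q : ℝ → ℝ) (σ κ : ℝ) : ℝ :=
  f (gainFun Pe σ * Q 0) (gainFun Pe κ * Q (-κ * dr))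
    + ε * f (gainFun Pe κ * Q (-(σ + κ) * dr)) (gainFun Pe σ * Q (-σ * dr))

/-- The weighted sum over the pairs of displacements other than `(0, 0)`. -/
def octet (b : ℝ) (g : ℝ → ℝ → ℝ) : ℝ :=
  (1 - b) * (g 1 0 + g (-1) 0 + g 0 1 + g 0 (-1))
    + b / 2 * (g 1 1 + g 1 (-1) + g (-1) 1 + g (-1) (-1))

/-- The weights are invariant under reversing both displacements, so odd summands cancel in pairs.
This cancellation makes whole orders of the expansion disappear. -/
theorem octet_odd (b : ℝ) {g : ℝ → ℝ → ℝ} (hg : ∀ σ κ, g (-σ) (-κ) = -g σ κ) :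
    octet b g = 0 := by
  have h1 := hg 1 0
  have h2 := hg 0 1
  have h3 := hg 1 1
  have h4 := hg 1 (-1)
  simp only [neg_neg, neg_zero] at h1 h2 h3 h4
  rw [octet, h1, h2, h3, h4]
  ring

theorem octet_even (b : ℝ) {g : ℝ → ℝ → ℝ} (hg : ∀ σ κ, g (-σ) (-κ) = g σ κ) :
    octet b g = 2 * ((1 - b) * (g 1 0 + g 0 1) + b / 2 * (g 1 1 + g 1 (-1))) := by
  have h1 := hg 1 0
  have h2 := hg 0 1
  have h3 := hg 1 1
  have h4 := hg 1 (-1)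
  simp only [neg_neg, neg_zero] at h1 h2 h3 h4
  rw [octet, h1, h2, h3, h4]
  ring

theorem octet_mul (b c : ℝ) (g : ℝ → ℝ → ℝ) :
    octet b (fun σ κ => c * g σ κ) = c * octet b g := by
  simp only [octet]
  ring

theorem tendsto_octet {ι : Type} {F : Filter ι} {b : ι → ℝ} {b₀ : ℝ} {g : ι → ℝ → ℝ → ℝ}
    {g₀ : ℝ → ℝ → ℝ} (hb : Tendsto b F (𝓝 b₀))
    (hg : ∀ σ κ, Tendsto (fun j => g j σ κ) F (𝓝 (g₀ σ κ))) :
    Tendsto (fun j => octet (b j) (g j)) F (𝓝 (octet b₀ g₀)) :=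
  ((hb.const_sub 1).mul ((((hg 1 0).add (hg (-1) 0)).add (hg 0 1)).add (hg 0 (-1)))).add
    ((hb.div_const 2).mul ((((hg 1 1).add (hg 1 (-1))).add (hg (-1) 1)).add (hg (-1) (-1))))

/-- The leading order of a sum over pairs of branches, if the lower orders vanish. -/
theorem tendsto_octet_weighted {ι : Type} {F : Filter ι} {b h : ι → ℝ} {b₀ : ℝ} (V : ℝ)
    (hb : Tendsto b F (𝓝 b₀)) (hh : Tendsto h F (𝓝 0)) (hpos : ∀ j, 0 < h j) (μ : ℝ → ℝ)
    {g₀ g₁ R : ι → ℝ → ℝ → ℝ} {l₀ l₁ l₂ : ℝ → ℝ → ℝ}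
    (h₀ : ∀ σ κ, Tendsto (fun j => g₀ j σ κ) F (𝓝 (l₀ σ κ)))
    (h₁ : ∀ σ κ, Tendsto (fun j => g₁ j σ κ) F (𝓝 (l₁ σ κ)))
    (h₂ : ∀ σ κ, Tendsto (fun j => R j σ κ) F (𝓝 (l₂ σ κ))) :
    Tendsto (fun j => octet (b j) fun σ κ => μ σ * (1 - κ * (V * h j) / 2)
        * (g₀ j σ κ + h j * g₁ j σ κ + h j ^ 2 * R j σ κ)) F
      (𝓝 (octet b₀ fun σ κ => μ σ * l₀ σ κ)) ∧
    ((∀ j, octet (b j) (fun σ κ => μ σ * g₀ j σ κ) = 0) →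
      Tendsto (fun j => (octet (b j) fun σ κ => μ σ * (1 - κ * (V * h j) / 2)
          * (g₀ j σ κ + h j * g₁ j σ κ + h j ^ 2 * R j σ κ)) / h j) F
        (𝓝 (octet b₀ fun σ κ => μ σ * (l₁ σ κ - κ * V / 2 * l₀ σ κ)))) ∧
    ((∀ j σ κ, g₀ j σ κ = 0) → (∀ j, octet (b j) (fun σ κ => μ σ * g₁ j σ κ) = 0) →
      Tendsto (fun j => (octet (b j) fun σ κ => μ σ * (1 - κ * (V * h j) / 2)
          * (g₀ j σ κ + h j * g₁ j σ κ + h j ^ 2 * R j σ κ)) / h j ^ 2) F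
        (𝓝 (octet b₀ fun σ κ => μ σ * (l₂ σ κ - κ * V / 2 * l₁ σ κ)))) := by
  have hw : ∀ κ : ℝ, Tendsto (fun j => 1 - κ * (V * h j) / 2) F (𝓝 1) := by
    intro κ
    have hc : Continuous fun x : ℝ => 1 - κ * (V * x) / 2 := by fun_prop
    simpa [Function.comp_def] using (hc.tendsto 0).comp hh
  refine ⟨tendsto_octet hb fun σ κ => ?_, fun hodd => ?_, fun hzero hodd => ?_⟩
  · have := ((hw κ).const_mul (μ σ)).mul
      (((h₀ σ κ).add (hh.mul (h₁ σ κ))).add ((hh.pow 2).mul (h₂ σ κ)))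
    simpa using this
  · have key : ∀ j, (octet (b j) fun σ κ => μ σ * (1 - κ * (V * h j) / 2)
          * (g₀ j σ κ + h j * g₁ j σ κ + h j ^ 2 * R j σ κ)) / h j
        = octet (b j) fun σ κ => μ σ * (g₁ j σ κ - κ * V / 2 * g₀ j σ κ
          + h j * (R j σ κ - κ * V / 2 * (g₁ j σ κ + h j * R j σ κ))) := by
      intro j
      have e := hodd j
      rw [div_eq_iff (hpos j).ne']
      simp only [octet] at e ⊢
      linear_combination e
    simp only [key]
    refine tendsto_octet hb fun σ κ => ?_
    have := (((h₁ σ κ).sub ((h₀ σ κ).const_mul (κ * V / 2))).add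
      (hh.mul ((h₂ σ κ).sub (((h₁ σ κ).add (hh.mul (h₂ σ κ))).const_mul (κ * V / 2))))).const_mul
        (μ σ)
    simpa using this
  · have key : ∀ j, (octet (b j) fun σ κ => μ σ * (1 - κ * (V * h j) / 2)
          * (g₀ j σ κ + h j * g₁ j σ κ + h j ^ 2 * R j σ κ)) / h j ^ 2
        = octet (b j) fun σ κ => μ σ * (R j σ κ - κ * V / 2 * g₁ j σ κ
          + h j * (-(κ * V / 2) * R j σ κ)) := by
      intro j
      have e := hodd j
      rw [div_eq_iff (pow_pos (hpos j) 2).ne']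
      simp only [hzero]
      simp only [octet] at e ⊢
      linear_combination h j * e
    simp only [key]
    refine tendsto_octet hb fun σ κ => ?_
    have := (((h₂ σ κ).sub ((h₁ σ κ).const_mul (κ * V / 2))).add
      (hh.mul ((h₂ σ κ).const_mul (-(κ * V / 2))))).const_mul (μ σ)
    simpa using this

namespace UOFPChain

variable {D v : ℝ} {k : ℕ}

theorem beta_pos (S : UOFPChain D v k) : 0 < S.beta := by
  have h0 := S.bulkEta_pos 0
  have h2 := S.bulkEta_pos 2
  simp [bulkEta] at h0 h2
  change 0 < betaOf D S.dr S.tau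
  linarith

theorem beta_lt_one (S : UOFPChain D v k) : S.beta < 1 := by
  have h1 := S.bulkEta_pos 1
  simp [bulkEta] at h1
  exact h1

theorem gain_eq (S : UOFPChain D v k) (s : Fin 3) :
    S.gain s = gainFun S.peclet (disp s) := by
  have hβ := S.beta_pos
  have h0 := S.ηb_pos 0
  have h1 := S.ηb_pos 1
  have h2 := S.ηb_pos 2
  have e0 : S.ηb 0 = S.beta / 2 * (1 - S.peclet / 2) := rfl
  have e1 : S.ηb 1 = 1 - S.beta := rfl
  have e2 : S.ηb 2 = S.beta / 2 * (1 + S.peclet / 2) := rfl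
  have hp : 0 < 1 + S.peclet / 2 := by
    rw [e2] at h2
    exact pos_of_mul_pos_right h2 (by linarith)
  have hm : 0 < 1 - S.peclet / 2 := by
    rw [e0] at h0
    exact pos_of_mul_pos_right h0 (by linarith)
  unfold gain νb gainFun disp
  fin_cases s
  · change S.ηb 0 / S.ηb 2 = _
    rw [e0, e2, mul_div_mul_left _ _ (by linarith)]
    norm_num
    ring_nf
  · change S.ηb 1 / S.ηb 1 = _
    rw [div_self h1.ne']
    norm_num
  · change S.ηb 2 / S.ηb 0 = _
    rw [e0, e2, mul_div_mul_left _ _ (by linarith)]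
    norm_num

/-- For σ = ±1 one has η + δν = β((1 + δ) + σ(1 - δ)Pe/2)/2 and ν = β(1 - σPe/2)/2, while both η and
ν are 1 - β for σ = 0. Every pair except (0, 0) therefore has a factor β, which is taken out to
compensate 1/τ. -/
theorem branchSum_eq (S : UOFPChain D v k) (f : ℝ → ℝ → ℝ) (ε δ : ℝ) (Q : ℝ → ℝ) :
    S.branchSum f ε δ Q = (1 + δ) * (1 - S.beta) ^ 2 * pairTerm f ε S.peclet S.dr Q 0 0
      + S.beta * octet S.beta fun σ κ => ((1 + δ) + σ * (1 - δ) * S.peclet / 2) / 2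
        * (1 - κ * S.peclet / 2) * pairTerm f ε S.peclet S.dr Q σ κ := by
  have e0 : S.ηb 0 = S.beta / 2 * (1 - S.peclet / 2) := rfl
  have e1 : S.ηb 1 = 1 - S.beta := rfl
  have e2 : S.ηb 2 = S.beta / 2 * (1 + S.peclet / 2) := rfl
  have n0 : S.νb 0 = S.beta / 2 * (1 + S.peclet / 2) := rfl
  have n1 : S.νb 1 = 1 - S.beta := rfl
  have n2 : S.νb 2 = S.beta / 2 * (1 - S.peclet / 2) := rfl
  have d0 : disp 0 = -1 := by simp [disp]
  have d1 : disp 1 = 0 := by simp [disp]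
  have d2 : disp 2 = 1 := by simp [disp]; norm_num
  have hb : S.branchSum f ε δ Q = ∑ s, ∑ t, (S.ηb s + δ * S.νb s) * S.νb t *
      pairTerm f ε S.peclet S.dr Q (disp s) (disp t) := by
    simp only [branchSum, S.gain_eq, pairTerm]
  rw [hb]
  simp only [Fin.sum_univ_three, e0, e1, e2, n0, n1, n2, d0, d1, d2, octet]
  generalize pairTerm f ε S.peclet S.dr Q = p
  ring

end UOFPChain
end Multibaker

/-! ### Parity and the leading order of a branch sum -/

namespace Multibaker

theorem SiteData.T0_neg (z : SiteData) (m : ℕ) (σ κ : ℝ) :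
    z.T0 m (-σ) (-κ) = (-1) ^ m * z.T0 m σ κ := by
  have hA : z.formA (-σ) (-κ) = -z.formA σ κ := by
    simp only [formA]
    ring
  rw [T0, T0, hA, neg_pow]
  ring

/-- The forms `formA` and `formY1` are odd and `formB` is even, so each further order in Δr flips
the parity. For m = 0 the term with the truncated exponent carries the factor m = 0. -/
theorem SiteData.T1_neg (z : SiteData) (m : ℕ) (e : Fin 2) (σ κ : ℝ) :
    z.T1 m e (-σ) (-κ) = -(-1) ^ m * z.T1 m e σ κ := by
  have hA : z.formA (-σ) (-κ) = -z.formA σ κ := by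
    simp only [formA]
    ring
  have hB : z.formB e (-σ) (-κ) = z.formB e σ κ := by
    simp only [formB]
    ring
  have hY : z.formY1 e (-σ) (-κ) = -z.formY1 e σ κ := by
    simp only [formY1]
    ring
  rw [T1, T1, hA, hB, hY, neg_pow _ m, neg_pow _ (m - 1)]
  rcases m with _ | m
  · simp only [Nat.cast_zero, pow_zero]
    ring
  · rw [Nat.add_sub_cancel, pow_succ (-1 : ℝ)]
    ring

/-- A sequence of chains with density profiles around one site of each chain. -/
structure IsLocalLimit {D v : ℝ} {k : ℕ} {ι : Type} (F : Filter ι) (S : ι → UOFPChain D v k)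
    (Q : ι → ℝ → ℝ) (z : ι → SiteData) (w : SiteData) (J : Set ℝ) (f : ℝ → ℝ → ℝ) (m : ℕ)
    (C : ℝ → ℝ) : Prop where
  D_pos : 0 < D
  v_eq : w.v = v
  D_eq : w.D = D
  dr : Tendsto (fun j => (S j).dr) F (𝓝 0)
  b_eq : ∀ j, (z j).b = (S j).beta
  data : SiteData.TendsTo z F w
  profile : HasProfile F (fun j => (S j).dr) Q z w.ρrrr
  isOpen : IsOpen J
  mem : w.ρ ∈ J
  t1 : IsT1Function J f m C
  C_eq : ∀ j, (z j).C = C (z j).ρ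
  C'_eq : ∀ j, (z j).C' = iteratedDeriv 1 C (z j).ρ
  C''_eq : w.C'' = iteratedDeriv 2 C w.ρ

namespace IsLocalLimit

variable {D v : ℝ} {k : ℕ} {ι : Type} {F : Filter ι} {S : ι → UOFPChain D v k}
  {Q : ι → ℝ → ℝ} {z : ι → SiteData} {w : SiteData} {J : Set ℝ} {f : ℝ → ℝ → ℝ} {m : ℕ}
  {C : ℝ → ℝ}

theorem peclet_eq (hS : IsLocalLimit F S Q z w J f m C) (j : ι) :
    (S j).peclet = w.V * (S j).dr := by
  rw [SiteData.V, hS.v_eq, hS.D_eq, UOFPChain.peclet, pecletOf]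
  ring

theorem tendsto_gain_mul (hS : IsLocalLimit F S Q z w J f m C) (σ c : ℝ) :
    Tendsto (fun j => gainFun (w.V * (S j).dr) σ * Q j (c * (S j).dr)) F (𝓝 w.ρ) := by
  obtain ⟨T, hT, hT'⟩ := gain_profile_expand hS.dr hS.data hS.profile w.V σ c
  refine Tendsto.congr' (hT'.mono fun j hj => hj.symm) ?_
  have h1 := (hS.data.ρ.const_mul (σ * w.V)).add (hS.data.ρr.const_mul c)
  have h2 := ((hS.data.ρ.const_mul (σ ^ 2 * w.V ^ 2 / 2)).add
    ((hS.data.ρr.const_mul c).const_mul (σ * w.V))).add (hS.data.ρrr.const_mul (c ^ 2 / 2))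
  simpa using ((hS.data.ρ.add (hS.dr.mul h1)).add ((hS.dr.pow 2).mul h2)).add
    ((hS.dr.pow 3).mul hT)

/-- Expansion of the contributions of all pairs of branches. -/
theorem pairTerm_expand (hS : IsLocalLimit F S Q z w J f m C) (ε : ℝ) :
    ∃ (H : ℝ) (R : ι → ℝ → ℝ → ℝ),
      (∀ σ κ, Tendsto (fun j => R j σ κ) F
        (𝓝 (w.T2 m H 0 σ κ + ε * (-1) ^ m * w.T2 m H 1 σ κ))) ∧
      ∀ σ κ, ∀ᶠ j in F, pairTerm f ε (S j).peclet (S j).dr (Q j) σ κ = ((S j).dr / 2) ^ m *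
        ((1 + ε * (-1) ^ m) * (z j).T0 m σ κ
          + (S j).dr * ((z j).T1 m 0 σ κ + ε * (-1) ^ m * (z j).T1 m 1 σ κ)
          + (S j).dr ^ 2 * R j σ κ) := by
  obtain ⟨-, K, H, hK, hH, hK0, hf⟩ := hS.t1.exists_expansion hS.isOpen hS.mem
  have hK0' : K (w.ρ, 0) = w.C'' / 2 := by rw [hK0.self_of_nhds, hS.C''_eq]
  have hb := branch_expand hS.dr hS.data hS.profile hK hH hK0' hS.C_eq hS.C'_eq hf
  choose R hR hR' using hb
  refine ⟨H (w.ρ, 0), fun j σ κ => R 0 σ κ j + ε * (-1) ^ m * R 1 σ κ j,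
    fun σ κ => (hR 0 σ κ).add ((hR 1 σ κ).const_mul _), fun σ κ => ?_⟩
  -- Exchanging the arguments of the inflow term costs (-1)^m, and is legitimate once both densities
  -- lie in J.
  have hJ := hS.isOpen.mem_nhds hS.mem
  filter_upwards [hR' 0 σ κ, hR' 1 σ κ,
    (hS.tendsto_gain_mul σ (-σ)).eventually hJ,
    (hS.tendsto_gain_mul κ (-(σ + κ))).eventually hJ] with j h0 h1 m1 m2
  simp only [Fin.val_zero, Fin.val_one, Nat.cast_zero, Nat.cast_one, zero_mul, one_mul, neg_zero,
    zero_add] at h0 h1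
  rw [pairTerm, hS.peclet_eq, h0, hS.t1.swap hS.isOpen m1 m2, h1]
  ring

/-- No factor β compensates 1/τ here, so the term has to vanish exactly. It does for three different
reasons: the weight 1 + δ is zero, or f vanishes on the diagonal, or outflow and inflow cancel. -/
theorem pairTerm_zero (hS : IsLocalLimit F S Q z w J f m C) {ε δ : ℝ}
    (hcase : δ = -1 ∨ m ≠ 0 ∨ ε = -1) :
    ∀ᶠ j in F, (1 + δ) * (1 - (S j).beta) ^ 2 * pairTerm f ε (S j).peclet (S j).dr (Q j) 0 0
      = 0 := by
  rcases hcase with rfl | hm | rfl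
  · exact Eventually.of_forall fun j => by ring
  · obtain ⟨-, K, H, -, -, -, hf⟩ := hS.t1.exists_expansion hS.isOpen hS.mem
    have h1 : Tendsto (fun j => (gainFun (w.V * (S j).dr) 0 * Q j (0 * (S j).dr), (0 : ℝ), (0 : ℝ)))
        F (𝓝 (w.ρ, 0, 0)) := (hS.tendsto_gain_mul 0 0).prodMk_nhds tendsto_const_nhds
    filter_upwards [h1.eventually hf] with j hj
    simp only [zero_mul, add_zero, sub_zero, zero_pow hm] at hj
    simp [pairTerm, hS.peclet_eq, hj]
  · exact Eventually.of_forall fun j => by simp [pairTerm]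

/-- The identity β/τ = 2D/Δr² removes τ from the prefactor. The power of Δr is left as a quotient
since m may be less than 2. -/
theorem branchSum_expand (hS : IsLocalLimit F S Q z w J f m C) {ε δ : ℝ}
    (hcase : δ = -1 ∨ m ≠ 0 ∨ ε = -1) :
    ∃ (H : ℝ) (R : ι → ℝ → ℝ → ℝ),
      (∀ σ κ, Tendsto (fun j => R j σ κ) F
        (𝓝 (w.T2 m H 0 σ κ + ε * (-1) ^ m * w.T2 m H 1 σ κ))) ∧
      ∀ᶠ j in F, (S j).branchSum f ε δ (Q j) / (S j).tau = 2 * D / 2 ^ m * ((S j).dr ^ m / (S j).dr ^ 2 *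
        octet (S j).beta fun σ κ => ((1 + δ) + σ * (1 - δ) * (w.V * (S j).dr) / 2) / 2
          * (1 - κ * (w.V * (S j).dr) / 2) * ((1 + ε * (-1) ^ m) * (z j).T0 m σ κ
          + (S j).dr * ((z j).T1 m 0 σ κ + ε * (-1) ^ m * (z j).T1 m 1 σ κ)
          + (S j).dr ^ 2 * R j σ κ)) := by
  obtain ⟨H, R, hR, hR'⟩ := hS.pairTerm_expand ε
  refine ⟨H, R, hR, ?_⟩
  filter_upwards [hS.pairTerm_zero hcase, hR' 1 0, hR' (-1) 0, hR' 0 1, hR' 0 (-1), hR' 1 1,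
    hR' 1 (-1), hR' (-1) 1, hR' (-1) (-1)] with j h0 h1 h2 h3 h4 h5 h6 h7 h8
  have hd := (S j).dr_pos
  have ht := (S j).tau_pos
  have hβ : (S j).beta = 2 * (S j).tau * D / (S j).dr ^ 2 := rfl
  obtain ⟨g, hg⟩ : ∃ g : ℝ → ℝ → ℝ, g = fun σ κ => (1 + ε * (-1) ^ m) * (z j).T0 m σ κ
      + (S j).dr * ((z j).T1 m 0 σ κ + ε * (-1) ^ m * (z j).T1 m 1 σ κ)
      + (S j).dr ^ 2 * R j σ κ := ⟨_, rfl⟩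
  have hg' : ∀ σ κ, (1 + ε * (-1) ^ m) * (z j).T0 m σ κ
      + (S j).dr * ((z j).T1 m 0 σ κ + ε * (-1) ^ m * (z j).T1 m 1 σ κ)
      + (S j).dr ^ 2 * R j σ κ = g σ κ := fun σ κ => by rw [hg]
  simp only [hg'] at h1 h2 h3 h4 h5 h6 h7 h8 ⊢
  have hoct : (octet (S j).beta fun σ κ => ((1 + δ) + σ * (1 - δ) * (S j).peclet / 2) / 2
        * (1 - κ * (S j).peclet / 2) * pairTerm f ε (S j).peclet (S j).dr (Q j) σ κ)
      = ((S j).dr / 2) ^ m * octet (S j).beta fun σ κ =>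
        ((1 + δ) + σ * (1 - δ) * (w.V * (S j).dr) / 2) / 2 * (1 - κ * (w.V * (S j).dr) / 2)
          * g σ κ := by
    simp only [octet]
    rw [h1, h2, h3, h4, h5, h6, h7, h8, hS.peclet_eq]
    ring
  rw [UOFPChain.branchSum_eq, h0, zero_add, hoct, hβ, div_pow]
  generalize octet (2 * (S j).tau * D / (S j).dr ^ 2) _ = o
  field_simp

/-- The even part of the transition weights: leading terms of the sum over pairs of branches. -/
theorem tendsto_branchSum_plus (hS : IsLocalLimit F S Q z w J f m C) (ε : ℝ)
    (hcase : m ≠ 0 ∨ ε = -1) :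
    ∃ H : ℝ,
    (2 ≤ m → Tendsto (fun j => (S j).branchSum f ε 1 (Q j) / (S j).tau / (S j).dr ^ (m - 2)) F
      (𝓝 (2 * D / 2 ^ m * octet w.b fun σ κ => (1 + ε * (-1) ^ m) * w.T0 m σ κ))) ∧
    (Odd m → Tendsto (fun j => (S j).branchSum f ε 1 (Q j) / (S j).tau / (S j).dr ^ (m - 1)) F
      (𝓝 (2 * D / 2 ^ m * octet w.b fun σ κ => (w.T1 m 0 σ κ + ε * (-1) ^ m * w.T1 m 1 σ κ)
        - κ * w.V / 2 * ((1 + ε * (-1) ^ m) * w.T0 m σ κ)))) ∧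
    (Even m → ε = -1 → Tendsto (fun j => (S j).branchSum f ε 1 (Q j) / (S j).tau / (S j).dr ^ m) F
      (𝓝 (2 * D / 2 ^ m * octet w.b fun σ κ =>
        (w.T2 m H 0 σ κ + ε * (-1) ^ m * w.T2 m H 1 σ κ)
          - κ * w.V / 2 * (w.T1 m 0 σ κ + ε * (-1) ^ m * w.T1 m 1 σ κ)))) := by
  obtain ⟨H, R, hR, hR'⟩ := hS.branchSum_expand (ε := ε) (δ := 1) (Or.inr hcase)
  refine ⟨H, ?_⟩
  have hb : Tendsto (fun j => (S j).beta) F (𝓝 w.b) := hS.data.b.congr hS.b_eq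
  obtain ⟨k0, k1, k2⟩ := tendsto_octet_weighted w.V hb hS.dr (fun j => (S j).dr_pos) (fun _ => 1)
    (g₀ := fun j σ κ => (1 + ε * (-1) ^ m) * (z j).T0 m σ κ)
    (fun σ κ => (hS.data.T0 m σ κ).const_mul (1 + ε * (-1) ^ m))
    (fun σ κ => (hS.data.T1 m 0 σ κ).add ((hS.data.T1 m 1 σ κ).const_mul (ε * (-1) ^ m))) hR
  simp only [one_mul] at k0 k1 k2
  have hform : ∀ j σ, ((1 + 1) + σ * (1 - 1) * (w.V * (S j).dr) / 2) / 2 = (1 : ℝ) := by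
    intro j σ
    ring
  simp only [hform, one_mul] at hR'
  refine ⟨fun hm => ?_, fun hm => ?_, fun hm hε => ?_⟩
  · refine (k0.const_mul (2 * D / 2 ^ m)).congr' ?_
    filter_upwards [hR'] with j hj
    have hd := (S j).dr_pos
    rw [hj, show (S j).dr ^ m = (S j).dr ^ (m - 2) * (S j).dr ^ 2 by rw [← pow_add]; congr 1; omega]
    generalize octet (S j).beta _ = o
    field_simp
  -- For odd m the lowest coefficient is odd in the displacements and drops out.
  · refine ((k1 fun j => octet_odd _ fun σ κ => ?_).const_mul (2 * D / 2 ^ m)).congr' ?_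
    · rw [SiteData.T0_neg, hm.neg_one_pow]
      ring
    filter_upwards [hR'] with j hj
    have hd := (S j).dr_pos
    have := hm.pos
    rw [hj, show (S j).dr ^ m = (S j).dr ^ (m - 1) * (S j).dr by rw [← pow_succ]; congr 1; omega]
    generalize octet (S j).beta _ = o
    field_simp
  -- For even m and ε = -1 the factor 1 + ε(-1)^m is zero, and the next coefficient is odd; two
  -- orders are lost.
  · refine ((k2 (fun j σ κ => ?_) fun j => octet_odd _ fun σ κ => ?_).const_mul
      (2 * D / 2 ^ m)).congr' ?_
    · rw [hε, hm.neg_one_pow]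
      ring
    · rw [SiteData.T1_neg, SiteData.T1_neg, hm.neg_one_pow]
      ring
    filter_upwards [hR'] with j hj
    have hd := (S j).dr_pos
    rw [hj]
    generalize octet (S j).beta _ = o
    field_simp

/-- The odd part of the transition weights: leading terms of the sum over pairs of branches. -/
theorem tendsto_branchSum_minus (hS : IsLocalLimit F S Q z w J f m C) (ε : ℝ) :
    ∃ H : ℝ,
    (Odd m → Tendsto (fun j => (S j).branchSum f ε (-1) (Q j) / (S j).tau / (S j).dr ^ (m - 1)) F
      (𝓝 (2 * D / 2 ^ m * octet w.b fun σ κ =>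
        σ * w.V / 2 * ((1 + ε * (-1) ^ m) * w.T0 m σ κ)))) ∧
    (Even m → Tendsto (fun j => (S j).branchSum f ε (-1) (Q j) / (S j).tau / (S j).dr ^ m) F
      (𝓝 (2 * D / 2 ^ m * octet w.b fun σ κ => σ * w.V / 2 *
        ((w.T1 m 0 σ κ + ε * (-1) ^ m * w.T1 m 1 σ κ)
        - κ * w.V / 2 * ((1 + ε * (-1) ^ m) * w.T0 m σ κ))))) ∧
    (Odd m → ε = 1 → Tendsto
      (fun j => (S j).branchSum f ε (-1) (Q j) / (S j).tau / (S j).dr ^ (m + 1)) F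
      (𝓝 (2 * D / 2 ^ m * octet w.b fun σ κ => σ * w.V / 2 *
        ((w.T2 m H 0 σ κ + ε * (-1) ^ m * w.T2 m H 1 σ κ)
          - κ * w.V / 2 * (w.T1 m 0 σ κ + ε * (-1) ^ m * w.T1 m 1 σ κ))))) := by
  obtain ⟨H, R, hR, hR'⟩ := hS.branchSum_expand (ε := ε) (δ := -1) (Or.inl rfl)
  refine ⟨H, ?_⟩
  have hb : Tendsto (fun j => (S j).beta) F (𝓝 w.b) := hS.data.b.congr hS.b_eq
  obtain ⟨k0, k1, k2⟩ := tendsto_octet_weighted w.V hb hS.dr (fun j => (S j).dr_pos)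
    (fun σ => σ * w.V / 2)
    (g₀ := fun j σ κ => (1 + ε * (-1) ^ m) * (z j).T0 m σ κ)
    (fun σ κ => (hS.data.T0 m σ κ).const_mul (1 + ε * (-1) ^ m))
    (fun σ κ => (hS.data.T1 m 0 σ κ).add ((hS.data.T1 m 1 σ κ).const_mul (ε * (-1) ^ m))) hR
  -- For δ = -1 only the odd part σVΔr/2 of the weight remains: every order rises by one and the
  -- parity required for a nonzero sum is reversed.
  have hform : ∀ j (σ x y : ℝ), ((1 + -1) + σ * (1 - -1) * (w.V * (S j).dr) / 2) / 2 * x * y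
      = (S j).dr * (σ * w.V / 2 * x * y) := by
    intro j σ x y
    ring
  simp only [hform, octet_mul] at hR'
  refine ⟨fun hm => ?_, fun hm => ?_, fun hm hε => ?_⟩
  · refine (k0.const_mul (2 * D / 2 ^ m)).congr' ?_
    filter_upwards [hR'] with j hj
    have hd := (S j).dr_pos
    have := hm.pos
    rw [hj, show (S j).dr ^ m = (S j).dr ^ (m - 1) * (S j).dr by rw [← pow_succ]; congr 1; omega]
    generalize octet (S j).beta _ = o
    field_simp
  · refine ((k1 fun j => octet_odd _ fun σ κ => ?_).const_mul (2 * D / 2 ^ m)).congr' ?_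
    · rw [SiteData.T0_neg, hm.neg_one_pow]
      ring
    filter_upwards [hR'] with j hj
    have hd := (S j).dr_pos
    rw [hj]
    generalize octet (S j).beta _ = o
    field_simp
  · refine ((k2 (fun j σ κ => ?_) fun j => octet_odd _ fun σ κ => ?_).const_mul
      (2 * D / 2 ^ m)).congr' ?_
    · rw [hε, hm.neg_one_pow]
      ring
    · rw [SiteData.T1_neg, SiteData.T1_neg, hm.neg_one_pow]
      ring
    filter_upwards [hR'] with j hj
    have hd := (S j).dr_pos
    rw [hj, pow_succ (S j).dr m]
    generalize octet (S j).beta _ = o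
    field_simp

end IsLocalLimit
end Multibaker

namespace Multibaker

/-! ### Binomial sums over even and over odd indices -/

theorem sum_range_even_odd (g : ℕ → ℝ) (n : ℕ) :
    ∑ q ∈ Finset.range (2 * n + 1), g q
      = ∑ p ∈ Finset.range (n + 1), g (2 * p) + ∑ p ∈ Finset.range n, g (2 * p + 1) := by
  induction n with
  | zero => simp
  | succ n ih =>
    rw [show 2 * (n + 1) + 1 = 2 * n + 1 + 1 + 1 by ring, Finset.sum_range_succ,
      Finset.sum_range_succ, ih, Finset.sum_range_succ _ (n + 1),
      Finset.sum_range_succ (fun p => g (2 * p + 1)) n, show 2 * (n + 1) = 2 * n + 1 + 1 by ring]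
    ring

/-- Half the sum and half the difference of the binomial expansions of (x + y)^(2n) and (x -
y)^(2n). -/
theorem choose_even_sums (x y : ℝ) (n : ℕ) :
    (∑ p ∈ Finset.range (n + 1), ((2 * n).choose (2 * p) : ℝ) * x ^ (2 * p) * y ^ (2 * (n - p))
      = ((x + y) ^ (2 * n) + (x - y) ^ (2 * n)) / 2) ∧
    (∑ p ∈ Finset.range n,
        ((2 * n).choose (2 * p + 1) : ℝ) * x ^ (2 * p + 1) * y ^ (2 * (n - p) - 1)
      = ((x + y) ^ (2 * n) - (x - y) ^ (2 * n)) / 2) := by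
  have h1 := add_pow x y (2 * n)
  have h2 := add_pow x (-y) (2 * n)
  rw [sum_range_even_odd] at h1 h2
  have e1 : ∀ Y : ℝ, ∑ p ∈ Finset.range (n + 1),
      x ^ (2 * p) * Y ^ (2 * n - 2 * p) * ((2 * n).choose (2 * p) : ℝ)
      = ∑ p ∈ Finset.range (n + 1), ((2 * n).choose (2 * p) : ℝ) * x ^ (2 * p) * Y ^ (2 * (n - p)) :=
    fun Y => Finset.sum_congr rfl fun p _ => by rw [← Nat.mul_sub]; ring
  have e2 : ∀ Y : ℝ, ∑ p ∈ Finset.range n,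
      x ^ (2 * p + 1) * Y ^ (2 * n - (2 * p + 1)) * ((2 * n).choose (2 * p + 1) : ℝ)
      = ∑ p ∈ Finset.range n,
        ((2 * n).choose (2 * p + 1) : ℝ) * x ^ (2 * p + 1) * Y ^ (2 * (n - p) - 1) :=
    fun Y => Finset.sum_congr rfl fun p _ => by
      rw [show 2 * n - (2 * p + 1) = 2 * (n - p) - 1 by omega]; ring
  rw [e1, e2] at h1 h2
  have o1 : ∑ p ∈ Finset.range (n + 1), ((2 * n).choose (2 * p) : ℝ) * x ^ (2 * p) * (-y) ^ (2 * (n - p))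
      = ∑ p ∈ Finset.range (n + 1), ((2 * n).choose (2 * p) : ℝ) * x ^ (2 * p) * y ^ (2 * (n - p)) :=
    Finset.sum_congr rfl fun p _ => by rw [(even_two_mul _).neg_pow]
  have o2 : ∑ p ∈ Finset.range n,
        ((2 * n).choose (2 * p + 1) : ℝ) * x ^ (2 * p + 1) * (-y) ^ (2 * (n - p) - 1)
      = -∑ p ∈ Finset.range n,
        ((2 * n).choose (2 * p + 1) : ℝ) * x ^ (2 * p + 1) * y ^ (2 * (n - p) - 1) := by
    rw [← Finset.sum_neg_distrib]
    refine Finset.sum_congr rfl fun p hp => ?_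
    have := Finset.mem_range.1 hp
    rw [show 2 * (n - p) - 1 = 2 * (n - p - 1) + 1 by omega, (odd_two_mul_add_one _).neg_pow]
    ring
  rw [o1, o2, ← sub_eq_add_neg x y] at h2
  constructor <;> linarith

theorem choose_odd_sums (x y : ℝ) (n : ℕ) :
    (∑ p ∈ Finset.range (n + 1),
        ((2 * n + 1).choose (2 * p) : ℝ) * x ^ (2 * p) * y ^ (2 * (n - p) + 1)
      = ((x + y) ^ (2 * n + 1) - (x - y) ^ (2 * n + 1)) / 2) ∧
    (∑ p ∈ Finset.range (n + 1),
        ((2 * n + 1).choose (2 * p + 1) : ℝ) * x ^ (2 * p + 1) * y ^ (2 * (n - p))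
      = ((x + y) ^ (2 * n + 1) + (x - y) ^ (2 * n + 1)) / 2) := by
  have h1 := add_pow x y (2 * n + 1)
  have h2 := add_pow x (-y) (2 * n + 1)
  have hsplit : ∀ g : ℕ → ℝ, ∑ q ∈ Finset.range (2 * n + 1 + 1), g q
      = ∑ p ∈ Finset.range (n + 1), g (2 * p) + ∑ p ∈ Finset.range (n + 1), g (2 * p + 1) := by
    intro g
    rw [Finset.sum_range_succ, sum_range_even_odd, Finset.sum_range_succ (fun p => g (2 * p + 1)) n]
    ring
  rw [hsplit] at h1 h2
  have e1 : ∀ Y : ℝ, ∑ p ∈ Finset.range (n + 1),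
      x ^ (2 * p) * Y ^ (2 * n + 1 - 2 * p) * ((2 * n + 1).choose (2 * p) : ℝ)
      = ∑ p ∈ Finset.range (n + 1),
        ((2 * n + 1).choose (2 * p) : ℝ) * x ^ (2 * p) * Y ^ (2 * (n - p) + 1) :=
    fun Y => Finset.sum_congr rfl fun p hp => by
      have := Finset.mem_range.1 hp
      rw [show 2 * n + 1 - 2 * p = 2 * (n - p) + 1 by omega]; ring
  have e2 : ∀ Y : ℝ, ∑ p ∈ Finset.range (n + 1),
      x ^ (2 * p + 1) * Y ^ (2 * n + 1 - (2 * p + 1)) * ((2 * n + 1).choose (2 * p + 1) : ℝ)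
      = ∑ p ∈ Finset.range (n + 1),
        ((2 * n + 1).choose (2 * p + 1) : ℝ) * x ^ (2 * p + 1) * Y ^ (2 * (n - p)) :=
    fun Y => Finset.sum_congr rfl fun p _ => by
      rw [show 2 * n + 1 - (2 * p + 1) = 2 * (n - p) by omega]; ring
  rw [e1, e2] at h1 h2
  have o1 : ∑ p ∈ Finset.range (n + 1),
        ((2 * n + 1).choose (2 * p) : ℝ) * x ^ (2 * p) * (-y) ^ (2 * (n - p) + 1)
      = -∑ p ∈ Finset.range (n + 1),
        ((2 * n + 1).choose (2 * p) : ℝ) * x ^ (2 * p) * y ^ (2 * (n - p) + 1) := by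
    rw [← Finset.sum_neg_distrib]
    refine Finset.sum_congr rfl fun p hp => ?_
    rw [(odd_two_mul_add_one _).neg_pow]
    ring
  have o2 : ∑ p ∈ Finset.range (n + 1),
        ((2 * n + 1).choose (2 * p + 1) : ℝ) * x ^ (2 * p + 1) * (-y) ^ (2 * (n - p))
      = ∑ p ∈ Finset.range (n + 1),
        ((2 * n + 1).choose (2 * p + 1) : ℝ) * x ^ (2 * p + 1) * y ^ (2 * (n - p)) :=
    Finset.sum_congr rfl fun p _ => by rw [(even_two_mul _).neg_pow]
  rw [o1, o2, ← sub_eq_add_neg x y] at h2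
  constructor <;> linarith

theorem choose_term_congr (x y : ℝ) {M M' q e e' : ℕ} (hM : M = M') (he : e = e') :
    (M.choose q : ℝ) * x ^ q * y ^ e = (M'.choose q : ℝ) * x ^ q * y ^ e' := by
  rw [hM, he]

namespace SiteData

variable (z : SiteData)

/-- Only even arguments occur in the leading coefficients, so the grid Péclet number never enters
them, and S_ν is β up to a correction at 0. -/
theorem Sν_even (p : ℕ) : z.Sν (2 * p) = z.b + if p = 0 then 1 - z.b else 0 := by
  unfold Sν
  rcases eq_or_ne p 0 with rfl | hp
  · simp
  · rw [if_neg (by omega), if_neg (by omega), if_neg hp, add_zero]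

/-- The uniform part β yields the branch pairs (1, ±1) through (x ± y)^M, and the correction at the
extreme index yields y^M, the pair (0, 1). The reversed version below yields x^M, the pair (1, 0).
Brackets containing S_ν are affine in it, hence the form of the hypotheses `hG` that follow. -/
theorem sum_mul_Sν (c : ℕ → ℝ) (n : ℕ) :
    ∑ p ∈ Finset.range (n + 1), c p * z.Sν (2 * p)
      = z.b * ∑ p ∈ Finset.range (n + 1), c p + (1 - z.b) * c 0 := by
  simp only [Sν_even, mul_add, Finset.sum_add_distrib, mul_ite, mul_zero, Finset.mul_sum]
  rw [Finset.sum_ite_eq' (Finset.range (n + 1)) 0, if_pos (by simp)]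
  rw [mul_comm (c 0)]
  congr 1
  exact Finset.sum_congr rfl fun p _ => mul_comm _ _

theorem sum_mul_Sν_rev (c : ℕ → ℝ) (n : ℕ) :
    ∑ p ∈ Finset.range (n + 1), c p * z.Sν (2 * (n - p))
      = z.b * ∑ p ∈ Finset.range (n + 1), c p + (1 - z.b) * c n := by
  rw [← Finset.sum_range_reflect]
  have : ∑ j ∈ Finset.range (n + 1), c (n + 1 - 1 - j) * z.Sν (2 * (n - (n + 1 - 1 - j)))
      = ∑ j ∈ Finset.range (n + 1), c (n - j) * z.Sν (2 * j) := by
    refine Finset.sum_congr rfl fun j hj => ?_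
    have := Finset.mem_range.1 hj
    rw [show n - (n + 1 - 1 - j) = j by omega, show n + 1 - 1 - j = n - j by omega]
  rw [this, sum_mul_Sν, Nat.sub_zero, ← Finset.sum_range_reflect]
  congr 2
  refine Finset.sum_congr rfl fun j hj => ?_
  have := Finset.mem_range.1 hj
  congr 1
  omega

/-- Even indices, odd exponent. -/
theorem sum_odd_even (x y : ℝ) (n : ℕ) {c : ℕ → ℝ} (G : ℝ → ℝ)
    (hc : ∀ p ∈ Finset.range (n + 1),
      c p = ((2 * n + 1).choose (2 * p) : ℝ) * x ^ (2 * p) * y ^ (2 * (n - p) + 1))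
    (hG : ∀ s, G s = G 0 + (G 1 - G 0) * s) :
    ∑ p ∈ Finset.range (n + 1), c p * G (z.Sν (2 * p))
      = G z.b * (((x + y) ^ (2 * n + 1) - (x - y) ^ (2 * n + 1)) / 2)
        + (1 - z.b) * (G 1 - G 0) * y ^ (2 * n + 1) := by
  have e : ∀ p ∈ Finset.range (n + 1), c p * G (z.Sν (2 * p))
      = G 0 * c p + (G 1 - G 0) * (c p * z.Sν (2 * p)) := by
    intro p _
    rw [hG]
    ring
  rw [Finset.sum_congr rfl e, Finset.sum_add_distrib, ← Finset.mul_sum, ← Finset.mul_sum,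
    sum_mul_Sν, Finset.sum_congr rfl hc, (choose_odd_sums x y n).1, hc 0 (by simp), hG z.b]
  simp
  ring

/-- Odd indices, odd exponent. -/
theorem sum_odd_odd (x y : ℝ) (n : ℕ) {c : ℕ → ℝ} (G : ℝ → ℝ) {t : ℕ → ℕ}
    (hc : ∀ p ∈ Finset.range (n + 1),
      c p = ((2 * n + 1).choose (2 * p + 1) : ℝ) * x ^ (2 * p + 1) * y ^ (2 * (n - p)))
    (ht : ∀ p, t p = 2 * (n - p)) (hG : ∀ s, G s = G 0 + (G 1 - G 0) * s) :
    ∑ p ∈ Finset.range (n + 1), c p * G (z.Sν (t p))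
      = G z.b * (((x + y) ^ (2 * n + 1) + (x - y) ^ (2 * n + 1)) / 2)
        + (1 - z.b) * (G 1 - G 0) * x ^ (2 * n + 1) := by
  have e : ∀ p ∈ Finset.range (n + 1), c p * G (z.Sν (t p))
      = G 0 * c p + (G 1 - G 0) * (c p * z.Sν (2 * (n - p))) := by
    intro p _
    rw [ht, hG]
    ring
  rw [Finset.sum_congr rfl e, Finset.sum_add_distrib, ← Finset.mul_sum, ← Finset.mul_sum,
    sum_mul_Sν_rev, Finset.sum_congr rfl hc, (choose_odd_sums x y n).2, hc n (by simp), hG z.b]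
  simp
  ring

/-- Even indices, even exponent. -/
theorem sum_even_even (x y : ℝ) (n : ℕ) {c : ℕ → ℝ} (G : ℝ → ℝ → ℝ) {t : ℕ → ℕ}
    (hc : ∀ p ∈ Finset.range (n + 1),
      c p = ((2 * n).choose (2 * p) : ℝ) * x ^ (2 * p) * y ^ (2 * (n - p)))
    (ht : ∀ p, t p = 2 * (n - p))
    (hG : ∀ s t, G s t = G 0 0 + (G 1 0 - G 0 0) * s + (G 0 1 - G 0 0) * t) :
    ∑ p ∈ Finset.range (n + 1), c p * G (z.Sν (2 * p)) (z.Sν (t p))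
      = G z.b z.b * (((x + y) ^ (2 * n) + (x - y) ^ (2 * n)) / 2)
        + (1 - z.b) * (G 1 0 - G 0 0) * y ^ (2 * n)
        + (1 - z.b) * (G 0 1 - G 0 0) * x ^ (2 * n) := by
  have e : ∀ p ∈ Finset.range (n + 1), c p * G (z.Sν (2 * p)) (z.Sν (t p))
      = G 0 0 * c p + (G 1 0 - G 0 0) * (c p * z.Sν (2 * p))
        + (G 0 1 - G 0 0) * (c p * z.Sν (2 * (n - p))) := by
    intro p _
    rw [ht, hG]
    ring
  rw [Finset.sum_congr rfl e, Finset.sum_add_distrib, Finset.sum_add_distrib, ← Finset.mul_sum,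
    ← Finset.mul_sum, ← Finset.mul_sum, sum_mul_Sν, sum_mul_Sν_rev, Finset.sum_congr rfl hc,
    (choose_even_sums x y n).1, hc 0 (by simp), hc n (by simp), hG z.b z.b]
  simp
  ring

/-- Odd indices, even exponent. -/
theorem sum_even_odd (x y : ℝ) (n : ℕ) {c : ℕ → ℝ} (G : ℝ)
    (hc : ∀ p ∈ Finset.range n,
      c p = ((2 * n).choose (2 * p + 1) : ℝ) * x ^ (2 * p + 1) * y ^ (2 * (n - p) - 1)) :
    ∑ p ∈ Finset.range n, c p * G
      = G * (((x + y) ^ (2 * n) - (x - y) ^ (2 * n)) / 2) := by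
  rw [← Finset.sum_mul, Finset.sum_congr rfl hc, (choose_even_sums x y n).2, mul_comm]

end SiteData
end Multibaker

namespace Multibaker

/-! ### The leading coefficients as sums over the branches -/

namespace SiteData

variable (z : SiteData)

theorem formA_one_zero : z.formA 1 0 = z.X10 := by simp [formA]

theorem formA_zero_one : z.formA 0 1 = z.X01 := by simp [formA]

theorem formA_one_one : z.formA 1 1 = z.X10 + z.X01 := by simp [formA]

theorem formA_one_neg_one : z.formA 1 (-1) = z.X10 - z.X01 := by simp [formA, sub_eq_add_neg]

/-- Two orders beyond the lowest the parity is again (-1)^m. The cases m = 0 and m = 1 are separate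
because of the truncated exponents. -/
theorem T2_neg (m : ℕ) (H : ℝ) (e : Fin 2) (σ κ : ℝ) :
    z.T2 m H e (-σ) (-κ) = (-1) ^ m * z.T2 m H e σ κ := by
  have hA : z.formA (-σ) (-κ) = -z.formA σ κ := by
    simp only [formA]
    ring
  have hB : z.formB e (-σ) (-κ) = z.formB e σ κ := by
    simp only [formB]
    ring
  have hE : z.formE e (-σ) (-κ) = -z.formE e σ κ := by
    simp only [formE]
    ring
  have hY : z.formY1 e (-σ) (-κ) = -z.formY1 e σ κ := by
    simp only [formY1]
    ring
  have hY2 : z.formY2 e (-σ) (-κ) = z.formY2 e σ κ := by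
    simp only [formY2]
    ring
  rw [T2, T2, hA, hB, hE, hY, hY2, neg_pow _ m, neg_pow _ (m - 1), neg_pow _ (m - 2)]
  rcases m with _ | _ | m
  · simp only [Nat.cast_zero, Nat.zero_sub, pow_zero]
    ring
  · simp only [Nat.cast_one, Nat.sub_self, zero_add, Nat.sub_eq_zero_of_le one_le_two, pow_zero,
      pow_one, sub_self]
    ring
  · simp only [Nat.add_sub_cancel, show m + 1 + 1 - 2 = m from rfl, pow_succ]
    ring

theorem v_eq_V_mul_D (hD : z.D ≠ 0) : z.v = z.V * z.D := by
  rw [V, div_mul_cancel₀ _ hD]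

theorem leadI1_eq {m' : ℕ} (hm : 0 < m') :
    z.leadI1 m' = 2 * z.D / 2 ^ (2 * m') * octet z.b fun σ κ => 2 * z.T0 (2 * m') σ κ := by
  obtain ⟨n, rfl⟩ : ∃ n, m' = n + 1 := ⟨m' - 1, by omega⟩
  have h := (choose_even_sums z.X10 z.X01 (n + 1)).1
  -- The extreme terms X01^m and X10^m are split off, since in `leadI1` they appear with weight 1
  -- instead of β.
  rw [Finset.sum_range_succ, Finset.sum_range_eq_add_Ico _ (Nat.succ_pos n)] at h
  -- The exponent is -1 when m = 2, so an integer power is needed.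
  have h2 : (2 : ℝ) ^ (2 * ((n + 1 : ℕ) : ℤ) - 3) = 2 ^ (2 * (n + 1)) / 8 := by
    rw [zpow_sub₀ two_ne_zero]
    norm_cast
  rw [octet_even]
  · simp only [leadI1, T0, formA_one_zero, formA_zero_one, formA_one_one, formA_one_neg_one, h2]
    simp only [Nat.choose_self, Nat.sub_self, mul_zero, Nat.choose_zero_right, Nat.cast_one,
      pow_zero, one_mul, mul_one, Nat.sub_zero] at h
    rw [← eq_sub_iff_add_eq, ← eq_sub_iff_add_eq'] at h
    rw [h]
    generalize (2 : ℝ) ^ (2 * (n + 1)) = q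
    rcases eq_or_ne q 0 with rfl | hq
    · simp
    · field_simp
      ring
  · intro σ κ
    rw [T0_neg, (even_two_mul _).neg_one_pow, one_mul]

/-- Each binomial sum is replaced by powers of X10 ± X01, X10 and X01, that is by the values of
`formA` on the four representatives left by `octet_even`; a polynomial identity remains. The other
coefficients are matched in the same way. -/
theorem leadII1_eq_plus (hD : z.D ≠ 0) (hδ : z.δ = 1) (m' : ℕ) :
    z.leadII1 m' = 2 * z.D / 2 ^ (2 * m' + 1) * octet z.b fun σ κ =>
      (z.T1 (2 * m' + 1) 0 σ κ - z.ε * z.T1 (2 * m' + 1) 1 σ κ)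
        - κ * z.V / 2 * ((1 - z.ε) * z.T0 (2 * m' + 1) σ κ) := by
  have h1 := z.sum_odd_even z.X10 z.X01 m' (fun s => s) (fun _ _ => rfl) (by intros; ring)
  have h2 := z.sum_odd_even z.X10 z.X01 m' (fun s => both (-z.ε) (fun i => z.Y i 0 1) * s)
    (fun _ _ => rfl) (by intros; ring)
  have h3 := z.sum_odd_odd z.X10 z.X01 m' (fun s => both (-z.ε) (fun i => z.Y i 1 0) * s)
    (fun _ _ => rfl) (fun _ => rfl) (by intros; ring)
  have h4 := z.sum_even_even z.X10 z.X01 m'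
    (fun s t => both (-z.ε) (fun i => z.X i 2 0 * t + z.X i 0 2 * s))
    (fun _ _ => rfl) (fun _ => rfl) (by intros; simp only [both]; ring)
  have h5 := sum_even_odd z.X10 z.X01 m' (both (-z.ε) (fun i => z.X i 1 1)) (fun _ _ => rfl)
  simp only [← mul_assoc] at h2 h3
  rw [octet_even]
  · simp only [leadII1]
    rw [h1, h2, h3, h4, h5]
    simp only [both, T0, T1, formA_one_zero, formA_zero_one,
      formA_one_one, formA_one_neg_one, hδ, z.v_eq_V_mul_D hD, formB, formY1, Nat.add_sub_cancel]
    simp only [pow_succ (_ + _), pow_succ (_ - _), pow_succ z.X10, pow_succ z.X01]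
    -- From here on the four powers are independent variables.
    generalize (z.X10 + z.X01) ^ (2 * m') = p1
    generalize (z.X10 - z.X01) ^ (2 * m') = p2
    generalize z.X10 ^ (2 * m') = p3
    generalize z.X01 ^ (2 * m') = p4
    push_cast
    field_simp
    ring
  · intro σ κ
    rw [T0_neg, T1_neg, T1_neg, (odd_two_mul_add_one m').neg_one_pow]
    ring

theorem leadII1_eq_minus (hD : z.D ≠ 0) (hε : z.ε = -1) (hδ : z.δ = -1) (m' : ℕ) :
    z.leadII1 m' = 2 * z.D / 2 ^ (2 * m' + 1) * octet z.b fun σ κ =>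
      σ * z.V / 2 * (2 * z.T0 (2 * m' + 1) σ κ) := by
  have h1 := z.sum_odd_odd z.X10 z.X01 m' (fun s => s) (fun _ _ => rfl) (fun _ => rfl)
    (by intros; ring)
  rw [octet_even]
  · simp only [leadII1, h1, T0, formA_one_zero, formA_zero_one,
      formA_one_one, formA_one_neg_one, hδ, hε, z.v_eq_V_mul_D hD]
    field_simp
    ring
  · intro σ κ
    rw [T0_neg, (odd_two_mul_add_one m').neg_one_pow]
    ring

end SiteData
end Multibaker

/-! ### The coefficients involving second-order terms as sums over the branches -/

namespace Multibaker
namespace SiteData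

variable (z : SiteData)

theorem v_sq_mul_div_D (hD : z.D ≠ 0) (c : ℝ) : z.v ^ 2 * c / z.D = z.V ^ 2 * z.D * c := by
  rw [V]
  field_simp

/-- For m' = n + 1 the exponents coming from m - 1 and m - 2 are honest. This lemma and the next
three bring them to the form of the general sums with n in place of m'. -/
theorem sum_pred_even {M n : ℕ} (hM : M = 2 * n + 1) (G : ℝ → ℝ)
    (hG : ∀ s, G s = G 0 + (G 1 - G 0) * s) :
    ∑ p ∈ Finset.range (n + 1),
        (M.choose (2 * p) : ℝ) * z.X10 ^ (2 * p) * z.X01 ^ (2 * (n + 1 - p) - 1) * G (z.Sν (2 * p))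
      = G z.b * (((z.X10 + z.X01) ^ (2 * n + 1) - (z.X10 - z.X01) ^ (2 * n + 1)) / 2)
        + (1 - z.b) * (G 1 - G 0) * z.X01 ^ (2 * n + 1) :=
  z.sum_odd_even _ _ n G (fun p hp => choose_term_congr _ _ hM (by
    have := Finset.mem_range.1 hp
    omega)) hG

theorem sum_pred_odd {M n : ℕ} (hM : M = 2 * n + 1) (G : ℝ → ℝ)
    (hG : ∀ s, G s = G 0 + (G 1 - G 0) * s) :
    ∑ p ∈ Finset.range (n + 1),
        (M.choose (2 * p + 1) : ℝ) * z.X10 ^ (2 * p + 1) * z.X01 ^ (2 * (n + 1 - p - 1))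
          * G (z.Sν (2 * (n + 1 - p - 1)))
      = G z.b * (((z.X10 + z.X01) ^ (2 * n + 1) + (z.X10 - z.X01) ^ (2 * n + 1)) / 2)
        + (1 - z.b) * (G 1 - G 0) * z.X10 ^ (2 * n + 1) :=
  z.sum_odd_odd _ _ n G (fun p _ => choose_term_congr _ _ hM (by omega)) (fun p => by omega) hG

theorem sum_pred_pred_even {M n : ℕ} (hM : M = 2 * n) (G : ℝ → ℝ → ℝ)
    (hG : ∀ s t, G s t = G 0 0 + (G 1 0 - G 0 0) * s + (G 0 1 - G 0 0) * t) :
    ∑ p ∈ Finset.range (n + 1),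
        (M.choose (2 * p) : ℝ) * z.X10 ^ (2 * p) * z.X01 ^ (2 * (n + 1 - p - 1))
          * G (z.Sν (2 * p)) (z.Sν (2 * (n + 1 - p - 1)))
      = G z.b z.b * (((z.X10 + z.X01) ^ (2 * n) + (z.X10 - z.X01) ^ (2 * n)) / 2)
        + (1 - z.b) * (G 1 0 - G 0 0) * z.X01 ^ (2 * n)
        + (1 - z.b) * (G 0 1 - G 0 0) * z.X10 ^ (2 * n) :=
  z.sum_even_even _ _ n G (fun p _ => choose_term_congr _ _ hM (by omega)) (fun p => by omega) hG

theorem sum_pred_pred_odd {M n : ℕ} (hM : M = 2 * n) (G : ℝ) :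
    ∑ p ∈ Finset.range n,
        (M.choose (2 * p + 1) : ℝ) * z.X10 ^ (2 * p + 1) * z.X01 ^ (2 * (n + 1 - p - 1) - 1) * G
      = G * (((z.X10 + z.X01) ^ (2 * n) - (z.X10 - z.X01) ^ (2 * n)) / 2) :=
  sum_even_odd _ _ n G (fun p _ => choose_term_congr _ _ hM (by omega))

/-- `H` is arbitrary: with ε = -1 the two values of `e` are subtracted, and the `H`-term is common
to both. The case m = 0 is separate because m - 1 and m - 2 truncate; all terms with the factor m
disappear. -/
theorem leadI2_zero_eq_plus (hD : z.D ≠ 0) (hε : z.ε = -1) (hδ : z.δ = 1) (H : ℝ) :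
    z.leadI2 0 = 2 * z.D / 2 ^ 0 * octet z.b fun σ κ =>
      (z.T2 0 H 0 σ κ + z.ε * z.T2 0 H 1 σ κ)
        - κ * z.V / 2 * (z.T1 0 0 σ κ + z.ε * z.T1 0 1 σ κ) := by
  rw [octet_even]
  · simp only [leadI2, mul_zero, Finset.range_zero, Finset.sum_empty, Finset.sum_range_one, zero_add,
      Nat.choose_zero_right, pow_zero, Sν, if_true, Nat.cast_zero, Nat.cast_one,
      Nat.zero_sub, both, T2, T1, formY1, formY2, hδ, hε, z.v_eq_V_mul_D hD]
    ring
  · intro σ κ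
    rw [T1_neg, T1_neg, T2_neg, T2_neg]
    ring

theorem leadI2_zero_eq_minus (hD : z.D ≠ 0) (hδ : z.δ = -1) :
    z.leadI2 0 = 2 * z.D / 2 ^ 0 * octet z.b fun σ κ =>
      σ * z.V / 2 * ((z.T1 0 0 σ κ + z.ε * z.T1 0 1 σ κ)
        - κ * z.V / 2 * ((1 + z.ε) * z.T0 0 σ κ)) := by
  rw [octet_even]
  · simp only [leadI2, mul_zero, Finset.range_zero, Finset.sum_empty, Finset.sum_range_one, zero_add,
      Nat.choose_zero_right, pow_zero, Sν, if_true, Nat.cast_zero, Nat.cast_one,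
      Nat.zero_sub, both, T0, T1, formY1, hδ, z.v_eq_V_mul_D hD]
    ring
  · intro σ κ
    rw [T1_neg, T1_neg, T0_neg]
    ring

theorem leadI2_succ_eq_plus (hD : z.D ≠ 0) (hε : z.ε = -1) (hδ : z.δ = 1) (H : ℝ) (n : ℕ) :
    z.leadI2 (n + 1) = 2 * z.D / 2 ^ (2 * (n + 1)) * octet z.b fun σ κ =>
      (z.T2 (2 * (n + 1)) H 0 σ κ + z.ε * z.T2 (2 * (n + 1)) H 1 σ κ)
        - κ * z.V / 2 * (z.T1 (2 * (n + 1)) 0 σ κ + z.ε * z.T1 (2 * (n + 1)) 1 σ κ) := by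
  have hM1 : 2 * (n + 1) - 1 = 2 * n + 1 := by omega
  have hM2 : 2 * (n + 1) - 2 = 2 * n := by omega
  have h1 := z.sum_even_even z.X10 z.X01 (n + 1)
    (fun s t => both z.ε (fun i => (z.δ + 1) * z.Y i 0 1 * s + (z.δ - 1) * z.Y i 1 0 * t))
    (fun _ _ => rfl) (fun _ => rfl) (by intros; simp only [both]; ring)
  have h2 := sum_even_odd z.X10 z.X01 (n + 1)
    (both z.ε (fun i => (z.δ - 1) * z.Y i 0 1 + (z.δ + 1) * z.Y i 1 0)) (fun _ _ => rfl)
  have h3 := z.sum_pred_even hM1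
    (fun s => both z.ε (fun i => (z.δ + 1) * z.X i 0 2 * s
                + z.b * (z.δ - 1) * z.X i 1 1 + z.b * (z.δ + 1) * z.X i 2 0))
    (by intros; simp only [both]; ring)
  have h4 := z.sum_pred_odd hM1
    (fun s => both z.ε (fun i => z.b * (z.δ - 1) * z.X i 0 2 + z.b * (z.δ + 1) * z.X i 1 1
                + (z.δ - 1) * z.X i 2 0 * s))
    (by intros; simp only [both]; ring)
  have h5 := z.sum_even_even z.X10 z.X01 (n + 1)
    (fun s t => z.C' * both z.ε (fun i => z.Y i 0 2 * s + z.Y i 2 0 * t)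
      + 1 / 2 * z.C'' * both z.ε (fun i => z.Y i 0 1 ^ 2 * s + z.Y i 1 0 ^ 2 * t))
    (fun _ _ => rfl) (fun _ => rfl) (by intros; simp only [both]; ring)
  have h6 := sum_even_odd z.X10 z.X01 (n + 1)
    (z.C' * both z.ε (fun i => z.Y i 1 1) + z.C'' * both z.ε (fun i => z.Y i 0 1 * z.Y i 1 0))
    (fun _ _ => rfl)
  have h7 := z.sum_pred_even hM1
    (fun s => z.C' * both z.ε (fun i => z.X i 0 2 * z.Y i 0 1 * s
                  + z.b * z.X i 1 1 * z.Y i 1 0 + z.b * z.X i 2 0 * z.Y i 0 1)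
                + z.C * both z.ε (fun i => z.X i 0 3 * s + z.b * z.X i 2 1))
    (by intros; simp only [both]; ring)
  have h8 := z.sum_pred_odd hM1
    (fun s => z.C' * both z.ε (fun i => z.b * z.X i 0 2 * z.Y i 1 0 + z.b * z.X i 1 1 * z.Y i 0 1
                  + z.X i 2 0 * z.Y i 1 0 * s)
                + z.C * both z.ε (fun i => z.b * z.X i 1 2 + z.X i 3 0 * s))
    (by intros; simp only [both]; ring)
  have h9 := z.sum_pred_pred_even hM2
    (fun s t => both z.ε (fun i => z.X i 0 2 ^ 2 * s + 2 * z.b * z.X i 0 2 * z.X i 2 0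
                + z.b * z.X i 1 1 ^ 2 + z.X i 2 0 ^ 2 * t))
    (by intros; simp only [both]; ring)
  have h10 := z.sum_pred_pred_odd hM2
    (both z.ε (fun i => 2 * z.X i 0 2 * z.X i 1 1 + 2 * z.X i 1 1 * z.X i 2 0))
  rw [octet_even]
  · simp only [leadI2, Nat.add_sub_cancel]
    rw [h1, h2, h3, h4, h5, h6, h7, h8, h9, h10]
    clear h1 h2 h3 h4 h5 h6 h7 h8 h9 h10
    simp only [both, T1, T2, formA_one_zero, formA_zero_one, formA_one_one, formA_one_neg_one,
      formB, formE, formY1, formY2, hδ, hε, z.v_eq_V_mul_D hD, mul_add 2 n 1, mul_one,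
      show 2 * n + 2 - 1 = 2 * n + 1 from rfl, show 2 * n + 2 - 2 = 2 * n from rfl]
    simp only [show 2 * n + 2 + 1 = 2 * n + 3 from rfl, show 2 * n + 2 + 2 = 2 * n + 4 from rfl,
      pow_add _ (2 * n)]
    generalize (2 : ℝ) ^ (2 * n) = q
    generalize (z.X10 + z.X01) ^ (2 * n) = p1
    generalize (z.X10 - z.X01) ^ (2 * n) = p2
    generalize z.X10 ^ (2 * n) = p3
    generalize z.X01 ^ (2 * n) = p4
    -- Even the relation between the sum, the difference and X10, X01 is not needed: coefficients of
    -- equal powers agree.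
    generalize z.X10 + z.X01 = s
    generalize z.X10 - z.X01 = d
    push_cast
    ring
  · intro σ κ
    rw [T1_neg, T1_neg, T2_neg, T2_neg, (even_two_mul _).neg_one_pow]
    ring

theorem leadI2_succ_eq_minus (hD : z.D ≠ 0) (hδ : z.δ = -1) (n : ℕ) :
    z.leadI2 (n + 1) = 2 * z.D / 2 ^ (2 * (n + 1)) * octet z.b fun σ κ =>
      σ * z.V / 2 * ((z.T1 (2 * (n + 1)) 0 σ κ + z.ε * z.T1 (2 * (n + 1)) 1 σ κ)
        - κ * z.V / 2 * ((1 + z.ε) * z.T0 (2 * (n + 1)) σ κ)) := by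
  have hM1 : 2 * (n + 1) - 1 = 2 * n + 1 := by omega
  have h0 := (choose_even_sums z.X10 z.X01 (n + 1)).2
  have h1 := z.sum_even_even z.X10 z.X01 (n + 1)
    (fun s t => both z.ε (fun i => (z.δ + 1) * z.Y i 0 1 * s + (z.δ - 1) * z.Y i 1 0 * t))
    (fun _ _ => rfl) (fun _ => rfl) (by intros; simp only [both]; ring)
  have h2 := sum_even_odd z.X10 z.X01 (n + 1)
    (both z.ε (fun i => (z.δ - 1) * z.Y i 0 1 + (z.δ + 1) * z.Y i 1 0)) (fun _ _ => rfl)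
  have h3 := z.sum_pred_even hM1
    (fun s => both z.ε (fun i => (z.δ + 1) * z.X i 0 2 * s
                + z.b * (z.δ - 1) * z.X i 1 1 + z.b * (z.δ + 1) * z.X i 2 0))
    (by intros; simp only [both]; ring)
  have h4 := z.sum_pred_odd hM1
    (fun s => both z.ε (fun i => z.b * (z.δ - 1) * z.X i 0 2 + z.b * (z.δ + 1) * z.X i 1 1
                + (z.δ - 1) * z.X i 2 0 * s))
    (by intros; simp only [both]; ring)
  rw [octet_even]
  · simp only [leadI2]
    rw [h0, h1, h2, h3, h4]
    clear h0 h1 h2 h3 h4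
    rw [z.v_sq_mul_div_D hD]
    simp only [hδ, neg_add_cancel, zero_mul, add_zero]
    simp only [both, T0, T1, formA_one_zero, formA_zero_one, formA_one_one, formA_one_neg_one,
      formB, formY1, z.v_eq_V_mul_D hD, mul_add 2 n 1, mul_one,
      show 2 * n + 2 - 1 = 2 * n + 1 from rfl]
    simp only [show 2 * n + 2 + 1 = 2 * n + 3 from rfl, pow_add _ (2 * n)]
    generalize (2 : ℝ) ^ (2 * n) = q
    generalize (z.X10 + z.X01) ^ (2 * n) = p1
    generalize (z.X10 - z.X01) ^ (2 * n) = p2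
    generalize z.X10 ^ (2 * n) = p3
    generalize z.X01 ^ (2 * n) = p4
    generalize z.X10 + z.X01 = s
    generalize z.X10 - z.X01 = d
    push_cast
    ring
  · intro σ κ
    rw [T1_neg, T1_neg, T0_neg, (even_two_mul _).neg_one_pow]
    ring

theorem leadI2_eq_plus (hD : z.D ≠ 0) (hε : z.ε = -1) (hδ : z.δ = 1) (H : ℝ) (m' : ℕ) :
    z.leadI2 m' = 2 * z.D / 2 ^ (2 * m') * octet z.b fun σ κ =>
      (z.T2 (2 * m') H 0 σ κ + z.ε * z.T2 (2 * m') H 1 σ κ)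
        - κ * z.V / 2 * (z.T1 (2 * m') 0 σ κ + z.ε * z.T1 (2 * m') 1 σ κ) := by
  rcases m' with _ | n
  · exact z.leadI2_zero_eq_plus hD hε hδ H
  · exact z.leadI2_succ_eq_plus hD hε hδ H n

theorem leadI2_eq_minus (hD : z.D ≠ 0) (hδ : z.δ = -1) (m' : ℕ) :
    z.leadI2 m' = 2 * z.D / 2 ^ (2 * m') * octet z.b fun σ κ =>
      σ * z.V / 2 * ((z.T1 (2 * m') 0 σ κ + z.ε * z.T1 (2 * m') 1 σ κ)
        - κ * z.V / 2 * ((1 + z.ε) * z.T0 (2 * m') σ κ)) := by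
  rcases m' with _ | n
  · exact z.leadI2_zero_eq_minus hD hδ
  · exact z.leadI2_succ_eq_minus hD hδ n

theorem leadII2_zero_eq (hD : z.D ≠ 0) (H : ℝ) :
    z.leadII2 0 = 2 * z.D / 2 ^ 1 * octet z.b fun σ κ =>
      σ * z.V / 2 * ((z.T2 1 H 0 σ κ - z.T2 1 H 1 σ κ)
        - κ * z.V / 2 * (z.T1 1 0 σ κ - z.T1 1 1 σ κ)) := by
  rw [octet_even]
  · simp only [leadII2]
    rw [z.v_sq_mul_div_D hD, z.v_sq_mul_div_D hD]
    simp only [mul_zero, Finset.range_zero, Finset.sum_empty, Finset.sum_range_one,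
      zero_add, Nat.choose_zero_right, Nat.choose_self, pow_zero, pow_one, Sν, if_true,
      Nat.cast_one, Nat.sub_self, both, T2, T1, formA_one_zero, formA_zero_one, formA_one_one,
      formA_one_neg_one, formB, formE, formY1, formY2, z.v_eq_V_mul_D hD]
    ring
  · intro σ κ
    rw [T1_neg, T1_neg, T2_neg, T2_neg]
    ring

theorem leadII2_succ_eq (hD : z.D ≠ 0) (H : ℝ) (n : ℕ) :
    z.leadII2 (n + 1) = 2 * z.D / 2 ^ (2 * (n + 1) + 1) * octet z.b fun σ κ =>
      σ * z.V / 2 *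
        ((z.T2 (2 * (n + 1) + 1) H 0 σ κ - z.T2 (2 * (n + 1) + 1) H 1 σ κ)
          - κ * z.V / 2 * (z.T1 (2 * (n + 1) + 1) 0 σ κ - z.T1 (2 * (n + 1) + 1) 1 σ κ)) := by
  have hM2 : 2 * (n + 1) + 1 - 2 = 2 * n + 1 := by omega
  have h1 := z.sum_odd_even z.X10 z.X01 (n + 1) (fun _ => both (-1) (fun i => z.Y i 1 0))
    (fun _ _ => rfl) (by intros; ring)
  have h2 := z.sum_odd_odd z.X10 z.X01 (n + 1) (fun _ => both (-1) (fun i => z.Y i 0 1))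
    (fun _ _ => rfl) (fun _ => rfl) (by intros; ring)
  have h3 := z.sum_even_even z.X10 z.X01 (n + 1) (fun _ _ => both (-1) (fun i => z.X i 1 1))
    (fun _ _ => rfl) (fun _ => rfl) (by intros; ring)
  have h4 := sum_even_odd z.X10 z.X01 (n + 1) (both (-1) (fun i => z.X i 0 2 + z.X i 2 0))
    (fun _ _ => rfl)
  have h5 := z.sum_odd_even z.X10 z.X01 (n + 1)
    (fun _ => z.C' * both (-1) (fun i => z.Y i 1 1)
      + z.C'' * both (-1) (fun i => z.Y i 0 1 * z.Y i 1 0))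
    (fun _ _ => rfl) (by intros; ring)
  have h6 := z.sum_odd_odd z.X10 z.X01 (n + 1)
    (fun s => z.C' * both (-1) (fun i => z.b * z.Y i 0 2 + z.Y i 2 0 * s)
      + 1 / 2 * z.C'' * both (-1) (fun i => z.b * z.Y i 0 1 ^ 2 + z.Y i 1 0 ^ 2 * s))
    (fun _ _ => rfl) (fun _ => rfl) (by intros; simp only [both]; ring)
  have h7 := z.sum_even_even z.X10 z.X01 (n + 1)
    (fun _ s => z.C' * both (-1) (fun i => z.b * z.X i 0 2 * z.Y i 1 0
        + z.b * z.X i 1 1 * z.Y i 0 1 + z.X i 2 0 * z.Y i 1 0 * s)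
      + z.C * both (-1) (fun i => z.b * z.X i 1 2 + z.X i 3 0 * s))
    (fun _ _ => rfl) (fun _ => rfl) (by intros; simp only [both]; ring)
  have h8 := sum_even_odd z.X10 z.X01 (n + 1)
    (z.C' * both (-1) (fun i => z.X i 0 2 * z.Y i 0 1 + z.X i 1 1 * z.Y i 1 0
        + z.X i 2 0 * z.Y i 0 1)
      + z.C * both (-1) (fun i => z.X i 2 1 + z.X i 0 3))
    (fun _ _ => rfl)
  have h9 := z.sum_pred_even hM2
    (fun _ => both (-1) (fun i => z.X i 0 2 * z.X i 1 1 + z.X i 1 1 * z.X i 2 0))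
    (by intros; ring)
  have h10 := z.sum_pred_odd hM2
    (fun s => both (-1) (fun i => z.b * z.X i 0 2 ^ 2 + 2 * z.b * z.X i 0 2 * z.X i 2 0
      + z.b * z.X i 1 1 ^ 2 + z.X i 2 0 ^ 2 * s))
    (by intros; simp only [both]; ring)
  rw [octet_even]
  · simp only [leadII2, Nat.add_sub_cancel]
    rw [h1, h2, h3, h4, h5, h6, h7, h8, h9, h10, z.v_sq_mul_div_D hD, z.v_sq_mul_div_D hD]
    clear h1 h2 h3 h4 h5 h6 h7 h8 h9 h10
    simp only [both, T1, T2, formA_one_zero, formA_zero_one, formA_one_one, formA_one_neg_one,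
      formB, formE, formY1, formY2, z.v_eq_V_mul_D hD, mul_add 2 n 1, mul_one,
      Nat.add_sub_cancel, show 2 * n + 2 + 1 - 2 = 2 * n + 1 from rfl]
    simp only [show 2 * n + 2 + 1 + 1 = 2 * n + 4 from rfl,
      show 2 * n + 2 + 1 + 2 = 2 * n + 5 from rfl, show 2 * n + 2 + 1 = 2 * n + 3 from rfl,
      pow_add _ (2 * n)]
    generalize (2 : ℝ) ^ (2 * n) = q
    generalize (z.X10 + z.X01) ^ (2 * n) = p1
    generalize (z.X10 - z.X01) ^ (2 * n) = p2
    generalize z.X10 ^ (2 * n) = p3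
    generalize z.X01 ^ (2 * n) = p4
    generalize z.X10 + z.X01 = s
    generalize z.X10 - z.X01 = d
    push_cast
    ring
  · intro σ κ
    rw [T1_neg, T1_neg, T2_neg, T2_neg, (odd_two_mul_add_one _).neg_one_pow]
    ring

theorem leadII2_eq (hD : z.D ≠ 0) (H : ℝ) (m' : ℕ) :
    z.leadII2 m' = 2 * z.D / 2 ^ (2 * m' + 1) * octet z.b fun σ κ =>
      σ * z.V / 2 * ((z.T2 (2 * m' + 1) H 0 σ κ - z.T2 (2 * m' + 1) H 1 σ κ)
        - κ * z.V / 2 * (z.T1 (2 * m' + 1) 0 σ κ - z.T1 (2 * m' + 1) 1 σ κ)) := by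
  rcases m' with _ | n
  · exact z.leadII2_zero_eq hD H
  · exact z.leadII2_succ_eq hD H n

end SiteData
end Multibaker

namespace Multibaker

/-! ### The continuum limit at one site -/

/-- The increment may have either sign, hence the unordered interval; d = 0 is treated apart because
the interval degenerates. -/
theorem exists_taylor_three {φ : ℝ → ℝ} {a d : ℝ}
    (hφ : ∀ x ∈ Set.uIcc a (a + d), ContDiffAt ℝ 3 φ x) :
    ∃ ξ ∈ Set.uIcc a (a + d), φ (a + d) = iteratedDeriv 0 φ a + d * iteratedDeriv 1 φ a
      + d ^ 2 / 2 * iteratedDeriv 2 φ a + d ^ 3 / 6 * iteratedDeriv 3 φ ξ := by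
  rcases eq_or_ne d 0 with rfl | hd
  · exact ⟨a, Set.left_mem_uIcc, by simp⟩
  have hne : a ≠ a + d := by simpa using hd
  obtain ⟨ξ, hξ, h⟩ := taylor_mean_remainder_lagrange_iteratedDeriv (n := 2) hne
    (f := φ) fun x hx => ((hφ x hx).of_le (by norm_num)).contDiffWithinAt
  refine ⟨ξ, Set.Ioo_subset_Icc_self hξ, ?_⟩
  have hi : ∀ i ≤ 3, iteratedDerivWithin i φ (Set.uIcc a (a + d)) a = iteratedDeriv i φ a :=
    fun i hi => iteratedDerivWithin_eq_iteratedDeriv (uniqueDiffOn_uIcc hne)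
      ((hφ a Set.left_mem_uIcc).of_le (by exact_mod_cast hi)) Set.left_mem_uIcc
  rw [taylor_within_apply, Finset.sum_range_succ, Finset.sum_range_succ, Finset.sum_range_one,
    hi 0 (by norm_num), hi 1 (by norm_num), hi 2 (by norm_num)] at h
  simp only [smul_eq_mul, add_sub_cancel_left, Nat.factorial] at h
  norm_num at h ⊢
  linarith

theorem continuousAt_iteratedDeriv {C : ℝ → ℝ} {x : ℝ} (hC : ContDiffAt ℝ (⊤ : ℕ∞) C x) (i : ℕ) :
    ContinuousAt (iteratedDeriv i C) x := by
  rw [iteratedDeriv_eq_equiv_comp]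
  exact (LinearIsometryEquiv.continuous _).continuousAt.comp
    (hC.iteratedFDeriv_right (m := 0) (i := i)
      (by rw [zero_add]; exact_mod_cast le_top)).continuousAt

/-- Site data with given density derivatives `q 0`, …, `q 3`. -/
def SiteData.ofProfile (v D b Pe ε δ : ℝ) (C : ℝ → ℝ) (q : ℕ → ℝ) : SiteData where
  v := v
  D := D
  b := b
  Pe := Pe
  ε := ε
  δ := δ
  ρ := q 0
  ρr := q 1
  ρrr := q 2
  ρrrr := q 3
  C := C (q 0)
  C' := iteratedDeriv 1 C (q 0)
  C'' := iteratedDeriv 2 C (q 0)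

/-- The Péclet numbers are unconstrained, as `TendsTo` does not read them. -/
theorem SiteData.tendsTo_ofProfile {ι : Type} {F : Filter ι} (v D ε δ Pe₀ : ℝ) {b : ι → ℝ} {b₀ : ℝ}
    (Pe : ι → ℝ) {C : ℝ → ℝ} {q : ι → ℕ → ℝ} {q₀ : ℕ → ℝ} (hb : Tendsto b F (𝓝 b₀))
    (hq : ∀ a ≤ 3, Tendsto (fun j => q j a) F (𝓝 (q₀ a)))
    (hC : ContDiffAt ℝ (⊤ : ℕ∞) C (q₀ 0)) :
    SiteData.TendsTo (fun j => ofProfile v D (b j) (Pe j) ε δ C (q j)) F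
      (ofProfile v D b₀ Pe₀ ε δ C q₀) where
  v _ := rfl
  D _ := rfl
  b := hb
  ρ := hq 0 (by norm_num)
  ρr := hq 1 (by norm_num)
  ρrr := hq 2 (by norm_num)
  ρrrr := hq 3 le_rfl
  C := hC.continuousAt.tendsto.comp (hq 0 (by norm_num))
  C' := (continuousAt_iteratedDeriv hC 1).tendsto.comp (hq 0 (by norm_num))
  C'' := (continuousAt_iteratedDeriv hC 2).tendsto.comp (hq 0 (by norm_num))

namespace HasContinuumLimit

variable {D v : ℝ} {k : ℕ} {S : ℕ → UOFPChain D v k} {u : ℕ → ℝ → ℝ → ℝ} {ρ : ℝ → ℝ → ℝ}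
  {r t : ℝ} {F : Filter ℕ} {x s : ℕ → ℝ}

theorem tendsto_iteratedDeriv (hu : HasContinuumLimit S u ρ r t) (hF : F ≤ atTop)
    (hx : Tendsto x F (𝓝 r)) (hs : Tendsto s F (𝓝 t)) {a : ℕ} (ha : a ≤ 3) :
    Tendsto (fun j => iteratedDeriv a (fun y => u j y (s j)) (x j)) F
      (𝓝 (iteratedDeriv a (fun y => ρ y t) r)) :=
  (hu.conv a ha).comp ((tendsto_id'.2 hF).prodMk (hx.prodMk_nhds hs))

/-- The intermediate points of Lagrange's remainder are squeezed to r, and third derivatives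
converge along moving points; so the coefficient of the cubic term converges. -/
theorem eventually_taylor (hu : HasContinuumLimit S u ρ r t) (hF : F ≤ atTop)
    (hx : Tendsto x F (𝓝 r)) (hs : Tendsto s F (𝓝 t)) {d : ℕ → ℝ} (hd : Tendsto d F (𝓝 0)) :
    ∃ T : ℕ → ℝ, Tendsto T F (𝓝 (iteratedDeriv 3 (fun y => ρ y t) r)) ∧ ∀ᶠ j in F,
      u j (x j + d j) (s j) = iteratedDeriv 0 (fun y => u j y (s j)) (x j)
        + d j * iteratedDeriv 1 (fun y => u j y (s j)) (x j)
        + d j ^ 2 / 2 * iteratedDeriv 2 (fun y => u j y (s j)) (x j) + d j ^ 3 / 6 * T j := by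
  classical
  have hsm := hu.smooth
  rw [nhds_prod_eq] at hsm
  obtain ⟨p1, hp1, p2, hp2, h12⟩ := eventually_prod_iff.1 hsm
  obtain ⟨p3, hp3, p4, hp4, h34⟩ := eventually_prod_iff.1 hp2
  obtain ⟨R, hR, hball⟩ := Metric.eventually_nhds_iff_ball.1 hp3
  have hxd : Tendsto (fun j => x j + d j) F (𝓝 r) := by simpa using hx.add hd
  have hex : ∀ᶠ j in F, ∃ ξ ∈ Set.uIcc (x j) (x j + d j), u j (x j + d j) (s j)
      = iteratedDeriv 0 (fun y => u j y (s j)) (x j)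
        + d j * iteratedDeriv 1 (fun y => u j y (s j)) (x j)
        + d j ^ 2 / 2 * iteratedDeriv 2 (fun y => u j y (s j)) (x j)
        + d j ^ 3 / 6 * iteratedDeriv 3 (fun y => u j y (s j)) ξ := by
    filter_upwards [hF hp1, hx.eventually (Metric.ball_mem_nhds r hR),
      hxd.eventually (Metric.ball_mem_nhds r hR), hs.eventually hp4] with j h1 h2 h3 h4
    refine exists_taylor_three (φ := fun y => u j y (s j)) fun y hy => ?_
    have hy' : y ∈ Metric.ball r R := (convex_ball r R).ordConnected.uIcc_subset h2 h3 hy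
    exact h12 h1 (h34 (hball y hy') h4)
  -- The default `x j` is used only for indices without an intermediate point; eventually there are
  -- none along `F`.
  let ξ : ℕ → ℝ := fun j => if h : ∃ ξ ∈ Set.uIcc (x j) (x j + d j), u j (x j + d j) (s j)
      = iteratedDeriv 0 (fun y => u j y (s j)) (x j)
        + d j * iteratedDeriv 1 (fun y => u j y (s j)) (x j)
        + d j ^ 2 / 2 * iteratedDeriv 2 (fun y => u j y (s j)) (x j)
        + d j ^ 3 / 6 * iteratedDeriv 3 (fun y => u j y (s j)) ξ then h.choose else x j
  have hξ : Tendsto ξ F (𝓝 r) := by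
    have h0 : Tendsto (fun j => ξ j - x j) F (𝓝 0) := by
      refine squeeze_zero_norm' ?_ (by simpa using hd.norm)
      filter_upwards [hex] with j hj
      have hm : ξ j ∈ Set.uIcc (x j) (x j + d j) := by
        simp only [ξ, dif_pos hj]
        exact hj.choose_spec.1
      have := Set.abs_sub_left_of_mem_uIcc hm
      simpa using this
    simpa using h0.add hx
  refine ⟨fun j => iteratedDeriv 3 (fun y => u j y (s j)) (ξ j),
    hu.tendsto_iteratedDeriv hF hξ hs le_rfl, ?_⟩
  filter_upwards [hex] with j hj
  simp only [ξ, dif_pos hj]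
  exact hj.choose_spec.2

/-- The factor `G` absorbs the gains of the shared symbols. It multiplies the profile and all its
derivatives, and being asymptotically 1 it leaves the limiting data unchanged. -/
theorem isLocalLimit (hu : HasContinuumLimit S u ρ r t) (hD : 0 < D) (hF : F ≤ atTop)
    (hdr : Tendsto (fun j => (S j).dr) F (𝓝 0)) {b : ℝ}
    (hb : Tendsto (fun j => (S j).beta) F (𝓝 b))
    (hx : Tendsto x F (𝓝 r)) (hs : Tendsto s F (𝓝 t)) {G : ℕ → ℝ} (hG : Tendsto G F (𝓝 1))
    {J : Set ℝ} (hJ : IsOpen J) (hρ : ρ r t ∈ J) {f : ℝ → ℝ → ℝ} {m : ℕ} {C : ℝ → ℝ}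
    (hf : IsT1Function J f m C) (ε δ : ℝ) :
    IsLocalLimit F S (fun j y => G j * u j (x j + y) (s j))
      (fun j => SiteData.ofProfile v D (S j).beta 0 ε δ C
        fun a => G j * iteratedDeriv a (fun y => u j y (s j)) (x j))
      (SiteData.ofProfile v D b 0 ε δ C fun a => iteratedDeriv a (fun y => ρ y t) r) J f m C where
  D_pos := hD
  v_eq := rfl
  D_eq := rfl
  dr := hdr
  b_eq _ := rfl
  data := by
    refine SiteData.tendsTo_ofProfile v D ε δ 0 (fun _ => 0) hb (fun a ha => ?_) ?_
    · simpa using hG.mul (hu.tendsto_iteratedDeriv hF hx hs ha)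
    · simpa using (hf.exists_expansion hJ hρ).1
  profile := by
    intro c
    obtain ⟨T, hT, hT'⟩ := hu.eventually_taylor hF hx hs (d := fun j => c * (S j).dr)
      (by simpa using hdr.const_mul c)
    refine ⟨fun j => G j * T j, by simpa using! hG.mul hT, ?_⟩
    filter_upwards [hT'] with j hj
    simp only [SiteData.ofProfile]
    rw [hj]
    ring
  isOpen := hJ
  mem := by simpa [SiteData.ofProfile] using hρ
  t1 := hf
  C_eq _ := rfl
  C'_eq _ := rfl
  C''_eq := rfl

end HasContinuumLimit
end Multibaker

namespace Multibaker

/-! ### Continuity of the leading coefficients -/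

namespace SiteData.TendsTo

variable {ι : Type} {z : ι → SiteData} {F : Filter ι} {w : SiteData}

theorem V (hz : TendsTo z F w) (j : ι) : (z j).V = w.V := by
  rw [SiteData.V, SiteData.V, hz.v, hz.D]

/-- Convergence is read off from the form as a sum over branches, where β occurs only in the weights
of `octet`. -/
theorem leadI1 (hz : TendsTo z F w) {m' : ℕ} (hm : 0 < m') :
    Tendsto (fun j => (z j).leadI1 m') F (𝓝 (w.leadI1 m')) := by
  simp only [SiteData.leadI1_eq _ hm, hz.D]
  exact (tendsto_octet hz.b fun σ κ => (hz.T0 _ σ κ).const_mul 2).const_mul _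

theorem leadII1_plus (hz : TendsTo z F w) (hD : w.D ≠ 0) {ε : ℝ} (hε : ∀ j, (z j).ε = ε)
    (hε' : w.ε = ε) (hδ : ∀ j, (z j).δ = 1) (hδ' : w.δ = 1) (m' : ℕ) :
    Tendsto (fun j => (z j).leadII1 m') F (𝓝 (w.leadII1 m')) := by
  have h : ∀ j, (z j).leadII1 m' = _ := fun j =>
    (z j).leadII1_eq_plus (by rwa [hz.D]) (hδ j) m'
  simp only [h, w.leadII1_eq_plus hD hδ', hz.D, hz.V, hε, hε']
  exact (tendsto_octet hz.b fun σ κ =>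
    ((hz.T1 _ 0 σ κ).sub ((hz.T1 _ 1 σ κ).const_mul _)).sub
      (((hz.T0 _ σ κ).const_mul _).const_mul _)).const_mul _

theorem leadII1_minus (hz : TendsTo z F w) (hD : w.D ≠ 0) (hε : ∀ j, (z j).ε = -1)
    (hε' : w.ε = -1) (hδ : ∀ j, (z j).δ = -1) (hδ' : w.δ = -1) (m' : ℕ) :
    Tendsto (fun j => (z j).leadII1 m') F (𝓝 (w.leadII1 m')) := by
  have h : ∀ j, (z j).leadII1 m' = _ := fun j =>
    (z j).leadII1_eq_minus (by rwa [hz.D]) (hε j) (hδ j) m'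
  simp only [h, w.leadII1_eq_minus hD hε' hδ', hz.D, hz.V]
  exact (tendsto_octet hz.b fun σ κ => ((hz.T0 _ σ κ).const_mul _).const_mul _).const_mul _

theorem leadI2_plus (hz : TendsTo z F w) (hD : w.D ≠ 0) (hε : ∀ j, (z j).ε = -1)
    (hε' : w.ε = -1) (hδ : ∀ j, (z j).δ = 1) (hδ' : w.δ = 1) (m' : ℕ) :
    Tendsto (fun j => (z j).leadI2 m') F (𝓝 (w.leadI2 m')) := by
  -- The coefficient is the same for every value of the auxiliary number `H`, so 0 is taken.
  have h : ∀ j, (z j).leadI2 m' = _ := fun j =>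
    (z j).leadI2_eq_plus (by rwa [hz.D]) (hε j) (hδ j) 0 m'
  simp only [h, w.leadI2_eq_plus hD hε' hδ' 0, hz.D, hz.V, hε, hε']
  exact (tendsto_octet hz.b fun σ κ =>
    ((hz.T2 _ 0 0 σ κ).add ((hz.T2 _ 0 1 σ κ).const_mul _)).sub
      (((hz.T1 _ 0 σ κ).add ((hz.T1 _ 1 σ κ).const_mul _)).const_mul _)).const_mul _

theorem leadI2_minus (hz : TendsTo z F w) (hD : w.D ≠ 0) {ε : ℝ} (hε : ∀ j, (z j).ε = ε)
    (hε' : w.ε = ε) (hδ : ∀ j, (z j).δ = -1) (hδ' : w.δ = -1) (m' : ℕ) :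
    Tendsto (fun j => (z j).leadI2 m') F (𝓝 (w.leadI2 m')) := by
  have h : ∀ j, (z j).leadI2 m' = _ := fun j =>
    (z j).leadI2_eq_minus (by rwa [hz.D]) (hδ j) m'
  simp only [h, w.leadI2_eq_minus hD hδ', hz.D, hz.V, hε, hε']
  exact (tendsto_octet hz.b fun σ κ =>
    (((hz.T1 _ 0 σ κ).add ((hz.T1 _ 1 σ κ).const_mul _)).sub
      (((hz.T0 _ σ κ).const_mul _).const_mul _)).const_mul _).const_mul _

theorem leadII2 (hz : TendsTo z F w) (hD : w.D ≠ 0) (m' : ℕ) :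
    Tendsto (fun j => (z j).leadII2 m') F (𝓝 (w.leadII2 m')) := by
  have h : ∀ j, (z j).leadII2 m' = _ := fun j => (z j).leadII2_eq (by rwa [hz.D]) 0 m'
  simp only [h, w.leadII2_eq hD 0, hz.D, hz.V]
  exact (tendsto_octet hz.b fun σ κ =>
    (((hz.T2 _ 0 0 σ κ).sub (hz.T2 _ 0 1 σ κ)).sub
      (((hz.T1 _ 0 σ κ).sub (hz.T1 _ 1 σ κ)).const_mul _)).const_mul _).const_mul _

end SiteData.TendsTo

/-! ### The limit of the site average -/

namespace UOFPChain

variable {D v : ℝ} {k : ℕ}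

theorem sum_prod_νb (S : UOFPChain D v k) (p : ℕ) :
    ∑ a : Fin p → Fin 3, ∏ i, S.νb (a i) = 1 := by
  rw [← Fintype.sum_pow, S.sum_νb, one_pow]

theorem prod_νb_pos (S : UOFPChain D v k) {p : ℕ} (a : Fin p → Fin 3) : 0 < ∏ i, S.νb (a i) :=
  Finset.prod_pos fun _ _ => S.νb_pos _

theorem prod_νb_le_one (S : UOFPChain D v k) {p : ℕ} (a : Fin p → Fin 3) :
    ∏ i, S.νb (a i) ≤ 1 := by
  rw [← S.sum_prod_νb p]
  exact Finset.single_le_sum (f := fun a : Fin p → Fin 3 => ∏ i, S.νb (a i))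
    (fun a _ => (S.prod_νb_pos a).le) (Finset.mem_univ a)

/-- Positivity of the staying probability means β < 1, that is τ < Δr²/(2D). Hence a delay of a
fixed number of steps is invisible in the limit. -/
theorem tendsto_tau {S : ℕ → UOFPChain D v k} {F : Filter ℕ} (hD : 0 < D)
    (hdr : Tendsto (fun j => (S j).dr) F (𝓝 0)) : Tendsto (fun j => (S j).tau) F (𝓝 0) := by
  refine squeeze_zero (fun j => (S j).tau_pos.le) (g := fun j => (S j).dr ^ 2 / (2 * D))
    (fun j => ?_) (by simpa using (hdr.pow 2).div_const (2 * D))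
  have h := (S j).beta_lt_one
  have hd := (S j).dr_pos
  change 2 * (S j).tau * D / (S j).dr ^ 2 < 1 at h
  rw [div_lt_one (by positivity)] at h
  rw [le_div_iff₀ (by positivity)]
  linarith

theorem tendsto_gain {S : ℕ → UOFPChain D v k} {F : Filter ℕ}
    (hdr : Tendsto (fun j => (S j).dr) F (𝓝 0)) (ω : Fin 3) :
    Tendsto (fun j => (S j).gain ω) F (𝓝 1) := by
  have hp : Tendsto (fun j => (S j).peclet) F (𝓝 0) := by
    simpa [peclet, pecletOf] using (hdr.const_mul v).div_const D
  have h := (((hp.const_mul (disp ω)).div_const 2).const_add 1).div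
    (((hp.const_mul (disp ω)).div_const 2).const_sub 1) (by simp)
  simpa [gain_eq, gainFun] using! h

end UOFPChain

/-- The weights need not converge; it suffices that they are bounded and sum to 1 while all terms
have the same limit. -/
theorem tendsto_weighted_sum {ι α : Type} [Fintype α] {F : Filter ι} {p B : ι → α → ℝ} {c : ℝ}
    (h0 : ∀ j a, 0 ≤ p j a) (h1 : ∀ j a, p j a ≤ 1) (hp : ∀ j, ∑ a, p j a = 1)
    (hB : ∀ a, Tendsto (fun j => B j a) F (𝓝 c)) :
    Tendsto (fun j => ∑ a, p j a * B j a) F (𝓝 c) := by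
  have h : Tendsto (fun j => ∑ a, p j a * (B j a - c)) F (𝓝 0) := by
    rw [← Finset.sum_const_zero (s := (Finset.univ : Finset α)) (ι := α) (M := ℝ)]
    refine tendsto_finsetSum _ fun a _ => ?_
    refine squeeze_zero_norm (a := fun j => ‖B j a - c‖) (fun j => ?_) ?_
    · rw [norm_mul, Real.norm_of_nonneg (h0 j a)]
      exact mul_le_of_le_one_left (norm_nonneg _) (h1 j a)
    · simpa using ((hB a).sub_const c).norm
  have h' := h.add_const c
  rw [zero_add] at h'
  refine h'.congr fun j => ?_
  simp only [mul_sub, Finset.sum_sub_distrib, ← Finset.sum_mul, hp]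
  ring

/-- Neither the normalised quantity nor the coefficient need converge along the sequence. Only their
difference has to tend to zero, and this may be tested on ultrafilters, where each is asked to have
a limit. -/
theorem isLittleO_of_ultrafilter {A Λ g : ℕ → ℝ} (hg : ∀ j, 0 < g j)
    (h : ∀ F : Ultrafilter ℕ, (F : Filter ℕ) ≤ atTop → ∃ c : ℝ,
      Tendsto (fun j => A j / g j) F (𝓝 c) ∧ Tendsto Λ F (𝓝 c)) :
    (fun j => A j - Λ j * g j) =o[atTop] g := by
  rw [Asymptotics.isLittleO_iff_tendsto fun j hj => absurd hj (hg j).ne', tendsto_iff_ultrafilter]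
  intro F hF
  obtain ⟨c, h1, h2⟩ := h F hF
  have := h1.sub h2
  rw [sub_self] at this
  refine this.congr fun j => ?_
  have := (hg j).ne'
  field_simp

/-- The common reduction for all cases: what remains for each is the continuity of the coefficient
and the limit of a single branch sum. -/
theorem isLittleO_siteAverage {D v : ℝ} (hD : 0 < D) {k : ℕ} (hk : 1 ≤ k)
    {S : ℕ → UOFPChain D v k} (hdr : Tendsto (fun j => (S j).dr) atTop (𝓝 0))
    {u : ℕ → ℝ → ℝ → ℝ} {ρ : ℝ → ℝ → ℝ} {r t : ℝ} (hu : HasContinuumLimit S u ρ r t)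
    {n : ∀ j, Fin ((S j).N + 1)} {l : ℕ → ℕ} (hbulk : ∀ j, (S j).IsBulk (l j) (n j))
    (hr : Tendsto (fun j => ((n j : ℕ) : ℝ) * (S j).dr) atTop (𝓝 r))
    (ht : Tendsto (fun j => (l j : ℝ) * (S j).tau) atTop (𝓝 t))
    {J : Set ℝ} (hJ : IsOpen J) (hρJ : ρ r t ∈ J) {f : ℝ → ℝ → ℝ} {m : ℕ} {C : ℝ → ℝ}
    (hf : IsT1Function J f m C) (ε δ : ℝ) {g : ℕ → ℝ} (hg : ∀ j, 0 < g j) (Λ : SiteData → ℝ)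
    (hΛ : ∀ (F : Filter ℕ) (z : ℕ → SiteData) (w : SiteData), SiteData.TendsTo z F w → w.D = D →
      (∀ j, (z j).ε = ε) → w.ε = ε → (∀ j, (z j).δ = δ) → w.δ = δ →
        Tendsto (fun j => Λ (z j)) F (𝓝 (Λ w)))
    (hlim : ∀ (F : Filter ℕ) (Q : ℕ → ℝ → ℝ) (z : ℕ → SiteData) (w : SiteData),
      IsLocalLimit F S Q z w J f m C → w.ε = ε → w.δ = δ →
        Tendsto (fun j => (S j).branchSum f ε δ (Q j) / (S j).tau / g j) F (𝓝 (Λ w))) :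
    (fun j => (S j).siteAverage f ε δ (l j) (n j)
      - Λ ((S j).siteData (u j) C ε δ (l j) (n j)) * g j) =o[atTop] g := by
  obtain ⟨k, rfl⟩ : ∃ k', k = k' + 1 := ⟨k - 1, by omega⟩
  have hl : ∀ j, l j = (l j - (k + 1)) + (k + 1) := fun j => by
    have := (hbulk j).2.2
    omega
  refine isLittleO_of_ultrafilter hg fun F hF => ?_
  -- As β lies in the compact interval [0, 1], it converges along the ultrafilter.
  obtain ⟨b, -, hb⟩ := (isCompact_Icc (a := (0 : ℝ)) (b := 1)).ultrafilter_le_nhds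
    (F.map fun j => (S j).beta) (le_principal_iff.2 (Ultrafilter.mem_map.2
      (univ_mem' fun j => ⟨(S j).beta_pos.le, (S j).beta_lt_one.le⟩)))
  replace hb : Tendsto (fun j => (S j).beta) F (𝓝 b) := hb
  have hdr' := hdr.mono_left hF
  have hr' := hr.mono_left hF
  have ht' := ht.mono_left hF
  have hC := (hf.exists_expansion hJ hρJ).1
  refine ⟨Λ (SiteData.ofProfile v D b 0 ε δ C fun a => iteratedDeriv a (fun y => ρ y t) r), ?_, ?_⟩
  · have hs : Tendsto (fun j => ((l j - (k + 1) : ℕ) : ℝ) * (S j).tau) F (𝓝 t) := by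
      have h := ht'.sub ((UOFPChain.tendsto_tau hD hdr').const_mul ((k : ℝ) + 1))
      rw [mul_zero, sub_zero] at h
      refine h.congr fun j => ?_
      have := congrArg (Nat.cast (R := ℝ)) (hl j)
      push_cast at this
      rw [this]
      ring
    have hx : ∀ a : Fin k → Fin 3,
        Tendsto (fun j => ((n j : ℕ) - ∑ i, disp (a i)) * (S j).dr) F (𝓝 r) := by
      intro a
      simpa [sub_mul] using hr'.sub (hdr'.const_mul (∑ i, disp (a i)))
    have hG : ∀ a : Fin k → Fin 3, Tendsto (fun j => ∏ i, (S j).gain (a i)) F (𝓝 1) := by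
      intro a
      simpa using tendsto_finsetProd Finset.univ fun i _ => UOFPChain.tendsto_gain hdr' (a i)
    -- Each shared word has its own centre and prefactor, but all centres tend to r and all
    -- prefactors to 1, so the branch sums have one and the same limit.
    have key := tendsto_weighted_sum (fun j (a : Fin k → Fin 3) => ((S j).prod_νb_pos a).le)
      (fun j a => (S j).prod_νb_le_one a) (fun j => (S j).sum_prod_νb k) fun a =>
        hlim F _ _ _ (hu.isLocalLimit hD hF hdr' hb (hx a) hs (hG a) hJ hρJ hf ε δ) rfl rfl
    refine key.congr fun j => ?_
    have hb' := hbulk j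
    rw [hl j] at hb' ⊢
    rw [(S j).siteAverage_eq f ε δ _ (n j) hb' (u j) (hu.interp j), ← hl j, Finset.mul_sum,
      Finset.sum_div]
    refine Finset.sum_congr rfl fun a _ => ?_
    ring
  -- The coefficient is evaluated at (nΔr, lτ), not at the shifted and delayed centres; the limiting
  -- data are nevertheless the same.
  · have hz := SiteData.tendsTo_ofProfile (F := F) v D ε δ 0 (fun j => (S j).peclet) (C := C) hb
      (q := fun j a => iteratedDeriv a (fun y => u j y (l j * (S j).tau)) ((n j : ℕ) * (S j).dr))
      (q₀ := fun a => iteratedDeriv a (fun y => ρ y t) r)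
      (fun a ha => hu.tendsto_iteratedDeriv hF hr' ht' ha) (by simpa using hC)
    refine (hΛ F _ _ hz rfl (fun _ => rfl) rfl (fun _ => rfl) rfl).congr fun j => ?_
    congr 1
    simp only [SiteData.ofProfile, UOFPChain.siteData, iteratedDeriv_zero, hu.interp]

end Multibaker

namespace Multibaker

/-! ### The leading terms of the branch sums -/

namespace IsLocalLimit

variable {D v : ℝ} {k : ℕ} {ι : Type} {F : Filter ι} {S : ι → UOFPChain D v k}
  {Q : ι → ℝ → ℝ} {z : ι → SiteData} {w : SiteData} {J : Set ℝ} {f : ℝ → ℝ → ℝ} {m : ℕ}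
  {C : ℝ → ℝ}

theorem D_ne_zero (hS : IsLocalLimit F S Q z w J f m C) : w.D ≠ 0 := by
  rw [hS.D_eq]
  exact hS.D_pos.ne'

theorem tendsto_pairTerm_zero (hS : IsLocalLimit F S Q z w J f 0 C) (hC : w.C = C w.ρ) (σ κ : ℝ) :
    Tendsto (fun j => pairTerm f 1 (S j).peclet (S j).dr (Q j) σ κ) F (𝓝 (2 * w.C)) := by
  have hc : ContinuousAt (fun p : ℝ × ℝ => f p.1 p.2) (w.ρ, w.ρ) :=
    hS.t1.smooth.continuousOn.continuousAt
      ((hS.isOpen.prod hS.isOpen).mem_nhds ⟨hS.mem, hS.mem⟩)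
  have hfC : f w.ρ w.ρ = w.C := by
    -- For m = 0 the denominator is 1, and continuity identifies the characteristic function with f
    -- on the diagonal.
    have h := hS.t1.char_lim w.ρ hS.mem 1 0 zero_ne_one
    simp only [one_mul, zero_mul, add_zero, pow_zero, div_one] at h
    rw [hC]
    refine tendsto_nhds_unique (Tendsto.mono_left ?_ nhdsWithin_le_nhds) h
    have hx : ContinuousAt (fun a : ℝ => (w.ρ + a, w.ρ)) 0 := by fun_prop
    have := ContinuousAt.comp (f := fun a : ℝ => (w.ρ + a, w.ρ)) (x := 0)
      (g := fun p : ℝ × ℝ => f p.1 p.2) (by simpa using hc) hx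
    simpa [ContinuousAt, Function.comp_def] using this
  have h1 := hc.tendsto.comp ((hS.tendsto_gain_mul σ 0).prodMk_nhds (hS.tendsto_gain_mul κ (-κ)))
  have h2 := hc.tendsto.comp
    ((hS.tendsto_gain_mul κ (-(σ + κ))).prodMk_nhds (hS.tendsto_gain_mul σ (-σ)))
  have h := h1.add h2
  simp only [hfC] at h
  rw [two_mul]
  refine h.congr fun j => ?_
  simp [pairTerm, hS.peclet_eq]

/-- Every pair tends to 2C, and the limiting weights sum to 2(1 - β)² + β(4(1 - β) + 2β) = 2 with β
at its limit. -/
theorem tendsto_branchSum_zero (hS : IsLocalLimit F S Q z w J f 0 C) :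
    Tendsto (fun j => (S j).branchSum f 1 1 (Q j)) F (𝓝 (4 * w.C)) := by
  -- Uniqueness of limits, used to identify `w.C`, needs a proper filter.
  rcases F.eq_or_neBot with rfl | hF
  · exact tendsto_bot
  have hC : w.C = C w.ρ := tendsto_nhds_unique hS.data.C <| by
    simp only [hS.C_eq]
    exact (hS.t1.exists_expansion hS.isOpen hS.mem).1.continuousAt.tendsto.comp hS.data.ρ
  have hb : Tendsto (fun j => (S j).beta) F (𝓝 w.b) := hS.data.b.congr hS.b_eq
  have hw : ∀ κ : ℝ, Tendsto (fun j => 1 - κ * (S j).peclet / 2) F (𝓝 1) := by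
    intro κ
    have hp : Tendsto (fun j => (S j).peclet) F (𝓝 0) := by
      simpa [hS.peclet_eq] using hS.dr.const_mul w.V
    simpa using ((hp.const_mul κ).div_const 2).const_sub 1
  have h := ((((hb.const_sub 1).pow 2).const_mul 2).mul (hS.tendsto_pairTerm_zero hC 0 0)).add
    (hb.mul (tendsto_octet hb fun σ κ => (hw κ).mul (hS.tendsto_pairTerm_zero hC σ κ)))
  convert! h using 2 with j
  · rw [UOFPChain.branchSum_eq]
    simp only [octet]
    ring
  · simp only [octet]
    ring

theorem tendsto_leadI1 {m' : ℕ} (hS : IsLocalLimit F S Q z w J f (2 * m') C) (hm : 0 < m') :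
    Tendsto (fun j => (S j).branchSum f 1 1 (Q j) / (S j).tau / (S j).dr ^ (2 * m' - 2)) F
      (𝓝 (w.leadI1 m')) := by
  obtain ⟨H, h, -⟩ := hS.tendsto_branchSum_plus 1 (Or.inl (by omega))
  rw [w.leadI1_eq hm, hS.D_eq]
  convert h (by omega) using 3
  refine congrArg _ (funext fun σ => funext fun κ => ?_)
  rw [(even_two_mul m').neg_one_pow]
  ring

theorem tendsto_leadII1_plus {m' : ℕ} (hS : IsLocalLimit F S Q z w J f (2 * m' + 1) C)
    (hδ : w.δ = 1) :
    Tendsto (fun j => (S j).branchSum f w.ε 1 (Q j) / (S j).tau / (S j).dr ^ (2 * m' + 1 - 1)) F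
      (𝓝 (w.leadII1 m')) := by
  obtain ⟨H, -, h, -⟩ := hS.tendsto_branchSum_plus w.ε (Or.inl (by omega))
  rw [w.leadII1_eq_plus hS.D_ne_zero hδ, hS.D_eq]
  convert h (odd_two_mul_add_one m') using 3
  refine congrArg _ (funext fun σ => funext fun κ => ?_)
  rw [(odd_two_mul_add_one m').neg_one_pow]
  ring

theorem tendsto_leadII1_minus {m' : ℕ} (hS : IsLocalLimit F S Q z w J f (2 * m' + 1) C)
    (hε : w.ε = -1) (hδ : w.δ = -1) :
    Tendsto (fun j => (S j).branchSum f (-1) (-1) (Q j) / (S j).tau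
      / (S j).dr ^ (2 * m' + 1 - 1)) F (𝓝 (w.leadII1 m')) := by
  obtain ⟨H, h, -⟩ := hS.tendsto_branchSum_minus (-1)
  rw [w.leadII1_eq_minus hS.D_ne_zero hε hδ, hS.D_eq]
  convert h (odd_two_mul_add_one m') using 3
  refine congrArg _ (funext fun σ => funext fun κ => ?_)
  rw [(odd_two_mul_add_one m').neg_one_pow]
  ring

theorem tendsto_leadI2_plus {m' : ℕ} (hS : IsLocalLimit F S Q z w J f (2 * m') C)
    (hε : w.ε = -1) (hδ : w.δ = 1) :
    Tendsto (fun j => (S j).branchSum f (-1) 1 (Q j) / (S j).tau / (S j).dr ^ (2 * m')) F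
      (𝓝 (w.leadI2 m')) := by
  obtain ⟨H, -, -, h⟩ := hS.tendsto_branchSum_plus (-1) (Or.inr rfl)
  rw [w.leadI2_eq_plus hS.D_ne_zero hε hδ H, hS.D_eq, hε]
  convert h (even_two_mul m') rfl using 3
  refine congrArg _ (funext fun σ => funext fun κ => ?_)
  rw [(even_two_mul m').neg_one_pow]
  ring

theorem tendsto_leadI2_minus {m' : ℕ} (hS : IsLocalLimit F S Q z w J f (2 * m') C)
    (hδ : w.δ = -1) :
    Tendsto (fun j => (S j).branchSum f w.ε (-1) (Q j) / (S j).tau / (S j).dr ^ (2 * m')) F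
      (𝓝 (w.leadI2 m')) := by
  obtain ⟨H, -, h, -⟩ := hS.tendsto_branchSum_minus w.ε
  rw [w.leadI2_eq_minus hS.D_ne_zero hδ, hS.D_eq]
  convert h (even_two_mul m') using 3
  refine congrArg _ (funext fun σ => funext fun κ => ?_)
  rw [(even_two_mul m').neg_one_pow]
  ring

theorem tendsto_leadII2 {m' : ℕ} (hS : IsLocalLimit F S Q z w J f (2 * m' + 1) C) :
    Tendsto (fun j => (S j).branchSum f 1 (-1) (Q j) / (S j).tau
      / (S j).dr ^ (2 * m' + 1 + 1)) F (𝓝 (w.leadII2 m')) := by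
  obtain ⟨H, -, -, h⟩ := hS.tendsto_branchSum_minus 1
  rw [w.leadII2_eq hS.D_ne_zero H, hS.D_eq]
  convert h (odd_two_mul_add_one m') rfl using 3
  refine congrArg _ (funext fun σ => funext fun κ => ?_)
  rw [(odd_two_mul_add_one m').neg_one_pow]
  ring

end IsLocalLimit
end Multibaker

end

theorem theorem2 (D v L : ℝ) (hD : 0 < D) (k : ℕ) (hk : 1 ≤ k)
    -- the continuum limit: chains of fixed length `L` with `Δr → 0`
    (S : ℕ → Multibaker.UOFPChain D v k)
    (hL : ∀ j, ((S j).N : ℝ) * (S j).dr = L)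
    (hdr : Filter.Tendsto (fun j => (S j).dr) Filter.atTop (nhds 0))
    -- the macroscopic density near the macroscopic position `r` and time `t`
    (u : ℕ → ℝ → ℝ → ℝ) (ρ : ℝ → ℝ → ℝ) (r t : ℝ)
    (hu : Multibaker.HasContinuumLimit S u ρ r t)
    -- bulk sites and time steps approaching `(r, t)`
    (n : ∀ j, Fin ((S j).N + 1)) (l : ℕ → ℕ)
    (hbulk : ∀ j, (S j).IsBulk (l j) (n j))
    (hr : Filter.Tendsto (fun j => ((n j : ℕ) : ℝ) * (S j).dr) Filter.atTop (nhds r))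
    (ht : Filter.Tendsto (fun j => (l j : ℝ) * (S j).tau) Filter.atTop (nhds t))
    -- the local quantity
    (J : Set ℝ) (hJ : IsOpen J) (hρJ : ρ r t ∈ J)
    (f : ℝ → ℝ → ℝ) (m : ℕ) (C : ℝ → ℝ) (hf : Multibaker.IsT1Function J f m C)
    (ε δ : ℝ) (hε : ε = 1 ∨ ε = -1) (hδ : δ = 1 ∨ δ = -1) :
    -- case I-1
    (m = 0 → ε = 1 → δ = 1 →
      (fun j => (S j).siteAverage f ε δ (l j) (n j)
          - 4 * C ((S j).siteDensity (l j) (n j)) / (S j).tau)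
        =o[Filter.atTop] (fun j => 1 / (S j).tau)) ∧
    (∀ m' : ℕ, 0 < m' → m = 2 * m' → ε = 1 → δ = 1 →
      (fun j => (S j).siteAverage f ε δ (l j) (n j)
          - ((S j).siteData (u j) C ε δ (l j) (n j)).leadI1 m' * (S j).dr ^ (m - 2))
        =o[Filter.atTop] (fun j => (S j).dr ^ (m - 2))) ∧
    -- case II-1
    (∀ m' : ℕ, m = 2 * m' + 1 → (ε = -1 ∨ δ = 1) →
      (fun j => (S j).siteAverage f ε δ (l j) (n j)
          - ((S j).siteData (u j) C ε δ (l j) (n j)).leadII1 m' * (S j).dr ^ (m - 1))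
        =o[Filter.atTop] (fun j => (S j).dr ^ (m - 1))) ∧
    -- case I-2
    (∀ m' : ℕ, m = 2 * m' → ¬(ε = 1 ∧ δ = 1) →
      (fun j => (S j).siteAverage f ε δ (l j) (n j)
          - ((S j).siteData (u j) C ε δ (l j) (n j)).leadI2 m' * (S j).dr ^ m)
        =o[Filter.atTop] (fun j => (S j).dr ^ m)) ∧
    -- case II-2
    (∀ m' : ℕ, m = 2 * m' + 1 → ¬(ε = -1 ∨ δ = 1) →
      (fun j => (S j).siteAverage f ε δ (l j) (n j)
          - ((S j).siteData (u j) C ε δ (l j) (n j)).leadII2 m' * (S j).dr ^ (m + 1))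
        =o[Filter.atTop] (fun j => (S j).dr ^ (m + 1))) := by
  have key := @Multibaker.isLittleO_siteAverage D v hD k hk S hdr u ρ r t hu n l hbulk hr ht J hJ
    hρJ f m C hf ε δ
  refine ⟨?_, ?_, ?_, ?_, ?_⟩
  · rintro rfl rfl rfl
    -- Normalising by 1/τ cancels the time step and leaves the bare branch sum.
    have h := key (g := fun j => 1 / (S j).tau) (fun j => one_div_pos.2 (S j).tau_pos)
      (fun z => 4 * z.C) (fun F z w hz _ _ _ _ _ => hz.C.const_mul 4)
      fun F Q z w hS _ _ => hS.tendsto_branchSum_zero.congr fun j => by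
        have := (S j).tau_pos.ne'
        field_simp
    refine h.congr_left fun j => ?_
    simp only [Multibaker.UOFPChain.siteData]
    ring
  · rintro m' hm rfl rfl rfl
    exact key (fun j => pow_pos (S j).dr_pos _) (fun z => z.leadI1 m')
      (fun F z w hz _ _ _ _ _ => hz.leadI1 hm) fun F Q z w hS _ _ => hS.tendsto_leadI1 hm
  · rintro m' rfl hcase
    refine key (fun j => pow_pos (S j).dr_pos _) (fun z => z.leadII1 m') ?_ ?_
    · intro F z w hz hw hε₁ hε₂ hδ₁ hδ₂
      rcases hδ with rfl | rfl
      · exact hz.leadII1_plus (hw ▸ hD.ne') hε₁ hε₂ hδ₁ hδ₂ m'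
      · obtain rfl : ε = -1 := hcase.resolve_right (by norm_num)
        exact hz.leadII1_minus (hw ▸ hD.ne') hε₁ hε₂ hδ₁ hδ₂ m'
    · intro F Q z w hS hε₁ hδ₁
      rcases hδ with rfl | rfl
      · rw [← hε₁]
        exact hS.tendsto_leadII1_plus hδ₁
      · obtain rfl : ε = -1 := hcase.resolve_right (by norm_num)
        exact hS.tendsto_leadII1_minus hε₁ hδ₁
  · rintro m' rfl hcase
    refine key (fun j => pow_pos (S j).dr_pos _) (fun z => z.leadI2 m') ?_ ?_
    · intro F z w hz hw hε₁ hε₂ hδ₁ hδ₂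
      rcases hδ with rfl | rfl
      · obtain rfl : ε = -1 := hε.resolve_left fun h => hcase ⟨h, rfl⟩
        exact hz.leadI2_plus (hw ▸ hD.ne') hε₁ hε₂ hδ₁ hδ₂ m'
      · exact hz.leadI2_minus (hw ▸ hD.ne') hε₁ hε₂ hδ₁ hδ₂ m'
    · intro F Q z w hS hε₁ hδ₁
      rcases hδ with rfl | rfl
      · obtain rfl : ε = -1 := hε.resolve_left fun h => hcase ⟨h, rfl⟩
        exact hS.tendsto_leadI2_plus hε₁ hδ₁
      · rw [← hε₁]
        exact hS.tendsto_leadI2_minus hδ₁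
  · rintro m' rfl hcase
    rw [not_or] at hcase
    obtain rfl := hε.resolve_right hcase.1
    obtain rfl := hδ.resolve_left hcase.2
    exact key (fun j => pow_pos (S j).dr_pos _) (fun z => z.leadII2 m')
      (fun F z w hz hw _ _ _ _ => hz.leadII2 (hw ▸ hD.ne') m')
      fun F Q z w hS _ _ => hS.tendsto_leadII2
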